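/- Let $R$ be a commutative artinian ring, let $\Lambda$ be an artin $R$-algebra (an $R$-algebra that is finitely generated as an $R$-module), and let $n\ge 0$. Modules are left modules (not necessarily finitely generated) unless said otherwise. Let $D(\Lambda)=\mathrm{Hom}_R(\Lambda,E)$, where $E$ is the injective envelope of $R/J(R)$ and $J(R)$ is the Jacobson radical of $R$, with its natural $(\Lambda,\Lambda)$-bimodule structure. Let $\mathcal B_{D(\Lambda)}(\Lambda)$ be the Bass class: the class of all $\Lambda$-modules $M$ such that $\mathrm{Ext}^i_\Lambda(D(\Lambda),M)=0$ and $\mathrm{Tor}_i^\Lambda(D(\Lambda),\mathrm{Hom}_\Lambda(D(\Lambda),M))=0$ for all $i\ge1$, and the evaluation map $D(\Lambda)\otimes_\Lambda\mathrm{Hom}_\Lambda(D(\Lambda),M)\to M$ is an isomorphism. Let $\mathcal B^\bullet_{D(\Lambda)}(\Lambda)$ be the class of complexes $M^\bullet$ of $\Lambda$-modules with bounded cohomology such that $\mathbf R\mathrm{Hom}_\Lambda(D(\Lambda),M^\bullet)$ has bounded cohomology and the canonical morphism $D(\Lambda)\otimes^{\mathbf L}_\Lambda\mathbf R\mathrm{Hom}_\Lambda(D(\Lambda),M^\bullet)\to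 M^\bullet$ is an isomorphism in the derived category. The Bass injective dimension $\mathcal B^\bullet_{D(\Lambda)}(\Lambda)\text{-}\mathrm{id}\,M^\bullet$ is $\sup\{i\in\mathbb Z\mid H^i(\mathbf R\mathrm{Hom}_\Lambda(D(\Lambda),M^\bullet))\ne0\}$ if $M^\bullet\in\mathcal B^\bullet_{D(\Lambda)}(\Lambda)$, and $+\infty$ otherwise. A module is regarded as a complex concentrated in degree $0$, and $\mathrm{id}$ denotes injective dimension. Then the following statements are equivalent. 1. $\Lambda$ is Gorenstein (that is, $\mathrm{id}\,{}_\Lambda\Lambda=\mathrm{id}\,\Lambda_\Lambda<\infty$) with $\mathrm{id}\,{}_\Lambda\Lambda=\mathrm{id}\,\Lambda_\Lambda\le n$. 2. For every simple $\Lambda$-module $T$, $\mathcal B^\bullet_{D(\Lambda)}(\Lambda)\text{-}\mathrm{id}\,T\le n$. 3. For every simple $\Lambda$-module $T$, there is a quasi-isomorphism $T\to Y^\bullet$, where $Y^\bullet$ is a bounded complex of length at most $n+1$ (that is, $Y^i=0$ outside some $n+1$ consecutive degrees) all of whose terms belong to $\mathcal B_{D(\Lambda)}(\Lambda)$. 4.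 For every simple $\Lambda$-module $T$, there is an exact sequence $0\to T\to X^T\to W^T\to0$ of $\Lambda$-modules with $X^T\in\mathcal B_{D(\Lambda)}(\Lambda)$ and $\mathrm{id}_\Lambda W^T\le n-1$ (for $n=0$ this means $W^T=0$). 5. For every simple $\Lambda$-module $T$, there is an exact sequence $0\to X_T\to W_T\to T\to0$ of $\Lambda$-modules with $X_T\in\mathcal B_{D(\Lambda)}(\Lambda)$ and $\mathrm{id}_\Lambda W_T\le n$. -/

import Mathlib

open CategoryTheory CategoryTheory.Limits
open scoped TensorProduct

universe u

/-! ### Injective envelopes -/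

/-- `j : M → E` is an injective envelope of `M`: a monomorphism into an injective module such
that every nonzero submodule of `E` meets the image of `j` nontrivially. -/
structure IsInjectiveEnvelope {R : Type u} [Ring R] {M E : Type u} [AddCommGroup M] [Module R M]
    [AddCommGroup E] [Module R E] (j : M →ₗ[R] E) : Prop where
  injective_module : Module.Injective R E
  mono : Function.Injective j
  essential : ∀ N : Submodule R E, N ⊓ LinearMap.range j = ⊥ → N = ⊥

/-- Every module has an injective envelope: a maximal essential extension inside an
injective module. -/
theorem exists_isInjectiveEnvelope (R : Type u) [Ring R] (M : Type u) [AddCommGroup M]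
    [Module R M] : ∃ (E : ModuleCat.{u} R) (j : M →ₗ[R] E), IsInjectiveEnvelope j := by
  classical
  let I : ModuleCat.{u} R := Injective.under (ModuleCat.of R M)
  let k : M →ₗ[R] I := (Injective.ι (ModuleCat.of R M)).hom
  have hk : Function.Injective k := (ModuleCat.mono_iff_injective _).1 inferInstance
  have hI : Module.Injective R I := by
    have : Injective (ModuleCat.of R I) := (inferInstance : Injective I)
    exact Module.injective_module_of_injective_object R I
  let A : Submodule R I := LinearMap.range k
  let Ess : Set (Submodule R I) :=
    {N | A ≤ N ∧ ∀ x ∈ N, x ≠ 0 → ∃ r : R, r • x ∈ A ∧ r • x ≠ 0}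
  obtain ⟨E, -, hE⟩ := zorn_le_nonempty₀ Ess (by
    intro c hc hchain N hN
    refine ⟨sSup c, ⟨(hc hN).1.trans (le_sSup hN), ?_⟩, fun z hz => le_sSup hz⟩
    intro x hx hx0
    obtain ⟨P, hP, hxP⟩ :=
      (Submodule.mem_sSup_of_directed ⟨N, hN⟩ hchain.directedOn).1 hx
    exact (hc hP).2 x hxP hx0) A ⟨le_rfl, fun x hx hx0 => ⟨1, by simpa using hx, by simpa using hx0⟩⟩
  have hAE : A ≤ E := hE.prop.1
  have hess := hE.prop.2
  obtain ⟨C, -, hC⟩ := zorn_le_nonempty₀ {C : Submodule R I | ∀ x ∈ C, x ∈ E → x = 0} (by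
    intro c hc hchain N hN
    refine ⟨sSup c, ?_, fun z hz => le_sSup hz⟩
    intro x hx hxE
    obtain ⟨P, hP, hxP⟩ :=
      (Submodule.mem_sSup_of_directed ⟨N, hN⟩ hchain.directedOn).1 hx
    exact hc hP x hxP hxE) ⊥ (by intro x hx _; simpa using hx)
  have hCE := hC.prop
  have hq : Function.Injective (C.mkQ ∘ₗ E.subtype) := by
    rw [← LinearMap.ker_eq_bot, LinearMap.ker_eq_bot']
    rintro ⟨x, hx⟩ h
    have : x ∈ C := by simpa using h
    exact Subtype.ext (hCE x this hx)
  obtain ⟨h, hh⟩ := hI.out (C.mkQ ∘ₗ E.subtype) hq E.subtype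
  let p : I →ₗ[R] I := h ∘ₗ C.mkQ
  have hpE : ∀ x ∈ E, p x = x := fun x hx => hh ⟨x, hx⟩
  have hker : LinearMap.ker p ≤ C := hC.le_of_ge (y := LinearMap.ker p)
    (by
      intro x hx hxE
      rw [← hpE x hxE]
      simpa using hx)
    (by
      intro x hx
      have : C.mkQ x = 0 := by simpa using hx
      simp only [LinearMap.mem_ker, p, LinearMap.comp_apply, this, map_zero])
  have hpC : ∀ x ∈ C, p x = 0 := by
    intro x hx
    have : C.mkQ x = 0 := by simpa using hx
    simp only [p, LinearMap.comp_apply, this, map_zero]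
  have hrange : LinearMap.range p ≤ E := hE.le_of_ge (y := LinearMap.range p)
    (by
      refine ⟨fun x hx => ⟨x, hpE x (hAE hx)⟩, ?_⟩
      rintro _ ⟨i, rfl⟩ hi
      have hiC : i ∉ C := fun h' => hi (hpC i h')
      have hnot : ¬ ∀ x ∈ C ⊔ Submodule.span R {i}, x ∈ E → x = 0 := by
        intro hall
        have := hC.le_of_ge (y := C ⊔ Submodule.span R {i}) hall le_sup_left
        exact hiC (this (Submodule.mem_sup_right (Submodule.mem_span_singleton_self i)))
      push Not at hnot
      obtain ⟨e, he, heE, he0⟩ := hnot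
      obtain ⟨c, hc, z, hz, rfl⟩ := Submodule.mem_sup.1 he
      obtain ⟨r, rfl⟩ := Submodule.mem_span_singleton.1 hz
      have hr : r • p i = c + r • i := by
        rw [← hpE _ heE, map_add, hpC c hc, zero_add, map_smul]
      obtain ⟨s, hs, hs0⟩ := hess _ heE he0
      exact ⟨s * r, by rw [mul_smul, hr]; exact hs, by rw [mul_smul, hr]; exact hs0⟩)
    (fun x hx => ⟨x, hpE x hx⟩)
  refine ⟨ModuleCat.of R E, k.codRestrict E (fun m => hAE ⟨m, rfl⟩), ⟨?_, ?_, ?_⟩⟩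
  · constructor
    intro X Y _ _ _ _ f hf g
    obtain ⟨t, ht⟩ := hI.out f hf (E.subtype ∘ₗ g)
    refine ⟨(p.codRestrict E fun m => hrange ⟨m, rfl⟩) ∘ₗ t, fun x => Subtype.ext ?_⟩
    change p (t (f x)) = _
    rw [ht]
    exact hpE _ (g x).2
  · intro a b hab
    exact hk (congrArg Subtype.val hab)
  · intro N hN
    rw [Submodule.eq_bot_iff]
    rintro ⟨x, hx⟩ hxN
    by_contra hne
    have hx0 : x ≠ 0 := fun h' => hne (Subtype.ext h')
    obtain ⟨r, ⟨m, hm⟩, hr0⟩ := hess x hx hx0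
    have hmem : r • (⟨x, hx⟩ : E) ∈ N ⊓ LinearMap.range (k.codRestrict E fun m => hAE ⟨m, rfl⟩) :=
      ⟨N.smul_mem r hxN, ⟨m, Subtype.ext hm⟩⟩
    rw [hN] at hmem
    exact hr0 (congrArg Subtype.val ((Submodule.mem_bot R).1 hmem))

/-- The injective envelope `E⁰(M)` of a module `M` (unique up to isomorphism). -/
noncomputable def injectiveEnvelope (R : Type u) [Ring R] (M : Type u) [AddCommGroup M]
    [Module R M] : ModuleCat.{u} R :=
  (exists_isInjectiveEnvelope R M).choose

theorem exists_isInjectiveEnvelope_injectiveEnvelope (R : Type u) [Ring R] (M : Type u)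
    [AddCommGroup M] [Module R M] :
    ∃ j : M →ₗ[R] injectiveEnvelope R M, IsInjectiveEnvelope j :=
  (exists_isInjectiveEnvelope R M).choose_spec

/-! ### The Matlis dual bimodule of an algebra -/

/-- `D(Λ) = Hom_R(Λ, E⁰(R/J(R)))`. -/
def MatlisDual (R Λ : Type u) [CommRing R] [Ring Λ] [Algebra R Λ] : Type u :=
  Λ →ₗ[R] injectiveEnvelope R (R ⧸ Ring.jacobson R)

namespace MatlisDual

variable {R Λ : Type u} [CommRing R] [Ring Λ] [Algebra R Λ]

noncomputable instance : AddCommGroup (MatlisDual R Λ) :=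
  inferInstanceAs (AddCommGroup (Λ →ₗ[R] injectiveEnvelope R (R ⧸ Ring.jacobson R)))

/-- The left action `(a f)(x) = f(x a)`. -/
noncomputable instance : Module Λ (MatlisDual R Λ) where
  smul a f := LinearMap.comp f (LinearMap.mulRight R a)
  one_smul f := LinearMap.ext fun x => congrArg f.toFun (mul_one x)
  mul_smul a b f := LinearMap.ext fun x => congrArg f.toFun (mul_assoc x a b).symm
  smul_zero _ := rfl
  smul_add _ _ _ := rfl
  add_smul a b f := LinearMap.ext fun x =>
    (congrArg f.toFun (mul_add x a b)).trans (f.map_add' _ _)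
  zero_smul f := LinearMap.ext fun x =>
    (congrArg f.toFun (mul_zero x)).trans (LinearMap.map_zero f)

/-- The right action `(f a)(x) = f(a x)`. -/
noncomputable instance : Module Λᵐᵒᵖ (MatlisDual R Λ) where
  smul a f := LinearMap.comp f (LinearMap.mulLeft R a.unop)
  one_smul f := LinearMap.ext fun x => congrArg f.toFun (one_mul x)
  mul_smul a b f := LinearMap.ext fun x => congrArg f.toFun (mul_assoc b.unop a.unop x)
  smul_zero _ := rfl
  smul_add _ _ _ := rfl
  add_smul a b f := LinearMap.ext fun x =>
    (congrArg f.toFun (add_mul a.unop b.unop x)).trans (f.map_add' _ _)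
  zero_smul f := LinearMap.ext fun x =>
    (congrArg f.toFun (zero_mul x)).trans (LinearMap.map_zero f)

instance : SMulCommClass Λ Λᵐᵒᵖ (MatlisDual R Λ) where
  smul_comm a b f := LinearMap.ext fun x => congrArg f.toFun (mul_assoc b.unop x a).symm

end MatlisDual

/-! ### Hom and tensor functors of a bimodule

Throughout, an `(R, S)`-bimodule is a left `R`-module and right `S`-module
(i.e. `Sᵐᵒᵖ`-module) `ω` with commuting actions. -/

section Bimodule

variable (R S : Type u) [Ring R] [Ring S] (ω : Type u) [AddCommGroup ω] [Module R ω]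
  [Module Sᵐᵒᵖ ω] [SMulCommClass R Sᵐᵒᵖ ω]

/-- Right multiplication by `s` on `ω`, as an `R`-linear map. -/
def rightMulMap (s : S) : ω →ₗ[R] ω where
  toFun x := MulOpposite.op s • x
  map_add' := smul_add _
  map_smul' r x := (smul_comm r (MulOpposite.op s) x).symm

/-- `Hom_R(ω, M)`, regarded as a left `S`-module. -/
def BimodHom (M : Type u) [AddCommGroup M] [Module R M] : Type u := ω →ₗ[R] M

namespace BimodHom

variable (M : Type u) [AddCommGroup M] [Module R M]

noncomputable instance : AddCommGroup (BimodHom R ω M) :=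
  inferInstanceAs (AddCommGroup (ω →ₗ[R] M))

/-- The left `S`-action `(s f)(x) = f(x s)`. -/
noncomputable instance : Module S (BimodHom R ω M) where
  smul s f := LinearMap.comp (σ₁₂ := RingHom.id R) (σ₂₃ := RingHom.id R) f
    (rightMulMap R S ω s)
  one_smul f := LinearMap.ext fun x => congrArg f.toFun (one_smul Sᵐᵒᵖ x)
  mul_smul s t f := LinearMap.ext fun x =>
    congrArg f.toFun (mul_smul (MulOpposite.op t) (MulOpposite.op s) x)
  smul_zero _ := rfl
  smul_add _ _ _ := rfl
  add_smul s t f := LinearMap.ext fun x =>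
    (congrArg f.toFun (add_smul (MulOpposite.op s) (MulOpposite.op t) x)).trans (f.map_add' _ _)
  zero_smul f := LinearMap.ext fun x =>
    (congrArg f.toFun (zero_smul Sᵐᵒᵖ x)).trans (LinearMap.map_zero f)

end BimodHom

/-- The functor `Hom_R(ω, -)` from left `R`-modules to left `S`-modules. -/
noncomputable def homFunctor : ModuleCat.{u} R ⥤ ModuleCat.{u} S where
  obj M := ModuleCat.of S (BimodHom R ω M)
  map {M N} g := ModuleCat.ofHom (X := BimodHom R ω M) (Y := BimodHom R ω N)
    { toFun := fun f => LinearMap.comp g.hom f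
      map_add' := fun f f' => LinearMap.comp_add f f' g.hom
      map_smul' := fun _ _ => rfl }

instance : (homFunctor R S ω).Additive where

/-- The relations `x s ⊗ y = x ⊗ s y`. The set of these relations is stable under `R`, so the
`R`-submodule they span is the additive subgroup they generate. -/
def balancedRelations (N : Type u) [AddCommGroup N] [Module S N] : Submodule R (ω ⊗[ℤ] N) :=
  Submodule.span R
    {z | ∃ (x : ω) (s : S) (y : N), z = (MulOpposite.op s • x) ⊗ₜ[ℤ] y - x ⊗ₜ[ℤ] (s • y)}

/-- The tensor product `ω ⊗_S N` over the noncommutative ring `S`, a left `R`-module. -/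
abbrev BalancedTensor (N : Type u) [AddCommGroup N] [Module S N] : Type u :=
  (ω ⊗[ℤ] N) ⧸ balancedRelations R S ω N

/-- The `R`-linear map `ω ⊗_S N → ω ⊗_S N'` induced by an `S`-linear map `N → N'`. -/
noncomputable def balancedTensorMap {N N' : Type u} [AddCommGroup N] [Module S N]
    [AddCommGroup N'] [Module S N'] (g : N →ₗ[S] N') :
    BalancedTensor R S ω N →ₗ[R] BalancedTensor R S ω N' :=
  Submodule.mapQ _ _
    (TensorProduct.AlgebraTensorModule.map (LinearMap.id : ω →ₗ[R] ω)
      g.toAddMonoidHom.toIntLinearMap) (by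
      refine Submodule.span_le.2 ?_
      rintro _ ⟨x, s, y, rfl⟩
      refine Submodule.subset_span ⟨x, s, g y, ?_⟩
      simp)

/-- The functor `ω ⊗_S -` from left `S`-modules to left `R`-modules. -/
noncomputable def tensorFunctor : ModuleCat.{u} S ⥤ ModuleCat.{u} R where
  obj N := ModuleCat.of R (BalancedTensor R S ω N)
  map g := ModuleCat.ofHom (balancedTensorMap R S ω g.hom)
  map_id N := by
    ext : 1
    refine Submodule.linearMap_qext _ (TensorProduct.AlgebraTensorModule.ext fun x y => ?_)
    rfl
  map_comp f g := by
    ext : 1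
    refine Submodule.linearMap_qext (balancedRelations R S ω _)
      (TensorProduct.AlgebraTensorModule.ext fun x y => ?_)
    rfl

instance : (tensorFunctor R S ω).Additive where
  map_add {M N f g} := by
    ext : 1
    refine Submodule.linearMap_qext _ (TensorProduct.AlgebraTensorModule.ext fun x y => ?_)
    change Submodule.Quotient.mk (p := balancedRelations R S ω N) (x ⊗ₜ[ℤ] (f.hom y + g.hom y)) =
      Submodule.Quotient.mk (p := balancedRelations R S ω N) (x ⊗ₜ[ℤ] f.hom y) +
        Submodule.Quotient.mk (p := balancedRelations R S ω N) (x ⊗ₜ[ℤ] g.hom y)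
    rw [TensorProduct.tmul_add, Submodule.Quotient.mk_add]

/-- The evaluation `θ_M : ω ⊗_S Hom_R(ω, M) → M`, `θ_M(x ⊗ f) = f(x)`. -/
noncomputable def evalMap (M : Type u) [AddCommGroup M] [Module R M] :
    BalancedTensor R S ω (BimodHom R ω M) →ₗ[R] M :=
  Submodule.liftQ _
    (TensorProduct.AlgebraTensorModule.lift
      { toFun := fun x =>
          ({ toFun := fun f : ω →ₗ[R] M => f x
             map_zero' := rfl
             map_add' := fun _ _ => rfl } : BimodHom R ω M →+ M).toIntLinearMap
        map_add' := fun x y => LinearMap.ext fun f : ω →ₗ[R] M => f.map_add x y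
        map_smul' := fun r x => LinearMap.ext fun f : ω →ₗ[R] M => f.map_smul r x }) (by
      refine Submodule.span_le.2 ?_
      rintro _ ⟨x, s, f, rfl⟩
      change _ = _
      rw [map_sub, sub_eq_zero]
      rfl)

/-- `θ` as a natural transformation. -/
noncomputable def evalTrans : homFunctor R S ω ⋙ tensorFunctor R S ω ⟶ 𝟭 (ModuleCat.{u} R) where
  app M := ModuleCat.ofHom (evalMap R S ω M)
  naturality M N g := by
    ext : 1
    refine Submodule.linearMap_qext _ (TensorProduct.AlgebraTensorModule.ext fun x y => ?_)
    rfl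

/-! ### The Bass class of modules -/

/-- The Bass class `B_ω(R)`. -/
structure IsBass (M : ModuleCat.{u} R) : Prop where
  ext_eq_zero : ∀ i : ℕ, 1 ≤ i → ∀ e : Abelian.Ext (ModuleCat.of R ω) M i, e = 0
  /-- `Tor_i^S(ω, Hom_R(ω, M)) = 0` for all `i ≥ 1`. -/
  tor_isZero : ∀ i : ℕ, 1 ≤ i →
    IsZero (((tensorFunctor R S ω).leftDerived i).obj ((homFunctor R S ω).obj M))
  static : Function.Bijective (evalMap R S ω M)

end Bimodule

/-! ### The Bass class and the Bass injective dimension of complexes -/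

section Complexes

variable {R : Type u} [Ring R]

/-- The cohomology of `M` is bounded, i.e. `M` defines an object of `D^b`. -/
def HasBoundedCohomology (M : CochainComplex (ModuleCat.{u} R) ℤ) : Prop :=
  ∃ a b : ℤ, M.IsGE a ∧ M.IsLE b

/-- `M → I` is an injective resolution: a quasi-isomorphism into a bounded below complex of
injective modules. -/
structure IsInjRes {M I : CochainComplex (ModuleCat.{u} R) ℤ} (ι : M ⟶ I) : Prop where
  quasiIso : QuasiIso ι
  injective : ∀ i : ℤ, Injective (I.X i)
  bounded : ∃ a : ℤ, I.IsStrictlyGE a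

/-- `P → N` is a projective resolution: a quasi-isomorphism from a bounded above complex of
projective modules. -/
structure IsProjRes {P N : CochainComplex (ModuleCat.{u} R) ℤ} (π : P ⟶ N) : Prop where
  quasiIso : QuasiIso π
  projective : ∀ i : ℤ, Projective (P.X i)
  bounded : ∃ b : ℤ, P.IsStrictlyLE b

end Complexes

section BimoduleComplexes

variable (R S : Type u) [Ring R] [Ring S] (ω : Type u) [AddCommGroup ω] [Module R ω]
  [Module Sᵐᵒᵖ ω] [SMulCommClass R Sᵐᵒᵖ ω]

/-- The complex `Hom_R(ω, I)`; it represents `RHom_R(ω, M)` if `I` is an injective resolution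
of `M`. -/
noncomputable abbrev homComplex (I : CochainComplex (ModuleCat.{u} R) ℤ) :
    CochainComplex (ModuleCat.{u} S) ℤ :=
  ((homFunctor R S ω).mapHomologicalComplex _).obj I

/-- The complex `ω ⊗_S P`; it represents `ω ⊗^L_S N` if `P` is a projective resolution of `N`. -/
noncomputable abbrev tensorComplex (P : CochainComplex (ModuleCat.{u} S) ℤ) :
    CochainComplex (ModuleCat.{u} R) ℤ :=
  ((tensorFunctor R S ω).mapHomologicalComplex _).obj P

/-- The evaluation `ω ⊗_S Hom_R(ω, I) → I`, degreewise `θ`. -/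
noncomputable def evalComplex (I : CochainComplex (ModuleCat.{u} R) ℤ) :
    tensorComplex R S ω (homComplex R S ω I) ⟶ I where
  f i := (evalTrans R S ω).app (I.X i)
  comm' i j _ := ((evalTrans R S ω).naturality (I.d i j)).symm

/-- The Bass class `B^•_ω(R)` of complexes: `M` and `RHom_R(ω, M)` have bounded cohomology, and
`ω ⊗^L_S RHom_R(ω, M) → M` is an isomorphism in the derived category. With an injective resolution
`ι : M → I` and a projective resolution `π : P → Hom_R(ω, I)` this last morphism is represented by
`ω ⊗_S P → ω ⊗_S Hom_R(ω, I) → I`, followed by the inverse of `ι`. -/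
def IsBassComplex (M : CochainComplex (ModuleCat.{u} R) ℤ) : Prop :=
  HasBoundedCohomology M ∧
  ∃ (I : CochainComplex (ModuleCat.{u} R) ℤ) (ι : M ⟶ I), IsInjRes ι ∧
    HasBoundedCohomology (homComplex R S ω I) ∧
    ∃ (P : CochainComplex (ModuleCat.{u} S) ℤ) (π : P ⟶ homComplex R S ω I), IsProjRes π ∧
      QuasiIso (((tensorFunctor R S ω).mapHomologicalComplex _).map π ≫ evalComplex R S ω I)

/-- `sup RHom_R(ω, M)`, the supremum of the degrees in which `RHom_R(ω, M)` has nonzero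
cohomology. (Any two injective resolutions of `M` are homotopy equivalent, so they give the same
degrees.) -/
noncomputable def supRHom (M : CochainComplex (ModuleCat.{u} R) ℤ) : EReal :=
  sSup {x | ∃ (I : CochainComplex (ModuleCat.{u} R) ℤ) (ι : M ⟶ I) (i : ℤ), IsInjRes ι ∧
    ¬ IsZero ((homComplex R S ω I).homology i) ∧ x = ((i : ℝ) : EReal)}

open Classical in
/-- The Bass injective dimension `B^•_ω(R)-id M` of a complex. -/
noncomputable def bassInjectiveDimension (M : CochainComplex (ModuleCat.{u} R) ℤ) : EReal :=
  if IsBassComplex R S ω M then supRHom R S ω M else ⊤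

end BimoduleComplexes

/-! ### Gorenstein algebras -/

/-- `Λ` is Gorenstein: the injective dimensions of `Λ` as a left and as a right module over itself
are equal and finite. -/
def IsGorensteinAlgebra (Λ : Type u) [Ring Λ] : Prop :=
  injectiveDimension (ModuleCat.of.{u} Λ Λ) = injectiveDimension (ModuleCat.of.{u} Λᵐᵒᵖ Λ) ∧
    injectiveDimension (ModuleCat.of.{u} Λ Λ) < ⊤

/-! Write `ω = D(Λ)`, `F = ω ⊗ -`, `G = Hom(ω, -)`. Matlis duality identifies `End(ω)` with `Λ` and
makes `ω` a finitely generated injective cogenerator, so `F ⊣ G` restricts to an equivalence between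
projective and injective `Λ`-modules. This is abstracted in `IsDualizing`. Since `F Λ ≅ ω` is an
injective cogenerator, exactness after applying `F` can be tested by maps into `Λ`
(`IsDualizing.exact_iff`). So `Tor_i(ω, N) = 0` if and only if `Ext^i(N, Λ) = 0` for `i ≥ 1`, and
the Bass class is described by `Ext` and the counit alone (`isBass_iff`).

If `Λ` is Gorenstein, then `id Λ ≤ n` on the left, and `pd ω ≤ n` because duality gives `pd ω = id
Λ` on the right. Finiteness of `id Λ` collapses the Bass class to the modules `X` with `Ext^i(ω, X)
= 0` for `i ≥ 1` (`isBassObject_of_perp`). A module whose groups `Ext^i(ω, -)` vanish for `i > m` is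
then a quotient of a module of injective dimension at most `m` by a Bass module
(`hasBassCover_of_subsingleton_ext`, in the manner of Auslander and Buchweitz). A pullback turns
such a cover of a cosyzygy into the embedding in statement 4, from which statement 5 follows.
Truncating an injective resolution gives statement 3. For statement 2, `F` preserves
quasi-isomorphisms between complexes of projectives, even unbounded ones
(`IsDualizing.quasiIso_map`).

Conversely, each statement about simple modules `T` gives two things: `Ext^(n+1)(ω, T) = 0`, hence
`pd ω ≤ n`; and an exact sequence `0 → X → V → T → 0` with `Ext^i(ω, X) = 0` for `i ≥ 1` and `id V <
∞`. Such sequences are stable under extensions (`hasPerpCover_X₂`), so there is one ending in `Λ`.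
It splits, whence `id Λ < ∞` on the left. Once `pd ω` and `id Λ` are both finite they agree
(`hasProjectiveDimensionLT_matlisDual_iff`), so both injective dimensions of `Λ` equal `pd ω ≤ n`.
-/

/-! ### Matlis duality over a commutative artinian ring -/

section Matlis

variable {R : Type u} [CommRing R]

/-- The Matlis module `E⁰(R/J(R))`. -/
noncomputable abbrev MatlisModule (R : Type u) [CommRing R] : ModuleCat.{u} R :=
  injectiveEnvelope R (R ⧸ Ring.jacobson R)

theorem MatlisModule.injective : Module.Injective R (MatlisModule R) :=
  (exists_isInjectiveEnvelope_injectiveEnvelope R (R ⧸ Ring.jacobson R)).choose_spec.injective_module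

theorem IsSimpleModule.exists_smul_eq {A S : Type*} [Ring A] [AddCommGroup S] [Module A S]
    [IsSimpleModule A S] {s : S} (hs : s ≠ 0) (t : S) : ∃ a : A, a • s = t :=
  IsSimpleModule.toSpanSingleton_surjective A hs t

/-- By essentiality the image of a simple module lies in `R/J(R)`, so both maps are governed by
classes of ring elements. This bounds the length of the dual of a simple module by one. -/
theorem MatlisModule.exists_smul_eq_of_isSimpleModule (S : Type u) [AddCommGroup S] [Module R S]
    [IsSimpleModule R S] {f : S →ₗ[R] MatlisModule R} (hf : f ≠ 0) (g : S →ₗ[R] MatlisModule R) :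
    ∃ r : R, r • f = g := by
  obtain ⟨j, hj⟩ := exists_isInjectiveEnvelope_injectiveEnvelope R (R ⧸ Ring.jacobson R)
  have key : ∀ (h : S →ₗ[R] MatlisModule R) (s : S), h s ∈ LinearMap.range j := by
    intro h s
    by_cases hh : h = 0
    · simp [hh]
    have : LinearMap.range h ⊓ LinearMap.range j ≠ ⊥ := fun h0 =>
      hh (LinearMap.range_eq_bot.1 (hj.essential _ h0))
    obtain ⟨z, ⟨⟨t, rfl⟩, hz⟩, hz0⟩ := Submodule.exists_mem_ne_zero_of_ne_bot this
    have ht : t ≠ 0 := by rintro rfl; simp at hz0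
    obtain ⟨r, rfl⟩ := IsSimpleModule.exists_smul_eq (A := R) ht s
    rw [map_smul]
    exact Submodule.smul_mem _ _ hz
  obtain ⟨s, hs⟩ : ∃ s, f s ≠ 0 := by
    by_contra! h
    exact hf (LinearMap.ext h)
  have hs0 : s ≠ 0 := by rintro rfl; simp at hs
  obtain ⟨x, hx⟩ := key f s
  obtain ⟨y, hy⟩ := key g s
  obtain ⟨x, rfl⟩ := Ideal.Quotient.mk_surjective x
  obtain ⟨y, rfl⟩ := Ideal.Quotient.mk_surjective y
  -- Otherwise `x • f s = 0`, so `x²` lies in the Jacobson radical. That ideal is radical, hence `f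
  -- s` would vanish.
  have hxs : x • s ≠ 0 := by
    intro h
    have h1 : x • f s = 0 := by rw [← map_smul, h, map_zero]
    rw [← hx, ← map_smul, map_eq_zero_iff j hj.mono] at h1
    have h2 : x ^ 2 ∈ Ring.jacobson R := by
      rw [← Ideal.Quotient.eq_zero_iff_mem, pow_two, map_mul]
      exact h1
    rw [← Ideal.jacobson_bot] at h2
    have h3 := Ideal.isRadical_jacobson (⊥ : Ideal R) ⟨2, h2⟩
    rw [Ideal.jacobson_bot] at h3
    apply hs
    rw [← hx, Ideal.Quotient.eq_zero_iff_mem.2 h3, map_zero]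
  obtain ⟨b, hb⟩ := IsSimpleModule.exists_smul_eq (A := R) hxs s
  -- Here `f s` and `g s` are the classes of `x` and `y`, and `b x s = s`; so `b y f(s) = b x g(s) =
  -- g(s)`.
  refine ⟨b * y, LinearMap.ext fun t => ?_⟩
  obtain ⟨r, rfl⟩ := IsSimpleModule.exists_smul_eq (A := R) hs0 t
  have e1 : g s = b • x • g s := by
    rw [← map_smul, ← map_smul, hb]
  have e2 : x • j (Ideal.Quotient.mk _ y) = y • j (Ideal.Quotient.mk _ x) := by
    rw [← LinearMap.map_smul, ← LinearMap.map_smul]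
    congr 1
    change Ideal.Quotient.mk _ (x * y) = Ideal.Quotient.mk _ (y * x)
    rw [mul_comm]
  rw [map_smul, map_smul, LinearMap.smul_apply, ← hx, e1, ← hy, e2, mul_smul]

theorem MatlisModule.length_dual_le_one (S : Type u) [AddCommGroup S] [Module R S]
    [IsSimpleModule R S] : Module.length R (S →ₗ[R] MatlisModule R) ≤ 1 := by
  rcases subsingleton_or_nontrivial (S →ₗ[R] MatlisModule R) with h | h
  · rw [Module.length_eq_zero]; exact zero_le
  · have : IsSimpleModule R (S →ₗ[R] MatlisModule R) := by
      rw [isSimpleModule_iff_toSpanSingleton_surjective]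
      exact ⟨h, fun f hf g => MatlisModule.exists_smul_eq_of_isSimpleModule S hf g⟩
    rw [Module.length_eq_one]

/-- Injectivity of the Matlis module makes dualization exact, so lengths add along a composition
series, and each simple factor contributes at most one. -/
theorem MatlisModule.length_dual_le {M : Type u} [AddCommGroup M] [Module R M]
    (h : IsFiniteLength R M) :
    Module.length R (M →ₗ[R] MatlisModule R) ≤ Module.length R M := by
  induction h with
  | of_subsingleton => rw [Module.length_eq_zero]; exact zero_le
  | @of_simple_quotient M _ _ N _ hN ih =>
    rw [Module.length_eq_add_of_exact (R := R) N.subtype N.mkQ N.subtype_injective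
      N.mkQ_surjective (LinearMap.exact_subtype_mkQ N), Module.length_eq_one R (M ⧸ N),
      Module.length_eq_add_of_exact (R := R) (LinearMap.lcomp R (MatlisModule R) N.mkQ)
        (LinearMap.lcomp R (MatlisModule R) N.subtype), add_comm]
    · exact add_le_add ih (MatlisModule.length_dual_le_one _)
    · intro f g hfg
      exact Submodule.linearMap_qext _ hfg
    · intro f
      obtain ⟨g, hg⟩ := (MatlisModule.injective (R := R)).out N.subtype N.subtype_injective f
      exact ⟨g, LinearMap.ext hg⟩
    · intro f
      constructor
      · intro hf
        refine ⟨N.liftQ f fun x hx => ?_, by ext; simp⟩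
        exact LinearMap.congr_fun hf ⟨x, hx⟩
      · rintro ⟨g, rfl⟩
        ext x
        have : N.mkQ x = 0 := by simp
        simp only [LinearMap.lcomp_apply, LinearMap.zero_apply, Submodule.subtype_apply]
        rw [this, map_zero]

variable [IsArtinianRing R]

/-- The cyclic module `R m` has a quotient `R/P` with `P` maximal. As `R/J(R)` is semisimple, `R/P`
embeds in it and so in the envelope; injectivity extends the resulting functional to `M`. -/
theorem MatlisModule.exists_apply_ne_zero {M : Type u} [AddCommGroup M] [Module R M] {m : M}
    (hm : m ≠ 0) : ∃ f : M →ₗ[R] MatlisModule R, f m ≠ 0 := by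
  obtain ⟨j, hj⟩ := exists_isInjectiveEnvelope_injectiveEnvelope R (R ⧸ Ring.jacobson R)
  let I := LinearMap.ker (LinearMap.toSpanSingleton R M m)
  have hI : I ≠ ⊤ := by
    intro h
    have : (1 : R) ∈ I := by rw [h]; trivial
    exact hm (by simpa [I] using this)
  obtain ⟨P, hP, hIP⟩ := Ideal.exists_le_maximal I hI
  have hJP : Ring.jacobson R ≤ P := by
    rw [Ring.jacobson, Module.jacobson]
    exact sInf_le (Ideal.isMaximal_def.1 hP)
  have hss : IsSemisimpleModule R (R ⧸ Ring.jacobson R) :=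
    (IsArtinian.isSemisimpleModule_iff_jacobson R _).2 (Module.jacobson_quotient_jacobson R R)
  let q : (R ⧸ Ring.jacobson R) →ₗ[R] (R ⧸ P) := Submodule.factor hJP
  have hq : Function.Surjective q := Submodule.factor_surjective hJP
  obtain ⟨s, hs⟩ := IsSemisimpleModule.lifting_property q hq LinearMap.id
  have hsinj : Function.Injective s := fun a b hab => by
    have := congrArg q hab
    simpa [← LinearMap.comp_apply, hs] using this
  let i : LinearMap.range (LinearMap.toSpanSingleton R M m) →ₗ[R] (R ⧸ P) :=
    (Submodule.factor hIP) ∘ₗ (LinearMap.quotKerEquivRange _).symm.toLinearMap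
  obtain ⟨f, hf⟩ := (MatlisModule.injective (R := R)).out
    (LinearMap.range (LinearMap.toSpanSingleton R M m)).subtype (Submodule.subtype_injective _)
    (j ∘ₗ s ∘ₗ i)
  refine ⟨f, fun h0 => ?_⟩
  have h1 := hf ⟨m, 1, by simp⟩
  have h2 : i ⟨m, 1, by simp⟩ = Ideal.Quotient.mk P 1 := by
    have : (⟨m, 1, by simp⟩ : LinearMap.range (LinearMap.toSpanSingleton R M m)) =
        LinearMap.quotKerEquivRange _ (Submodule.Quotient.mk 1) := by
      exact Subtype.ext (one_smul R m).symm
    simp only [i, this, LinearMap.comp_apply, LinearEquiv.coe_coe, LinearEquiv.symm_apply_apply]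
    rfl
  rw [Submodule.subtype_apply, h0, LinearMap.comp_apply, LinearMap.comp_apply, h2, eq_comm,
    map_eq_zero_iff j hj.mono, map_eq_zero_iff s hsinj, Ideal.Quotient.eq_zero_iff_mem] at h1
  exact hP.ne_top ((Ideal.eq_top_iff_one P).2 h1)

theorem MatlisModule.isFiniteLength_of_finite (M : Type u) [AddCommGroup M] [Module R M]
    [Module.Finite R M] : IsFiniteLength R M :=
  isFiniteLength_iff_isNoetherian_isArtinian.2 ⟨inferInstance, inferInstance⟩

theorem MatlisModule.isFiniteLength_dual (M : Type u) [AddCommGroup M] [Module R M]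
    [Module.Finite R M] : IsFiniteLength R (M →ₗ[R] MatlisModule R) := by
  have h := MatlisModule.isFiniteLength_of_finite (R := R) M
  rw [← Module.length_ne_top_iff] at h ⊢
  exact ne_top_of_le_ne_top h
    (MatlisModule.length_dual_le (MatlisModule.isFiniteLength_of_finite M))

theorem MatlisModule.finite_dual (M : Type u) [AddCommGroup M] [Module R M]
    [Module.Finite R M] : Module.Finite R (M →ₗ[R] MatlisModule R) := by
  have := (isFiniteLength_iff_isNoetherian_isArtinian.1
    (MatlisModule.isFiniteLength_dual (R := R) M)).1
  infer_instance

/-- Matlis biduality: every functional on the dual of a finitely generated module is an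
evaluation. -/
theorem MatlisModule.exists_eval_eq {M : Type u} [AddCommGroup M] [Module R M]
    [Module.Finite R M] (φ : (M →ₗ[R] MatlisModule R) →ₗ[R] MatlisModule R) :
    ∃ m : M, ∀ f : M →ₗ[R] MatlisModule R, φ f = f m := by
  let ev : M →ₗ[R] (M →ₗ[R] MatlisModule R) →ₗ[R] MatlisModule R := LinearMap.id.flip
  have hev : Function.Injective ev := by
    rw [injective_iff_map_eq_zero]
    intro m hm
    by_contra hne
    obtain ⟨f, hf⟩ := MatlisModule.exists_apply_ne_zero (R := R) hne
    exact hf (LinearMap.congr_fun hm f)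
  have := MatlisModule.finite_dual (R := R) M
  have hfl := MatlisModule.isFiniteLength_dual (R := R) (M →ₗ[R] MatlisModule R)
  obtain ⟨_, _⟩ := isFiniteLength_iff_isNoetherian_isArtinian.1 hfl
  -- Dualizing twice does not increase length, so the image of the injective map into the bidual
  -- cannot be proper.
  have hle := (MatlisModule.length_dual_le
    (MatlisModule.isFiniteLength_of_finite (R := R) (M →ₗ[R] MatlisModule R))).trans
    (MatlisModule.length_dual_le (MatlisModule.isFiniteLength_of_finite (R := R) M))
  have hr : LinearMap.range ev = ⊤ := by
    by_contra hne
    have h1 := Submodule.length_lt hne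
    rw [← (LinearEquiv.ofInjective ev hev).length_eq] at h1
    exact absurd hle (not_le_of_gt h1)
  obtain ⟨m, hm⟩ := LinearMap.range_eq_top.1 hr φ
  exact ⟨m, fun f => by rw [← hm]; rfl⟩

end Matlis

/-! ### Duality between right and left modules -/

section RightDual

variable (R Λ : Type u) [CommRing R] [Ring Λ] [Algebra R Λ]

namespace MatlisDual

noncomputable instance : Module R (MatlisDual R Λ) :=
  inferInstanceAs (Module R (Λ →ₗ[R] MatlisModule R))

instance : FunLike (MatlisDual R Λ) Λ (MatlisModule R) :=
  inferInstanceAs (FunLike (Λ →ₗ[R] MatlisModule R) Λ (MatlisModule R))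

instance : LinearMapClass (MatlisDual R Λ) R Λ (MatlisModule R) :=
  inferInstanceAs (LinearMapClass (Λ →ₗ[R] MatlisModule R) R Λ (MatlisModule R))

variable {R Λ}

/-- A linear functional, as an element of the dual. -/
def of (f : Λ →ₗ[R] MatlisModule R) : MatlisDual R Λ := f

@[simp] theorem of_apply (f : Λ →ₗ[R] MatlisModule R) (x : Λ) : of f x = f x := rfl

@[ext] theorem ext {f g : MatlisDual R Λ} (h : ∀ x, f x = g x) : f = g := LinearMap.ext h

@[simp] theorem add_apply (f g : MatlisDual R Λ) (x : Λ) : (f + g) x = f x + g x := rfl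

@[simp] theorem zero_apply (x : Λ) : (0 : MatlisDual R Λ) x = 0 := rfl

@[simp] theorem smul_apply (a : Λ) (f : MatlisDual R Λ) (x : Λ) : (a • f) x = f (x * a) := rfl

@[simp] theorem op_smul_apply (a : Λᵐᵒᵖ) (f : MatlisDual R Λ) (x : Λ) :
    (a • f) x = f (a.unop * x) := rfl

@[simp] theorem algebra_smul_apply (r : R) (f : MatlisDual R Λ) (x : Λ) : (r • f) x = r • f x := rfl

instance : IsScalarTower R Λ (MatlisDual R Λ) where
  smul_assoc r a f := by ext x; simp

instance : IsScalarTower R Λᵐᵒᵖ (MatlisDual R Λ) where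
  smul_assoc r a f := by ext x; simp

/-- Evaluation at an element. -/
def eval (x : Λ) : MatlisDual R Λ →ₗ[R] MatlisModule R where
  toFun f := f x
  map_add' _ _ := rfl
  map_smul' _ _ := rfl

@[simp] theorem eval_apply (x : Λ) (f : MatlisDual R Λ) : eval x f = f x := rfl

theorem exists_eval_eq [IsArtinianRing R] [Module.Finite R Λ]
    (φ : MatlisDual R Λ →ₗ[R] MatlisModule R) : ∃ x : Λ, φ = eval x := by
  obtain ⟨x, hx⟩ := MatlisModule.exists_eval_eq (R := R) (M := Λ) φ
  exact ⟨x, LinearMap.ext hx⟩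

theorem eq_of_forall_apply_eq [IsArtinianRing R] {x y : Λ}
    (h : ∀ f : MatlisDual R Λ, f x = f y) : x = y := by
  by_contra hne
  obtain ⟨f, hf⟩ := MatlisModule.exists_apply_ne_zero (R := R) (sub_ne_zero.2 hne)
  exact hf (by rw [map_sub, sub_eq_zero]; exact h (of f))

end MatlisDual

/-- The dual `Hom_R(M, E)` of a right `Λ`-module, a left `Λ`-module. -/
def RightDual (M : Type u) [AddCommGroup M] [Module R M] : Type u := M →ₗ[R] MatlisModule R

namespace RightDual

variable (M : Type u) [AddCommGroup M] [Module R M] [Module Λᵐᵒᵖ M] [IsScalarTower R Λᵐᵒᵖ M]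

noncomputable instance : AddCommGroup (RightDual R M) :=
  inferInstanceAs (AddCommGroup (M →ₗ[R] MatlisModule R))

noncomputable instance : Module R (RightDual R M) :=
  inferInstanceAs (Module R (M →ₗ[R] MatlisModule R))

instance : FunLike (RightDual R M) M (MatlisModule R) :=
  inferInstanceAs (FunLike (M →ₗ[R] MatlisModule R) M (MatlisModule R))

instance : LinearMapClass (RightDual R M) R M (MatlisModule R) :=
  inferInstanceAs (LinearMapClass (M →ₗ[R] MatlisModule R) R M (MatlisModule R))

variable {R Λ M}

/-- A linear functional, as an element of the dual. -/
def of (f : M →ₗ[R] MatlisModule R) : RightDual R M := f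

@[simp] theorem of_apply (f : M →ₗ[R] MatlisModule R) (x : M) : of f x = f x := rfl

@[ext] theorem ext {f g : RightDual R M} (h : ∀ x, f x = g x) : f = g := LinearMap.ext h

@[simp] theorem add_apply (f g : RightDual R M) (x : M) : (f + g) x = f x + g x := rfl

@[simp] theorem zero_apply (x : M) : (0 : RightDual R M) x = 0 := rfl

@[simp] theorem algebra_smul_apply (r : R) (f : RightDual R M) (x : M) : (r • f) x = r • f x := rfl

/-- The left action `(a f)(x) = f(x a)`. -/
noncomputable instance : Module Λ (RightDual R M) where
  smul a f := of (LinearMap.comp (f : M →ₗ[R] MatlisModule R)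
    (Algebra.lsmul R R M (MulOpposite.op a)))
  one_smul f := ext fun x => congrArg f (one_smul Λᵐᵒᵖ x)
  mul_smul a b f := ext fun x => congrArg f (mul_smul (MulOpposite.op b) (MulOpposite.op a) x)
  smul_zero _ := rfl
  smul_add _ _ _ := rfl
  add_smul a b f := ext fun x =>
    (congrArg f (add_smul (MulOpposite.op a) (MulOpposite.op b) x)).trans (map_add f _ _)
  zero_smul f := ext fun x => (congrArg f (zero_smul Λᵐᵒᵖ x)).trans (map_zero f)

@[simp] theorem smul_apply (a : Λ) (f : RightDual R M) (x : M) :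
    (a • f) x = f (MulOpposite.op a • x) := rfl

instance : IsScalarTower R Λ (RightDual R M) where
  smul_assoc r a f := by ext x; simp [MulOpposite.op_smul]

omit [Module Λᵐᵒᵖ M] [IsScalarTower R Λᵐᵒᵖ M] in
theorem exists_eval_eq [IsArtinianRing R] [Module.Finite R M]
    (φ : RightDual R M →ₗ[R] MatlisModule R) : ∃ x : M, ∀ f, φ f = f x :=
  MatlisModule.exists_eval_eq (R := R) (M := M) φ

omit [Module Λᵐᵒᵖ M] [IsScalarTower R Λᵐᵒᵖ M] in
theorem eq_of_forall_apply_eq [IsArtinianRing R] {x y : M}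
    (h : ∀ f : RightDual R M, f x = f y) : x = y := by
  by_contra hne
  obtain ⟨f, hf⟩ := MatlisModule.exists_apply_ne_zero (R := R) (sub_ne_zero.2 hne)
  exact hf (by rw [map_sub, sub_eq_zero]; exact h (of f))

variable {N : Type u} [AddCommGroup N] [Module R N] [Module Λᵐᵒᵖ N]
  [IsScalarTower R Λᵐᵒᵖ N]

/-- The dual of a map of right modules. -/
noncomputable def map (f : M →ₗ[Λᵐᵒᵖ] N) : RightDual R N →ₗ[Λ] RightDual R M where
  toFun u := of (LinearMap.comp (u : N →ₗ[R] MatlisModule R) (f.restrictScalars R))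
  map_add' _ _ := rfl
  map_smul' a u := ext fun x => congrArg u (f.map_smul (MulOpposite.op a) x).symm

@[simp] theorem map_apply (f : M →ₗ[Λᵐᵒᵖ] N) (u : RightDual R N) (x : M) :
    map f u x = u (f x) := rfl

theorem map_injective {f : M →ₗ[Λᵐᵒᵖ] N} (hf : Function.Surjective f) :
    Function.Injective (map (R := R) f) := fun u v huv => ext fun x => by
  obtain ⟨y, rfl⟩ := hf x
  exact DFunLike.congr_fun huv y

theorem map_surjective {f : M →ₗ[Λᵐᵒᵖ] N} (hf : Function.Injective f) :
    Function.Surjective (map (R := R) f) := fun u => by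
  obtain ⟨v, hv⟩ := (MatlisModule.injective (R := R)).out (f.restrictScalars R) hf
    (u : M →ₗ[R] MatlisModule R)
  exact ⟨of v, ext hv⟩

theorem map_exact {P : Type u} [AddCommGroup P] [Module R P] [Module Λᵐᵒᵖ P]
    [IsScalarTower R Λᵐᵒᵖ P] {f : M →ₗ[Λᵐᵒᵖ] N} {g : N →ₗ[Λᵐᵒᵖ] P} (h : Function.Exact f g)
    (hg : Function.Surjective g) : Function.Exact (map (R := R) g) (map (R := R) f) := by
  intro u
  constructor
  · intro hu
    have hker : LinearMap.ker (g.restrictScalars R) ≤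
        LinearMap.ker (u : N →ₗ[R] MatlisModule R) := by
      intro x hx
      obtain ⟨y, rfl⟩ := (h x).1 hx
      exact DFunLike.congr_fun hu y
    let e := (g.restrictScalars R).quotKerEquivOfSurjective hg
    refine ⟨of (LinearMap.comp ((LinearMap.ker (g.restrictScalars R)).liftQ
      (u : N →ₗ[R] MatlisModule R) hker) e.symm.toLinearMap), ext fun x => ?_⟩
    have : e.symm (g x) = Submodule.Quotient.mk x := by
      rw [LinearEquiv.symm_apply_eq]; rfl
    rw [map_apply, of_apply, LinearMap.comp_apply, LinearEquiv.coe_coe, this]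
    rfl
  · rintro ⟨v, rfl⟩
    ext x
    simp [h.apply_apply_eq_zero x]

variable [IsArtinianRing R]

theorem finite [Module.Finite R M] : Module.Finite R (RightDual R M) :=
  MatlisModule.finite_dual M

end RightDual

namespace MatlisDual

variable {R Λ} [IsArtinianRing R] [Module.Finite R Λ]

theorem finite : Module.Finite R (MatlisDual R Λ) := MatlisModule.finite_dual Λ

-- A module map `g : I → ω` is determined by the functional `x ↦ g(x)(1)`. Extending that functional
-- to the whole ring gives the element of `ω` required by Baer's criterion.
omit [IsArtinianRing R] [Module.Finite R Λ] in
theorem injective_right : Module.Injective Λᵐᵒᵖ (MatlisDual R Λ) := by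
  refine Module.Baer.injective fun I g => ?_
  obtain ⟨ψ, hψ⟩ := (MatlisModule.injective (R := R)).out (I.subtype.restrictScalars R)
    Subtype.val_injective (eval 1 ∘ₗ g.restrictScalars R)
  refine ⟨LinearMap.toSpanSingleton Λᵐᵒᵖ (MatlisDual R Λ)
    (of (ψ ∘ₗ (MulOpposite.opLinearEquiv R).toLinearMap)), fun x hx => ext fun y => ?_⟩
  have h1 := hψ (MulOpposite.op y • ⟨x, hx⟩)
  simp only [LinearMap.restrictScalars_apply, LinearMap.comp_apply, eval_apply, map_smul,
    op_smul_apply, MulOpposite.unop_op, mul_one] at h1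
  exact h1

omit [IsArtinianRing R] [Module.Finite R Λ] in
theorem injective_left : Module.Injective Λ (MatlisDual R Λ) := by
  refine Module.Baer.injective fun I g => ?_
  obtain ⟨ψ, hψ⟩ := (MatlisModule.injective (R := R)).out (I.subtype.restrictScalars R)
    Subtype.val_injective (eval 1 ∘ₗ g.restrictScalars R)
  refine ⟨LinearMap.toSpanSingleton Λ (MatlisDual R Λ) (of ψ), fun x hx => ext fun y => ?_⟩
  have h1 := hψ (y • ⟨x, hx⟩)
  simp only [LinearMap.restrictScalars_apply, LinearMap.comp_apply, eval_apply, map_smul,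
    smul_apply, one_mul] at h1
  exact h1

end MatlisDual

namespace RightDual

variable {R Λ}
variable {M : Type u} [AddCommGroup M] [Module R M] [Module Λᵐᵒᵖ M] [IsScalarTower R Λᵐᵒᵖ M]

/-- The map of right modules `M → ω ^ k` defined by `k` elements of the dual of `M`. -/
noncomputable def toPi {k : ℕ} (u : Fin k → RightDual R M) :
    M →ₗ[Λᵐᵒᵖ] (Fin k → MatlisDual R Λ) :=
  LinearMap.pi fun i =>
    { toFun := fun m => MatlisDual.of ((u i : M →ₗ[R] MatlisModule R) ∘ₗ
        (LinearMap.toSpanSingleton Λᵐᵒᵖ M m).restrictScalars R ∘ₗ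
          (MulOpposite.opLinearEquiv R).toLinearMap)
      map_add' := fun m m' => MatlisDual.ext fun x =>
        (congrArg (u i) (smul_add (MulOpposite.op x) m m')).trans (map_add (u i) _ _)
      map_smul' := fun a m => MatlisDual.ext fun x =>
        congrArg (u i) (mul_smul (MulOpposite.op x) a m).symm }

theorem toPi_apply {k : ℕ} (u : Fin k → RightDual R M) (m : M) (i : Fin k) (x : Λ) :
    toPi (Λ := Λ) u m i x = u i (MulOpposite.op x • m) := rfl

theorem sum_apply {k : ℕ} (u : Fin k → RightDual R M) (c : Fin k → Λ) (m : M) :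
    (∑ i, c i • u i) m = ∑ i, u i (MulOpposite.op (c i) • m) :=
  LinearMap.sum_apply (M₂ := MatlisModule R) _ _ _

variable [IsArtinianRing R]

theorem exists_generators [Module.Finite R M] :
    ∃ (k : ℕ) (u : Fin k → RightDual R M), Submodule.span Λ (Set.range u) = ⊤ := by
  have := finite (R := R) (M := M)
  have : Module.Finite Λ (RightDual R M) := Module.Finite.of_restrictScalars_finite R Λ _
  exact Module.Finite.exists_fin

/-- An element of the kernel is killed by every combination of the generators, hence by all
functionals, and these separate points. -/
theorem toPi_injective {k : ℕ} {u : Fin k → RightDual R M}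
    (hu : Submodule.span Λ (Set.range u) = ⊤) : Function.Injective (toPi (Λ := Λ) u) := by
  rw [injective_iff_map_eq_zero]
  intro m hm
  refine eq_of_forall_apply_eq (R := R) fun f => ?_
  obtain ⟨c, rfl⟩ := (Submodule.mem_span_range_iff_exists_fun Λ).1
    (hu ▸ Submodule.mem_top : f ∈ Submodule.span Λ (Set.range u))
  rw [map_zero, sum_apply]
  refine Finset.sum_eq_zero fun i _ => ?_
  rw [← toPi_apply, hm]
  rfl

variable [Module.Finite R Λ]

/-- The embedding `M → ω^k` given by generators of the dual splits. Dualizing and using biduality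
`D(ω) = Λ` exhibits the dual of `M` as a summand of `Λ^k`; `c` below records the coordinates in `Λ`.
-/
theorem projective_of_injective [Module.Finite R M] (hM : Module.Injective Λᵐᵒᵖ M) :
    Module.Projective Λ (RightDual R M) := by
  classical
  obtain ⟨k, u, hu⟩ := exists_generators (R := R) (Λ := Λ) (M := M)
  obtain ⟨r, hr⟩ := hM.out (toPi (Λ := Λ) u) (toPi_injective hu) LinearMap.id
  have key : ∀ (v : RightDual R M) (i : Fin k), ∃ c : Λ, ∀ w : MatlisDual R Λ,
      v (r (Pi.single i w)) = w c := by
    intro v i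
    obtain ⟨x, hx⟩ := MatlisDual.exists_eval_eq ((v : M →ₗ[R] MatlisModule R) ∘ₗ
      r.restrictScalars R ∘ₗ LinearMap.single R (fun _ => MatlisDual R Λ) i)
    exact ⟨x, fun w => LinearMap.congr_fun hx w⟩
  choose c hc using key
  let s : RightDual R M →ₗ[Λ] (Fin k → Λ) :=
    { toFun := fun v i => c v i
      map_add' := fun v v' => funext fun i => MatlisDual.eq_of_forall_apply_eq fun w => by
        rw [← hc, Pi.add_apply, map_add, ← hc, ← hc]; rfl
      map_smul' := fun a v => funext fun i => MatlisDual.eq_of_forall_apply_eq fun w => by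
        rw [← hc, smul_apply, ← map_smul, ← Pi.single_smul, hc]; rfl }
  refine Module.Projective.of_split s (Fintype.linearCombination Λ u) (LinearMap.ext fun v =>
    ext fun m => ?_)
  change (∑ i, c v i • u i) m = v m
  have h2 : v m = v (r (toPi (Λ := Λ) u m)) := by rw [hr]; rfl
  rw [sum_apply, h2, ← Finset.univ_sum_single (toPi (Λ := Λ) u m), map_sum, map_sum]
  refine Finset.sum_congr rfl fun i _ => ?_
  rw [hc]
  rfl

-- For Baer's criterion, lift the dual of `f : I → M` through the surjection from the dual of the
-- ring to the dual of `I`. Evaluating the lift at `1` is a functional on the dual of `M`, hence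
-- evaluation at some `m`, and `m` extends `f`.
omit [Module.Finite R Λ] in
theorem injective_of_projective [Module.Finite R M] (hM : Module.Projective Λ (RightDual R M)) :
    Module.Injective Λᵐᵒᵖ M := by
  refine Module.Baer.injective fun I f => ?_
  obtain ⟨g, hg⟩ := Module.projective_lifting_property (map (R := R) I.subtype) (map (R := R) f)
    (map_surjective I.subtype_injective)
  obtain ⟨m, hm⟩ := exists_eval_eq (R := R) (M := M)
    { toFun := fun u => g u 1
      map_add' := fun x y => by rw [map_add]; rfl
      map_smul' := fun r x => by rw [LinearMap.map_smul_of_tower]; rfl }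
  refine ⟨LinearMap.toSpanSingleton Λᵐᵒᵖ M m, fun a ha =>
    eq_of_forall_apply_eq (R := R) fun u => ?_⟩
  have h1 : g (a.unop • u) 1 = (a.unop • u) m := hm _
  rw [map_smul, smul_apply, smul_apply, MulOpposite.op_unop, smul_eq_mul, mul_one] at h1
  exact h1.symm.trans (DFunLike.congr_fun (LinearMap.congr_fun hg u) ⟨a, ha⟩)

/-- The sequence `0 → M → ω^k → C → 0` dualizes to a presentation of the dual of `M` by a projective
module with kernel the dual of `C`; both dimensions drop together. -/
theorem hasProjectiveDimensionLT_iff (m : ℕ) (M : Type u) [AddCommGroup M] [Module R M]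
    [Module Λᵐᵒᵖ M] [IsScalarTower R Λᵐᵒᵖ M] [Module.Finite R M] :
    HasProjectiveDimensionLT (ModuleCat.of Λ (RightDual R M)) (m + 1) ↔
      HasInjectiveDimensionLT (ModuleCat.of Λᵐᵒᵖ M) (m + 1) := by
  induction m generalizing M with
  | zero =>
    rw [zero_add, ← projective_iff_hasProjectiveDimensionLT_one,
      ← injective_iff_hasInjectiveDimensionLT_one, ← Module.injective_iff_injective_object,
      ← IsProjective.iff_projective]
    exact ⟨injective_of_projective, projective_of_injective⟩
  | succ m ih =>
    obtain ⟨k, u, hu⟩ := exists_generators (R := R) (Λ := Λ) (M := M)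
    have := MatlisDual.finite (R := R) (Λ := Λ)
    have : Module.Injective Λᵐᵒᵖ (MatlisDual R Λ) := MatlisDual.injective_right
    have hI : Module.Injective Λᵐᵒᵖ (Fin k → MatlisDual R Λ) := inferInstance
    let q := (LinearMap.range (toPi (Λ := Λ) u)).mkQ
    have hex : Function.Exact (toPi (Λ := Λ) u) q := LinearMap.exact_map_mkQ_range _
    have hq : Function.Surjective q := Submodule.mkQ_surjective _
    have s1 : (ShortComplex.mk (ModuleCat.ofHom (toPi (Λ := Λ) u)) (ModuleCat.ofHom q)
        (by ext x; exact hex.apply_apply_eq_zero x)).ShortExact :=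
      ModuleCat.shortComplex_shortExact _ hex (toPi_injective hu) hq
    have hex2 := map_exact (R := R) hex hq
    have s2 : (ShortComplex.mk (ModuleCat.ofHom (map (R := R) q))
        (ModuleCat.ofHom (map (R := R) (toPi (Λ := Λ) u)))
        (by ext x : 2; exact hex2.apply_apply_eq_zero x)).ShortExact :=
      ModuleCat.shortComplex_shortExact _ hex2 (map_injective hq) (map_surjective (toPi_injective hu))
    have hP : Module.Projective Λ (RightDual R (Fin k → MatlisDual R Λ)) :=
      projective_of_injective hI
    rw [s2.hasProjectiveDimensionLT_X₃_iff m ((IsProjective.iff_projective _).1 hP)]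
    have h3 := s1.hasInjectiveDimensionLT_X₃_iff m
      (Module.injective_object_of_injective_module Λᵐᵒᵖ (Fin k → MatlisDual R Λ))
    exact (ih _).trans h3

end RightDual

/-- The injective dimension of `Λ` as a right module is the projective dimension of `ω` as a
left module. -/
theorem MatlisDual.hasProjectiveDimensionLT_iff [IsArtinianRing R] [Module.Finite R Λ] (m : ℕ) :
    HasProjectiveDimensionLT (ModuleCat.of Λ (MatlisDual R Λ)) (m + 1) ↔
      HasInjectiveDimensionLT (ModuleCat.of Λᵐᵒᵖ Λ) (m + 1) := by
  rw [← RightDual.hasProjectiveDimensionLT_iff (R := R) (Λ := Λ) m Λ]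
  let e : MatlisDual R Λ ≃ₗ[Λ] RightDual R Λ :=
    { toFun := fun f => f
      invFun := fun f => f
      map_add' := fun _ _ => rfl
      map_smul' := fun _ _ => rfl
      left_inv := fun _ => rfl
      right_inv := fun _ => rfl }
  exact ⟨fun _ => hasProjectiveDimensionLT_of_iso e.toModuleIso _,
    fun _ => hasProjectiveDimensionLT_of_iso e.toModuleIso.symm _⟩

end RightDual

/-! ### The tensor-hom adjunction of a bimodule -/

section TensorHom

variable (R S : Type u) [Ring R] [Ring S] (ω : Type u) [AddCommGroup ω] [Module R ω]
  [Module Sᵐᵒᵖ ω]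

namespace BalancedTensor

variable {N : Type u} [AddCommGroup N] [Module S N]

variable {ω} in
/-- The pure tensor `x ⊗ y` in `ω ⊗_S N`. -/
def tmul (x : ω) (y : N) : BalancedTensor R S ω N :=
  Submodule.Quotient.mk (x ⊗ₜ[ℤ] y)

variable {ω}

theorem tmul_smul (x : ω) (s : S) (y : N) :
    tmul R S x (s • y) = tmul R S (MulOpposite.op s • x) y := by
  symm
  exact (Submodule.Quotient.eq _).2 (Submodule.subset_span ⟨x, s, y, rfl⟩)

theorem tmul_add (x : ω) (y z : N) : tmul R S x (y + z) = tmul R S x y + tmul R S x z := by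
  simp only [tmul, TensorProduct.tmul_add, Submodule.Quotient.mk_add]

theorem add_tmul (x x' : ω) (y : N) : tmul R S (x + x') y = tmul R S x y + tmul R S x' y := by
  simp only [tmul, TensorProduct.add_tmul, Submodule.Quotient.mk_add]

theorem tmul_zero (x : ω) : tmul R S x (0 : N) = 0 := by
  simp only [tmul, TensorProduct.tmul_zero, Submodule.Quotient.mk_zero]

theorem smul_tmul (r : R) (x : ω) (y : N) : tmul R S (r • x) y = r • tmul R S x y := rfl

variable {R S}

theorem hom_ext {M : Type u} [AddCommGroup M] [Module R M] {f g : BalancedTensor R S ω N →ₗ[R] M}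
    (h : ∀ x y, f (tmul R S x y) = g (tmul R S x y)) : f = g :=
  Submodule.linearMap_qext _ (TensorProduct.AlgebraTensorModule.ext h)

/-- The linear map on `ω ⊗_S N` induced by a balanced bilinear map. -/
noncomputable def lift {M : Type u} [AddCommGroup M] [Module R M] (b : ω →ₗ[R] N →ₗ[ℤ] M)
    (hb : ∀ x (s : S) y, b (MulOpposite.op s • x) y = b x (s • y)) :
    BalancedTensor R S ω N →ₗ[R] M :=
  Submodule.liftQ _ (TensorProduct.AlgebraTensorModule.lift b) (by
    refine Submodule.span_le.2 ?_
    rintro _ ⟨x, s, f, rfl⟩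
    change _ = _
    rw [map_sub, sub_eq_zero]
    exact hb x s f)

end BalancedTensor

open BalancedTensor

variable [SMulCommClass R Sᵐᵒᵖ ω]

/-- The map `x ↦ x ⊗ y`. -/
def tmulRight {N : Type u} [AddCommGroup N] [Module S N] (y : N) :
    ω →ₗ[R] BalancedTensor R S ω N where
  toFun x := tmul R S x y
  map_add' x x' := add_tmul R S x x' y
  map_smul' r x := smul_tmul R S r x y

/-- The unit `η_N : N → Hom_R(ω, ω ⊗_S N)`. -/
noncomputable def coevalMap (N : Type u) [AddCommGroup N] [Module S N] :
    N →ₗ[S] BimodHom R ω (BalancedTensor R S ω N) where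
  toFun y := tmulRight R S ω y
  map_add' y z := LinearMap.ext fun x => tmul_add R S x y z
  map_smul' s y := LinearMap.ext fun x => tmul_smul R S x s y

/-- The tensor-hom adjunction. -/
noncomputable def tensorHomAdjunction : tensorFunctor R S ω ⊣ homFunctor R S ω :=
  Adjunction.mkOfUnitCounit
    { unit := { app := fun N => ModuleCat.ofHom (coevalMap R S ω N)
                naturality := fun _ _ _ => rfl }
      counit := evalTrans R S ω
      left_triangle := by
        ext N : 3
        exact hom_ext fun _ _ => rfl
      right_triangle := rfl }

/-- `ω ⊗_S S^(J) → ω^(J)`. -/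
noncomputable def tensorFinsuppMap (J : Type u) :
    BalancedTensor R S ω (J →₀ S) →ₗ[R] (J →₀ ω) :=
  BalancedTensor.lift
    { toFun := fun x => ((Finsupp.mapRange.addMonoidHom
          ({ toFun := fun s => MulOpposite.op s • x
             map_zero' := by simp
             map_add' := fun s t => by simp [add_smul] } : S →+ ω)).toIntLinearMap)
      map_add' := fun x y => LinearMap.ext fun f => Finsupp.ext fun j =>
        smul_add (MulOpposite.op (f j)) x y
      map_smul' := fun r x => LinearMap.ext fun f => Finsupp.ext fun j =>
        (smul_comm r (MulOpposite.op (f j)) x).symm }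
    (fun x s f => Finsupp.ext fun j => (mul_smul (MulOpposite.op (f j)) (MulOpposite.op s) x).symm)

theorem tensorFinsuppMap_tmul_apply (J : Type u) (x : ω) (f : J →₀ S) (j : J) :
    tensorFinsuppMap R S ω J (tmul R S x f) j = MulOpposite.op (f j) • x := rfl

theorem tensorFinsuppMap_tmul_single (J : Type u) (x : ω) (s : S) (j : J) :
    tensorFinsuppMap R S ω J (tmul R S x (Finsupp.single j s)) =
      Finsupp.single j (MulOpposite.op s • x) := by
  classical
  refine Finsupp.ext fun k => ?_
  rw [tensorFinsuppMap_tmul_apply, Finsupp.single_apply, Finsupp.single_apply]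
  split_ifs <;> simp

/-- `ω ⊗_S S^(J) ≅ ω^(J)`. -/
noncomputable def tensorFinsuppEquiv (J : Type u) :
    BalancedTensor R S ω (J →₀ S) ≃ₗ[R] (J →₀ ω) :=
  LinearEquiv.ofLinearMap (tensorFinsuppMap R S ω J)
    (Finsupp.lsum ℕ fun j => tmulRight R S ω (Finsupp.single j 1 : J →₀ S))
    (by
      refine Finsupp.lhom_ext fun j x => ?_
      rw [LinearMap.comp_apply, Finsupp.lsum_single]
      exact (tensorFinsuppMap_tmul_single R S ω J x 1 j).trans (by simp))
    (by
      refine hom_ext fun x f => ?_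
      induction f using Finsupp.induction_linear with
      | zero => rw [tmul_zero, map_zero, map_zero]
      | add f g hf hg => rw [tmul_add, map_add, map_add, hf, hg]
      | single j s =>
        have h1 : (Finsupp.single j s : J →₀ S) = s • Finsupp.single j 1 := by simp
        rw [LinearMap.comp_apply, LinearMap.id_apply, tensorFinsuppMap_tmul_single,
          Finsupp.lsum_single, h1, tmul_smul]
        rfl)

theorem tensorFinsuppEquiv_tmul_apply (J : Type u) (x : ω) (f : J →₀ S) (j : J) :
    tensorFinsuppEquiv R S ω J (tmul R S x f) j = MulOpposite.op (f j) • x := rfl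

end TensorHom

/-! ### Direct sums of injective modules -/

theorem Finsupp.exists_finset_le_supported {A J M : Type*} [Ring A] [AddCommGroup M] [Module A M]
    {N : Submodule A (J →₀ M)} (hN : N.FG) :
    ∃ t : Finset J, N ≤ Finsupp.supported M A (t : Set J) := by
  classical
  obtain ⟨s, rfl⟩ := hN
  refine ⟨s.biUnion Finsupp.support, (Finsupp.span_le_supported_biUnion_support A _).trans
    (Finsupp.supported_mono ?_)⟩
  simp

/-- A left ideal is finitely generated, so a map from it to a direct sum meets only finitely many
coordinates, and a finite product of injective modules is injective. -/
theorem Module.Injective.finsupp {A M : Type u} [Ring A] [IsNoetherianRing A] [AddCommGroup M]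
    [Module A M] (hM : Module.Injective A M) (J : Type u) : Module.Injective A (J →₀ M) := by
  classical
  refine Module.Baer.injective fun I g => ?_
  obtain ⟨t, ht⟩ := Finsupp.exists_finset_le_supported (A := A)
    (Submodule.FG.map g (Module.finite_def.1 (inferInstance : Module.Finite A I)))
  let incl : (t → M) →ₗ[A] (J →₀ M) :=
    Finsupp.lmapDomain M A ((↑) : t → J) ∘ₗ (Finsupp.linearEquivFunOnFinite A M t).symm.toLinearMap
  obtain ⟨h, hh⟩ := (inferInstance : Module.Injective A (t → M)).out I.subtype I.subtype_injective
    (LinearMap.pi fun j => Finsupp.lapply (j : J) ∘ₗ g)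
  refine ⟨incl ∘ₗ h, fun x hx => ?_⟩
  rw [LinearMap.comp_apply, show h x = _ from hh ⟨x, hx⟩]
  ext j
  by_cases hj : j ∈ t
  · exact Finsupp.mapDomain_apply Subtype.val_injective _ (⟨j, hj⟩ : t)
  · have h1 : g ⟨x, hx⟩ j = 0 :=
      (Finsupp.mem_supported' A _).1 (ht ⟨⟨x, hx⟩, trivial, rfl⟩) j hj
    rw [h1]
    exact Finsupp.mapDomain_of_notMem_range _ _ (by simpa using hj)

/-! ### The bimodule `ω` of an artin algebra -/

theorem IsArtinianRing.of_artinAlgebra (R Λ : Type u) [CommRing R] [IsArtinianRing R] [Ring Λ]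
    [Algebra R Λ] [Module.Finite R Λ] : IsArtinianRing Λ :=
  isArtinian_of_tower R (inferInstance : IsArtinian R Λ)

theorem IsNoetherianRing.of_artinAlgebra (R Λ : Type u) [CommRing R] [IsArtinianRing R] [Ring Λ]
    [Algebra R Λ] [Module.Finite R Λ] : IsNoetherianRing Λ :=
  isNoetherian_of_tower R (inferInstance : IsNoetherian R Λ)

section Omega

variable {R Λ : Type u} [CommRing R] [IsArtinianRing R] [Ring Λ] [Algebra R Λ]

namespace MatlisDual

/-- An `R`-linear functional `f` with `f m ≠ 0` induces the `Λ`-linear map `x ↦ (a ↦ f (a x))`. Thus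
`ω` is a cogenerator. -/
theorem exists_hom_apply_ne_zero {M : Type u} [AddCommGroup M] [Module Λ M] {m : M} (hm : m ≠ 0) :
    ∃ f : M →ₗ[Λ] MatlisDual R Λ, f m ≠ 0 := by
  let _ : Module R M := Module.compHom M (algebraMap R Λ)
  have : IsScalarTower R Λ M := ⟨fun r a x => by
    rw [Algebra.smul_def, mul_smul]; rfl⟩
  obtain ⟨f, hf⟩ := MatlisModule.exists_apply_ne_zero (R := R) hm
  refine ⟨{ toFun := fun x => of (f ∘ₗ (LinearMap.toSpanSingleton Λ M x).restrictScalars R)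
            map_add' := fun x y => ext fun a => ?_
            map_smul' := fun a x => ext fun b => ?_ }, fun h => hf ?_⟩
  · exact (congrArg f (smul_add a x y)).trans (map_add f _ _)
  · exact congrArg f (mul_smul b a x).symm
  · have h1 := DFunLike.congr_fun h (1 : Λ)
    exact (congrArg f (one_smul Λ m)).symm.trans h1

variable [Module.Finite R Λ]

instance : Module.Finite Λ (MatlisDual R Λ) :=
  have := finite (R := R) (Λ := Λ)
  Module.Finite.of_restrictScalars_finite R Λ _

/-- The functional `w ↦ (h w)(1)` on `ω` is evaluation at some `a` by biduality, and linearity of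
`h` recovers all other values. -/
theorem exists_hom_eq (h : MatlisDual R Λ →ₗ[Λ] MatlisDual R Λ) :
    ∃ a : Λ, ∀ w, h w = MulOpposite.op a • w := by
  obtain ⟨a, ha⟩ := exists_eval_eq (eval 1 ∘ₗ h.restrictScalars R)
  refine ⟨a, fun w => ext fun x => ?_⟩
  have h1 := LinearMap.congr_fun ha (x • w)
  simpa using h1

/-- Under `ω ⊗ Λ^(J) ≅ ω^(J)`, a map out of the finitely generated module `ω` involves finitely many
coordinates, each of which is right multiplication by an element of `Λ`. -/
theorem coevalMap_finsupp_bijective (J : Type u) :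
    Function.Bijective (coevalMap Λ Λ (MatlisDual R Λ) (J →₀ Λ)) := by
  classical
  constructor
  · rw [injective_iff_map_eq_zero]
    intro f hf
    ext j
    refine eq_of_forall_apply_eq (R := R) fun w => ?_
    have h0 : BalancedTensor.tmul Λ Λ w f = 0 :=
      LinearMap.congr_fun (show tmulRight Λ Λ (MatlisDual R Λ) f = 0 from hf) w
    have h2 : MulOpposite.op (f j) • w = 0 := by
      rw [← tensorFinsuppMap_tmul_apply Λ Λ, h0, map_zero]
      rfl
    have h3 := DFunLike.congr_fun h2 (1 : Λ)
    simpa using h3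
  · intro h
    let e := tensorFinsuppEquiv Λ Λ (MatlisDual R Λ) J
    let h' : MatlisDual R Λ →ₗ[Λ] (J →₀ MatlisDual R Λ) := e.toLinearMap ∘ₗ h
    obtain ⟨t, ht⟩ := Finsupp.exists_finset_le_supported (A := Λ)
      (Submodule.FG.map h' (Module.finite_def.1 (inferInstance : Module.Finite Λ (MatlisDual R Λ))))
    choose a ha using fun j => exists_hom_eq (Finsupp.lapply j ∘ₗ h')
    refine ⟨Finsupp.onFinset t (fun j => if j ∈ t then a j else 0) (by simp_all), ?_⟩
    refine LinearMap.ext fun w => e.injective (Finsupp.ext fun j => ?_)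
    refine (tensorFinsuppEquiv_tmul_apply Λ Λ (MatlisDual R Λ) J w _ j).trans ?_
    change _ = h' w j
    by_cases hj : j ∈ t
    · simpa [hj] using (ha j w).symm
    · have h1 : h' w j = 0 := (Finsupp.mem_supported' Λ _).1 (ht ⟨w, trivial, rfl⟩) j hj
      simp [h1, hj]

theorem injective_tensor_finsupp (J : Type u) :
    Injective ((tensorFunctor Λ Λ (MatlisDual R Λ)).obj (ModuleCat.of Λ (J →₀ Λ))) := by
  have := IsNoetherianRing.of_artinAlgebra R Λ
  have h := (injective_left (R := R) (Λ := Λ)).finsupp J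
  have := Module.injective_object_of_injective_module Λ (J →₀ MatlisDual R Λ)
  exact Injective.of_iso (tensorFinsuppEquiv Λ Λ (MatlisDual R Λ) J).symm.toModuleIso this

end MatlisDual

theorem ModuleCat.exists_retract_finsupp {A : Type u} [Ring A] (P : ModuleCat.{u} A)
    [Projective P] : ∃ J : Type u, Nonempty (Retract P (ModuleCat.of A (J →₀ A))) := by
  have hP : Module.Projective A P := (IsProjective.iff_projective P).2 inferInstance
  obtain ⟨s, hs⟩ := hP.out
  exact ⟨P, ⟨⟨ModuleCat.ofHom s, ModuleCat.ofHom (Finsupp.linearCombination A id),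
    ModuleCat.hom_ext (LinearMap.ext hs)⟩⟩⟩

variable [Module.Finite R Λ]

variable (R) in
/-- `ω ⊗ P` is injective for projective `P`. -/
theorem injective_tensorFunctor_obj (P : ModuleCat.{u} Λ) [Projective P] :
    Injective ((tensorFunctor Λ Λ (MatlisDual R Λ)).obj P) := by
  obtain ⟨J, ⟨r⟩⟩ := ModuleCat.exists_retract_finsupp P
  have := MatlisDual.injective_tensor_finsupp (R := R) (Λ := Λ) J
  exact (r.map _).injective

theorem isIso_app_of_retract {C D : Type*} [Category C] [Category D] {F G : C ⥤ D} (τ : F ⟶ G)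
    {X Y : C} (r : Retract X Y) [IsIso (τ.app Y)] : IsIso (τ.app X) := by
  refine ⟨G.map r.i ≫ inv (τ.app Y) ≫ F.map r.r, ?_, ?_⟩
  · rw [← NatTrans.naturality_assoc, IsIso.hom_inv_id_assoc, ← F.map_comp, r.retract, F.map_id]
  · rw [Category.assoc, Category.assoc, τ.naturality, IsIso.inv_hom_id_assoc, ← G.map_comp,
      r.retract, G.map_id]

variable (R) in
theorem isIso_unit_app_of_projective (P : ModuleCat.{u} Λ) [Projective P] :
    IsIso ((tensorHomAdjunction Λ Λ (MatlisDual R Λ)).unit.app P) := by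
  obtain ⟨J, ⟨r⟩⟩ := ModuleCat.exists_retract_finsupp P
  have : IsIso ((tensorHomAdjunction Λ Λ (MatlisDual R Λ)).unit.app (ModuleCat.of Λ (J →₀ Λ))) :=
    (ConcreteCategory.isIso_iff_bijective _).2 (MatlisDual.coevalMap_finsupp_bijective J)
  exact isIso_app_of_retract _ r

variable (R) in
/-- Every injective module is a direct summand of a direct sum of copies of `ω`. -/
theorem exists_retract_tensor_finsupp (I : ModuleCat.{u} Λ) [Injective I] :
    ∃ J : Type u, Nonempty (Retract I
      ((tensorFunctor Λ Λ (MatlisDual R Λ)).obj (ModuleCat.of Λ (J →₀ Λ)))) := by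
  classical
  have := IsArtinianRing.of_artinAlgebra R Λ
  -- Each simple summand of the socle embeds in the cogenerator `ω`, so the socle embeds in a direct
  -- sum of copies of `ω`; that sum is injective, so the embedding extends to `I`.
  let soc : Submodule Λ I := sSup {S | IsSimpleModule Λ S}
  have hss : IsSemisimpleModule Λ soc := by
    have := isSemisimpleModule_biSup_of_isSemisimpleModule_submodule (R := Λ) (M := I)
      (s := {S : Submodule Λ I | IsSimpleModule Λ S}) (p := fun S => S) (fun S hS => by
        have : IsSimpleModule Λ S := hS
        exact inferInstanceAs (IsSemisimpleModule Λ S))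
    rwa [← sSup_eq_iSup] at this
  obtain ⟨s, e, -, hs⟩ := IsSemisimpleModule.exists_linearEquiv_dfinsupp Λ soc
  have key : ∀ m : s, ∃ f : m.1 →ₗ[Λ] MatlisDual R Λ, Function.Injective f := by
    intro m
    have := hs m
    have := IsSimpleModule.nontrivial Λ m.1
    obtain ⟨x, hx⟩ := exists_ne (0 : m.1)
    obtain ⟨f, hf⟩ := MatlisDual.exists_hom_apply_ne_zero (R := R) (Λ := Λ) hx
    exact ⟨f, (LinearMap.injective_or_eq_zero f).resolve_right fun h => hf (by rw [h]; rfl)⟩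
  choose f hf using key
  let φ : soc →ₗ[Λ] (s →₀ MatlisDual R Λ) :=
    (finsuppLequivDFinsupp Λ).symm.toLinearMap ∘ₗ (DFinsupp.mapRange.linearMap f) ∘ₗ e.toLinearMap
  have hφ : Function.Injective φ :=
    (finsuppLequivDFinsupp Λ).symm.injective.comp
      (((DFinsupp.mapRange_injective _ fun m => (f m).map_zero).2 hf).comp e.injective)
  let J := s
  let e' := tensorFinsuppEquiv Λ Λ (MatlisDual R Λ) J
  have hinj := MatlisDual.injective_tensor_finsupp (R := R) (Λ := Λ) J
  have hinj' : Module.Injective Λ (BalancedTensor Λ Λ (MatlisDual R Λ) (J →₀ Λ)) :=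
    @Module.injective_module_of_injective_object _ _ _ _ _ hinj
  obtain ⟨ψ, hψ⟩ := hinj'.out soc.subtype soc.subtype_injective (e'.symm.toLinearMap ∘ₗ φ)
  -- A nonzero cyclic module over an artinian ring contains a simple submodule. A nonzero kernel
  -- would therefore meet the socle, where `ψ` is injective.
  have hψi : Function.Injective ψ := by
    rw [injective_iff_map_eq_zero]
    intro x hx
    by_contra hne
    have : IsArtinian Λ (Submodule.span Λ {x}) := isArtinian_of_fg_of_artinian _ ⟨{x}, by simp⟩
    have hnt : Nontrivial (Submodule.span Λ {x}) := by
      rw [Submodule.nontrivial_iff_ne_bot]; simpa using hne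
    obtain ⟨S, hS⟩ := IsAtomic.exists_atom (Submodule Λ (Submodule.span Λ {x}))
    have hS' : IsSimpleModule Λ S := isSimpleModule_iff_isAtom.2 hS
    let S' : Submodule Λ I := S.map (Submodule.span Λ {x}).subtype
    have hS'' : IsSimpleModule Λ S' := IsSimpleModule.congr
      (Submodule.equivMapOfInjective _ (Submodule.injective_subtype _) S).symm
    have hle : S' ≤ soc := le_sSup hS''
    refine hS.1 ((Submodule.eq_bot_iff _).2 fun y hy => ?_)
    have hy' : (y : I) ∈ soc := hle ⟨y, hy, rfl⟩
    obtain ⟨r, hr⟩ := Submodule.mem_span_singleton.1 y.2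
    have h1 : ψ y = 0 := by rw [← hr, map_smul, hx, smul_zero]
    have h2 : e'.symm (φ ⟨y, hy'⟩) = 0 := (hψ ⟨y, hy'⟩).symm.trans h1
    have h3 : (⟨y, hy'⟩ : soc) = 0 := hφ (by simpa using h2)
    exact Subtype.ext (show (y : I) = 0 from congrArg Subtype.val h3)
  let k : I ⟶ (tensorFunctor Λ Λ (MatlisDual R Λ)).obj (ModuleCat.of Λ (J →₀ Λ)) :=
    ModuleCat.ofHom ψ
  have hmono : Mono k := (ModuleCat.mono_iff_injective _).2 hψi
  exact ⟨J, ⟨⟨k, Injective.factorThru (𝟙 I) k, Injective.comp_factorThru _ _⟩⟩⟩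

-- On `ω ⊗ Λ^(J)` a triangle identity makes the counit inverse to the image of the invertible unit;
-- every injective module is a retract of such a module.
variable (R) in
theorem isIso_evalTrans_app_of_injective (I : ModuleCat.{u} Λ) [Injective I] :
    IsIso ((evalTrans Λ Λ (MatlisDual R Λ)).app I) := by
  obtain ⟨J, ⟨r⟩⟩ := exists_retract_tensor_finsupp R I
  have hP : Projective (ModuleCat.of Λ (J →₀ Λ)) :=
    (IsProjective.iff_projective _).1 inferInstance
  have := isIso_unit_app_of_projective R (ModuleCat.of Λ (J →₀ Λ))
  have h := (tensorHomAdjunction Λ Λ (MatlisDual R Λ)).left_triangle_components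
    (ModuleCat.of Λ (J →₀ Λ))
  have : IsIso ((evalTrans Λ Λ (MatlisDual R Λ)).app
      ((tensorFunctor Λ Λ (MatlisDual R Λ)).obj (ModuleCat.of Λ (J →₀ Λ)))) :=
    IsIso.of_isIso_fac_left (h := 𝟙 _) h
  exact isIso_app_of_retract _ r

variable (R) in
/-- `Hom(ω, I)` is projective for injective `I`. -/
theorem projective_homFunctor_obj (I : ModuleCat.{u} Λ) [Injective I] :
    Projective ((homFunctor Λ Λ (MatlisDual R Λ)).obj I) := by
  obtain ⟨J, ⟨r⟩⟩ := exists_retract_tensor_finsupp R I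
  have hP : Projective (ModuleCat.of Λ (J →₀ Λ)) :=
    (IsProjective.iff_projective _).1 inferInstance
  have := isIso_unit_app_of_projective R (ModuleCat.of Λ (J →₀ Λ))
  have : Projective ((homFunctor Λ Λ (MatlisDual R Λ)).obj
      ((tensorFunctor Λ Λ (MatlisDual R Λ)).obj (ModuleCat.of Λ (J →₀ Λ)))) :=
    Projective.of_iso (asIso ((tensorHomAdjunction Λ Λ (MatlisDual R Λ)).unit.app
      (ModuleCat.of Λ (J →₀ Λ)))) hP
  exact (r.map (homFunctor Λ Λ (MatlisDual R Λ))).projective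

end Omega

/-! ### Dimension shifting -/

namespace CategoryTheory.ShortComplex.ShortExact

open Abelian

variable {C : Type*} [Category* C] [Abelian C] [HasExt C] {S : ShortComplex C}
  (hS : S.ShortExact)

include hS

theorem subsingleton_ext_X₁ {X : C} {n : ℕ} (h₃ : Subsingleton (Ext X S.X₃ n))
    (h₂ : Subsingleton (Ext X S.X₂ (n + 1))) : Subsingleton (Ext X S.X₁ (n + 1)) := by
  refine subsingleton_of_forall_eq 0 fun e => ?_
  obtain ⟨x, rfl⟩ := Ext.covariant_sequence_exact₁ X hS e (h₂.elim _ _) rfl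
  rw [h₃.elim x 0, Ext.zero_comp]

theorem subsingleton_ext_X₂ {X : C} {n : ℕ} (h₁ : Subsingleton (Ext X S.X₁ n))
    (h₃ : Subsingleton (Ext X S.X₃ n)) : Subsingleton (Ext X S.X₂ n) := by
  refine subsingleton_of_forall_eq 0 fun e => ?_
  obtain ⟨x, rfl⟩ := Ext.covariant_sequence_exact₂ X hS e (h₃.elim _ _)
  rw [h₁.elim x 0, Ext.zero_comp]

theorem subsingleton_ext_X₃ {X : C} {n : ℕ} (h₂ : Subsingleton (Ext X S.X₂ n))
    (h₁ : Subsingleton (Ext X S.X₁ (n + 1))) : Subsingleton (Ext X S.X₃ n) := by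
  refine subsingleton_of_forall_eq 0 fun e => ?_
  obtain ⟨x, rfl⟩ := Ext.covariant_sequence_exact₃ X hS e rfl (h₁.elim _ _)
  rw [h₂.elim x 0, Ext.zero_comp]

theorem subsingleton_ext_left_X₁ {Y : C} {n : ℕ} (h₂ : Subsingleton (Ext S.X₂ Y n))
    (h₃ : Subsingleton (Ext S.X₃ Y (n + 1))) : Subsingleton (Ext S.X₁ Y n) := by
  refine subsingleton_of_forall_eq 0 fun e => ?_
  obtain ⟨x, rfl⟩ := Ext.contravariant_sequence_exact₁ hS Y e (add_comm 1 n) (h₃.elim _ _)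
  rw [h₂.elim x 0, Ext.comp_zero]

theorem subsingleton_ext_left_X₂ {Y : C} {n : ℕ} (h₁ : Subsingleton (Ext S.X₁ Y n))
    (h₃ : Subsingleton (Ext S.X₃ Y n)) : Subsingleton (Ext S.X₂ Y n) := by
  refine subsingleton_of_forall_eq 0 fun e => ?_
  obtain ⟨x, rfl⟩ := Ext.contravariant_sequence_exact₂ hS Y e (h₁.elim _ _)
  rw [h₃.elim x 0, Ext.comp_zero]

theorem exists_lift_of_subsingleton_ext {X : C} (h : Subsingleton (Ext X S.X₁ 1)) (f : X ⟶ S.X₃) :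
    ∃ g : X ⟶ S.X₂, g ≫ S.g = f := by
  obtain ⟨x, hx⟩ := Ext.covariant_sequence_exact₃ X hS (Ext.mk₀ f) rfl (h.elim _ _)
  obtain ⟨g, rfl⟩ := (Ext.mk₀_bijective _ _).2 x
  refine ⟨g, (Ext.mk₀_bijective _ _).1 ?_⟩
  simpa using hx

theorem exists_desc_of_subsingleton_ext {Y : C} (h : Subsingleton (Ext S.X₃ Y 1)) (f : S.X₁ ⟶ Y) :
    ∃ g : S.X₂ ⟶ Y, S.f ≫ g = f := by
  obtain ⟨x, hx⟩ := Ext.contravariant_sequence_exact₁ hS Y (Ext.mk₀ f) rfl (h.elim _ _)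
  obtain ⟨g, rfl⟩ := (Ext.mk₀_bijective _ _).2 x
  refine ⟨g, (Ext.mk₀_bijective _ _).1 ?_⟩
  simpa using hx

/-- Every class in the group is the connecting image of some map `X ⟶ S.X₃`, and the connecting map
kills maps that lift to `S.X₂`. -/
theorem subsingleton_ext_one_of_exists_lift {X : C} (h₂ : Subsingleton (Ext X S.X₂ 1))
    (h : ∀ f : X ⟶ S.X₃, ∃ g : X ⟶ S.X₂, g ≫ S.g = f) : Subsingleton (Ext X S.X₁ 1) := by
  refine subsingleton_of_forall_eq 0 fun e => ?_
  obtain ⟨x, rfl⟩ := Ext.covariant_sequence_exact₁ X hS e (h₂.elim _ _) rfl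
  obtain ⟨f, rfl⟩ := (Ext.mk₀_bijective _ _).2 x
  obtain ⟨g, rfl⟩ := h f
  rw [← Ext.mk₀_comp_mk₀, Ext.comp_assoc_of_second_deg_zero, hS.comp_extClass, Ext.comp_zero]

end CategoryTheory.ShortComplex.ShortExact

namespace CategoryTheory

open Abelian

section

variable {C : Type*} [Category* C] [Abelian C] [HasExt C]

theorem subsingleton_ext_of_injective (X : C) {I : C} [Injective I] (n : ℕ) :
    Subsingleton (Ext X I (n + 1)) :=
  subsingleton_of_forall_eq 0 fun e => e.eq_zero_of_injective

theorem subsingleton_ext_of_projective {P : C} (X : C) [Projective P] (n : ℕ) :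
    Subsingleton (Ext P X (n + 1)) :=
  subsingleton_of_forall_eq 0 fun e => e.eq_zero_of_projective

theorem Retract.subsingleton_ext_left {X Y Z : C} (r : Retract X Y) {n : ℕ}
    (h : Subsingleton (Ext Y Z n)) : Subsingleton (Ext X Z n) := by
  refine subsingleton_of_forall_eq 0 fun e => ?_
  rw [← e.mk₀_id_comp, ← r.retract, ← Ext.mk₀_comp_mk₀, Ext.comp_assoc_of_second_deg_zero,
    h.elim ((Ext.mk₀ r.r).comp e (zero_add n)) 0, Ext.comp_zero]

theorem Retract.subsingleton_ext_right {X Y Z : C} (r : Retract X Y) {n : ℕ}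
    (h : Subsingleton (Ext Z Y n)) : Subsingleton (Ext Z X n) := by
  refine subsingleton_of_forall_eq 0 fun e => ?_
  rw [← e.comp_mk₀_id, ← r.retract, ← Ext.mk₀_comp_mk₀, ← Ext.comp_assoc_of_second_deg_zero,
    h.elim (e.comp (Ext.mk₀ r.i) (add_zero n)) 0, Ext.zero_comp]

omit [HasExt C] in
/-- A short exact sequence embedding `X` into an injective object. -/
theorem exists_shortExact_injective [EnoughInjectives C] (X : C) :
    ∃ (I Y : C) (f : X ⟶ I) (g : I ⟶ Y) (w : f ≫ g = 0),
      Injective I ∧ (ShortComplex.mk f g w).ShortExact :=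
  ⟨Injective.under X, cokernel (Injective.ι X), Injective.ι X, cokernel.π _, cokernel.condition _,
    inferInstance, { exact := ShortComplex.exact_cokernel _ }⟩

/-- The objects `M` with `Ext^i(Z, M) = 0` for all `i ≥ 1`. -/
def Perp (Z M : C) : Prop := ∀ i : ℕ, Subsingleton (Ext Z M (i + 1))

namespace Perp

variable {Z : C} {S : ShortComplex C} (hS : S.ShortExact)

theorem of_injective (Z M : C) [Injective M] : Perp Z M := subsingleton_ext_of_injective Z

include hS in
theorem X₂ (h₁ : Perp Z S.X₁) (h₃ : Perp Z S.X₃) : Perp Z S.X₂ := fun i =>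
  hS.subsingleton_ext_X₂ (h₁ i) (h₃ i)

include hS in
theorem X₃ (h₁ : Perp Z S.X₁) (h₂ : Perp Z S.X₂) : Perp Z S.X₃ := fun i =>
  hS.subsingleton_ext_X₃ (h₂ i) (h₁ (i + 1))

theorem of_iso {M N : C} (h : Perp Z M) (e : M ≅ N) : Perp Z N := fun i =>
  Retract.subsingleton_ext_right ⟨e.inv, e.hom, e.inv_hom_id⟩ (h i)

end Perp

end

end CategoryTheory

/-! ### Modules over artinian rings tested on simple modules -/

namespace ModuleCat

open Abelian

variable {A : Type u} [Ring A]

theorem shortExact_mk {X Y Z : ModuleCat.{u} A} (f : X ⟶ Y) (g : Y ⟶ Z) (w : f ≫ g = 0)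
    (hf : Function.Injective f) (hg : Function.Surjective g)
    (h : ∀ y, g y = 0 → ∃ x, f x = y) : (ShortComplex.mk f g w).ShortExact where
  exact := (ShortComplex.moduleCat_exact_iff _).2 h
  mono_f := (ModuleCat.mono_iff_injective _).2 hf
  epi_g := (ModuleCat.epi_iff_surjective _).2 hg

theorem subsingleton_ext_of_isFiniteLength {X : ModuleCat.{u} A} {n : ℕ}
    (h : ∀ T : ModuleCat.{u} A, IsSimpleModule A T → Subsingleton (Ext X T n))
    (M : Type u) [AddCommGroup M] [Module A M] (hM : IsFiniteLength A M) :
    Subsingleton (Ext X (ModuleCat.of A M) n) := by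
  induction hM with
  | @of_subsingleton M _ _ _ =>
    have := (ModuleCat.isZero_of_subsingleton (ModuleCat.of A M)).hasInjectiveDimensionLT_zero
    exact HasInjectiveDimensionLT.subsingleton _ 0 n (Nat.zero_le n) X
  | @of_simple_quotient M _ _ N hq _ ih =>
    have := hq
    refine (shortExact_mk (ModuleCat.ofHom N.subtype) (ModuleCat.ofHom N.mkQ) (by ext x; simp)
      N.subtype_injective N.mkQ_surjective fun y hy => ?_).subsingleton_ext_X₂ ih (h _ hq)
    exact ⟨⟨y, (Submodule.Quotient.mk_eq_zero N).1 hy⟩, rfl⟩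

theorem exists_finite_projective_surjective (M : ModuleCat.{u} A) [Module.Finite A M] :
    ∃ (P : ModuleCat.{u} A) (p : P ⟶ M), Function.Surjective p.hom ∧ Projective P ∧
      Module.Finite A P := by
  obtain ⟨k, p, hp⟩ := Module.Finite.exists_fin' A M
  exact ⟨ModuleCat.of A (Fin k → A), ModuleCat.ofHom p, hp,
    (IsProjective.iff_projective _).1 inferInstance, inferInstanceAs (Module.Finite A (Fin k → A))⟩

/-- For `n = 0`, the kernel of a finite projective cover map has finite length, so its `Ext^1` from
`M` vanishes by dévissage and the map splits. The general case passes to the syzygy. -/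
theorem hasProjectiveDimensionLT_of_simple [IsArtinianRing A] (n : ℕ) (M : ModuleCat.{u} A)
    [Module.Finite A M]
    (h : ∀ T : ModuleCat.{u} A, IsSimpleModule A T → Subsingleton (Ext M T (n + 1))) :
    HasProjectiveDimensionLT M (n + 1) := by
  have : IsNoetherianRing A := inferInstance
  induction n generalizing M with
  | zero =>
    obtain ⟨P, p, hp, _, _⟩ := exists_finite_projective_surjective M
    have h1 := subsingleton_ext_of_isFiniteLength h (LinearMap.ker p.hom)
      (isFiniteLength_iff_isNoetherian_isArtinian.2 ⟨inferInstance, inferInstance⟩)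
    obtain ⟨s, hs⟩ := (LinearMap.shortExact_shortComplexKer hp).exists_lift_of_subsingleton_ext h1
      (𝟙 M)
    have : Projective M := Retract.projective (Y := P) ⟨s, p, hs⟩
    infer_instance
  | succ n ih =>
    obtain ⟨P, p, hp, _, _⟩ := exists_finite_projective_surjective M
    have hS := LinearMap.shortExact_shortComplexKer hp
    refine (hS.hasProjectiveDimensionLT_X₃_iff n ‹_›).2 (ih _ fun T hT => ?_)
    exact hS.subsingleton_ext_left_X₁ (subsingleton_ext_of_projective T n) (h T hT)

end ModuleCat

set_option linter.unusedSectionVars false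

namespace CategoryTheory

open Abelian

/-! ### Short five lemmas -/

section ShortFive

variable {C : Type*} [Category* C] [Abelian C] {S₁ S₂ : ShortComplex C} (φ : S₁ ⟶ S₂)
  (h₁ : S₁.ShortExact) (h₂ : S₂.ShortExact)

include h₁ h₂

theorem ShortComplex.isIso₁_of_shortExact_of_isIso₂₃ [IsIso φ.τ₂] [IsIso φ.τ₃] : IsIso φ.τ₁ := by
  have := h₁.mono_f
  have := h₂.mono_f
  have : Mono φ.τ₁ := by
    have : Mono (φ.τ₁ ≫ S₂.f) := by rw [φ.comm₁₂]; infer_instance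
    exact mono_of_mono _ S₂.f
  have h0 : (S₂.f ≫ inv φ.τ₂) ≫ S₁.g = 0 := by
    rw [← cancel_mono φ.τ₃, Category.assoc, Category.assoc, ← φ.comm₂₃, IsIso.inv_hom_id_assoc,
      S₂.zero, zero_comp]
  refine ⟨h₁.exact.lift _ h0, ?_, ?_⟩
  · rw [← cancel_mono S₁.f, Category.assoc, h₁.exact.lift_f, ← Category.assoc, φ.comm₁₂]
    simp
  · rw [← cancel_mono S₂.f, Category.assoc, φ.comm₁₂, h₁.exact.lift_f_assoc]
    simp

end ShortFive

/-! ### Dualizing adjunctions -/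

variable {C D : Type*} [Category* C] [Category* D] [Abelian C] [Abelian D]
  {F : C ⥤ D} {G : D ⥤ C} [F.Additive] [G.Additive]

/-- An adjunction `F ⊣ G` that restricts to an equivalence between projective objects and
injective objects, together with a projective object `A` such that `F A` is a cogenerator, and
an object `W` such that `G` is exact in the same situations as `Hom(W, -)`. -/
structure IsDualizing (adj : F ⊣ G) (W : D) (A : C) : Prop where
  isIso_unit : ∀ (P : C) [Projective P], IsIso (adj.unit.app P)
  isIso_counit : ∀ (I : D) [Injective I], IsIso (adj.counit.app I)
  injective : ∀ (P : C) [Projective P], Injective (F.obj P)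
  projective : ∀ (I : D) [Injective I], Projective (G.obj I)
  projective_regular : Projective A
  isZero : ∀ X : D, (∀ f : X ⟶ F.obj A, f = 0) → IsZero X
  epi_iff : ∀ {X Y : D} (g : X ⟶ Y), Epi (G.map g) ↔ ∀ f : W ⟶ Y, ∃ f' : W ⟶ X, f' ≫ g = f

namespace IsDualizing

variable {adj : F ⊣ G} {W : D} {A : C} (h : IsDualizing adj W A)

include h

theorem exists_map_eq {B P : C} [Projective P] (f : F.obj B ⟶ F.obj P) :
    ∃ g : B ⟶ P, F.map g = f := by
  have := h.isIso_unit P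
  refine ⟨adj.homEquiv _ _ f ≫ inv (adj.unit.app P), ?_⟩
  apply (adj.homEquiv _ _).injective
  rw [Adjunction.homEquiv_unit, Adjunction.unit_naturality, Category.assoc, IsIso.inv_hom_id,
    Category.comp_id]

theorem eq_zero_of_map_eq_zero {B P : C} [Projective P] {g : B ⟶ P} (hg : F.map g = 0) :
    g = 0 := by
  have := h.isIso_unit P
  have h1 := adj.unit_naturality g
  rw [hg, Functor.map_zero, comp_zero] at h1
  exact (cancel_mono (adj.unit.app P)).1 (h1.symm.trans zero_comp.symm)

/-- `F.obj A` is an injective cogenerator, so maps into it detect exactness; since the unit at `A`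
is invertible, maps `F.obj X ⟶ F.obj A` are the same as maps `X ⟶ A`. -/
theorem exact_iff (S : ShortComplex C) :
    (S.map F).Exact ↔ ∀ f : S.X₂ ⟶ A, S.f ≫ f = 0 → ∃ g, S.g ≫ g = f := by
  have := h.projective_regular
  have := h.injective A
  constructor
  · intro hS f hf
    have h0 : F.map S.f ≫ F.map f = 0 := by
      rw [← Functor.map_comp, hf, Functor.map_zero]
    obtain ⟨g, hg⟩ := h.exists_map_eq (hS.descToInjective _ h0)
    refine ⟨g, sub_eq_zero.1 (h.eq_zero_of_map_eq_zero ?_)⟩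
    rw [Functor.map_sub, Functor.map_comp, hg, sub_eq_zero]
    exact hS.comp_descToInjective _ h0
  · intro hS
    rw [ShortComplex.exact_iff_isZero_homology]
    refine h.isZero _ fun φ => ?_
    -- Extended to the opcycles, a map out of the homology comes from some `f : S.X₂ ⟶ A` killed by
    -- `S.f`. Factoring `f` through `S.g` makes the original map vanish.
    let φ' : (S.map F).opcycles ⟶ F.obj A := Injective.factorThru φ (S.map F).homologyι
    obtain ⟨f, hf⟩ := h.exists_map_eq ((S.map F).pOpcycles ≫ φ')
    obtain ⟨g, rfl⟩ := hS f (h.eq_zero_of_map_eq_zero (by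
      rw [Functor.map_comp, hf]
      exact (S.map F).f_pOpcycles_assoc φ' |>.trans zero_comp))
    have h1 : φ' = (S.map F).fromOpcycles ≫ F.map g :=
      (cancel_epi (S.map F).pOpcycles).1 (hf.symm.trans
        ((F.map_comp _ _).trans ((S.map F).p_fromOpcycles_assoc (F.map g)).symm))
    rw [← Injective.comp_factorThru φ (S.map F).homologyι]
    exact (congrArg ((S.map F).homologyι ≫ ·) h1).trans
      (((S.map F).homologyι_comp_fromOpcycles_assoc (F.map g)).trans zero_comp)

variable [HasExt C] [HasExt D]

/-- Applying `exact_iff` to three consecutive terms of a projective resolution translates `Tor`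
vanishing into cocycles with values in `A` being coboundaries. -/
theorem isZero_leftDerived_iff [EnoughProjectives C] (N : C) (i : ℕ) :
    IsZero ((F.leftDerived (i + 1)).obj N) ↔ Subsingleton (Ext N A (i + 1)) := by
  let P := ProjectiveResolution.of N
  rw [(P.isoLeftDerivedObj F (i + 1)).isZero_iff]
  change IsZero (HomologicalComplex.homology _ _) ↔ _
  rw [← HomologicalComplex.exactAt_iff_isZero_homology,
    HomologicalComplex.exactAt_iff' _ (i + 2) (i + 1) i (by simp) (by simp)]
  refine (h.exact_iff (P.complex.sc' (i + 2) (i + 1) i)).trans ⟨fun h => ?_, fun h => ?_⟩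
  · refine subsingleton_of_forall_eq 0 fun e => ?_
    obtain ⟨f, hf, rfl⟩ := P.extMk_surjective e (i + 2) rfl
    exact (P.extMk_eq_zero_iff f _ rfl hf i rfl).2 (h f hf)
  · intro f hf
    exact (P.extMk_eq_zero_iff f (i + 2) rfl hf i rfl).1 (h.elim _ _)

/-- `F` preserves short exact sequences whose last term `N` satisfies `Ext^1(N, A) = 0`. -/
theorem map_shortExact {S : ShortComplex C} (hS : S.ShortExact)
    (h₃ : Subsingleton (Ext S.X₃ A 1)) : (S.map F).ShortExact := by
  have := adj.leftAdjoint_preservesColimits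
  have := hS.epi_g
  refine { exact := ?_, mono_f := ?_, epi_g := ?_ }
  · exact hS.exact.map_of_epi_of_preservesCokernel F inferInstance inferInstance
  · have h0 := (h.exact_iff (ShortComplex.mk (0 : S.X₁ ⟶ S.X₁) S.f zero_comp)).2
      fun f _ => hS.exists_desc_of_subsingleton_ext h₃ f
    exact (ShortComplex.exact_iff_mono _ (F.map_zero _ _)).1 h0
  · exact inferInstanceAs (Epi (F.map S.g))

/-- `G` preserves short exact sequences whose first term `X` satisfies `Ext^1(W, X) = 0`. -/
theorem map_right_shortExact {S : ShortComplex D} (hS : S.ShortExact)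
    (h₁ : Subsingleton (Ext W S.X₁ 1)) : (S.map G).ShortExact := by
  have := adj.rightAdjoint_preservesLimits
  have := hS.mono_f
  refine { exact := ?_, mono_f := ?_, epi_g := ?_ }
  · exact hS.exact.map_of_mono_of_preservesKernel G inferInstance inferInstance
  · exact inferInstanceAs (Mono (G.map S.f))
  · exact (h.epi_iff S.g).2 (hS.exists_lift_of_subsingleton_ext h₁)

end IsDualizing

/-- The Bass class of a dualizing adjunction. -/
structure IsBassObject [HasExt C] [HasExt D] (adj : F ⊣ G) (W : D) (A : C) (X : D) : Prop where
  perp : Perp W X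
  perp_right : Perp (G.obj X) A
  isIso_counit : IsIso (adj.counit.app X)

/-! ### Properties of the Bass class of a dualizing adjunction -/

namespace IsDualizing

variable {adj : F ⊣ G} {W : D} {A : C} (h : IsDualizing adj W A) [HasExt C] [HasExt D]

include h

theorem isBassObject_of_injective (I : D) [Injective I] : IsBassObject adj W A I :=
  have := h.projective I
  ⟨Perp.of_injective _ _, subsingleton_ext_of_projective A, h.isIso_counit I⟩

omit [HasExt C] [HasExt D] in
theorem isIso_counit_of_shortExact₁ {S : ShortComplex D} (hS : S.ShortExact)
    (hS' : (S.map (G ⋙ F)).ShortExact) [IsIso (adj.counit.app S.X₂)] [IsIso (adj.counit.app S.X₃)] :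
    IsIso (adj.counit.app S.X₁) := by
  let φ : S.map (G ⋙ F) ⟶ S :=
    { τ₁ := adj.counit.app S.X₁, τ₂ := adj.counit.app S.X₂, τ₃ := adj.counit.app S.X₃
      comm₁₂ := (adj.counit.naturality S.f).symm
      comm₂₃ := (adj.counit.naturality S.g).symm }
  have : IsIso φ.τ₂ := ‹IsIso (adj.counit.app S.X₂)›
  have : IsIso φ.τ₃ := ‹IsIso (adj.counit.app S.X₃)›
  exact ShortComplex.isIso₁_of_shortExact_of_isIso₂₃ φ hS' hS

omit [HasExt C] [HasExt D] in
theorem isIso_counit_of_shortExact₂ {S : ShortComplex D} (hS : S.ShortExact)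
    (hS' : (S.map (G ⋙ F)).ShortExact) [IsIso (adj.counit.app S.X₁)] [IsIso (adj.counit.app S.X₃)] :
    IsIso (adj.counit.app S.X₂) := by
  let φ : S.map (G ⋙ F) ⟶ S :=
    { τ₁ := adj.counit.app S.X₁, τ₂ := adj.counit.app S.X₂, τ₃ := adj.counit.app S.X₃
      comm₁₂ := (adj.counit.naturality S.f).symm
      comm₂₃ := (adj.counit.naturality S.g).symm }
  have : IsIso φ.τ₁ := ‹IsIso (adj.counit.app S.X₁)›
  have : IsIso φ.τ₃ := ‹IsIso (adj.counit.app S.X₃)›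
  exact ShortComplex.isIso₂_of_shortExact_of_isIso₁₃ φ hS' hS

theorem map_counit_shortExact {S : ShortComplex D} (hS : S.ShortExact) (h₁ : Perp W S.X₁)
    (h₃ : Perp (G.obj S.X₃) A) : (S.map (G ⋙ F)).ShortExact :=
  h.map_shortExact (h.map_right_shortExact hS (h₁ 0)) (h₃ 0)

theorem isBassObject_X₂ {S : ShortComplex D} (hS : S.ShortExact) (h₁ : IsBassObject adj W A S.X₁)
    (h₃ : IsBassObject adj W A S.X₃) : IsBassObject adj W A S.X₂ := by
  refine ⟨Perp.X₂ hS h₁.perp h₃.perp, fun i => ?_, ?_⟩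
  · exact (h.map_right_shortExact hS (h₁.perp 0)).subsingleton_ext_left_X₂
      (h₁.perp_right i) (h₃.perp_right i)
  · have := h₁.isIso_counit
    have := h₃.isIso_counit
    exact h.isIso_counit_of_shortExact₂ hS (h.map_counit_shortExact hS h₁.perp h₃.perp_right)

/-- Embedding `X` into an injective `I` with cokernel `Y` makes `G.obj X` a syzygy of `G.obj Y`, and
`Y` is again in `Perp W`. Iterating makes `G.obj X` an arbitrarily high syzygy, so its `Ext` into
`A` vanishes. -/
theorem perp_right_of_hasInjectiveDimensionLT [EnoughInjectives D] {d : ℕ}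
    (hd : HasInjectiveDimensionLT A d) {X : D} (hX : Perp W X) : Perp (G.obj X) A := by
  suffices key : ∀ (m : ℕ) (X : D), Perp W X → ∀ i, d ≤ i + 1 + m →
      Subsingleton (Ext (G.obj X) A (i + 1)) from fun i => key d X hX i (by lia)
  intro m
  induction m with
  | zero => exact fun X _ i hi => HasInjectiveDimensionLT.subsingleton A d (i + 1) hi _
  | succ m ih =>
    intro X hX i hi
    obtain ⟨I, Y, f, g, w, _, hS⟩ := exists_shortExact_injective X
    have hY : Perp W Y := Perp.X₃ hS hX (Perp.of_injective W I)
    have := h.projective I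
    exact (h.map_right_shortExact hS (hX 0)).subsingleton_ext_left_X₁
      (subsingleton_ext_of_projective (P := G.obj I) A i) (ih Y hY (i + 1) (by lia))

/-- If `A` has finite injective dimension, the Bass class is the class of all `X` with
`Ext^i(W, X) = 0` for `i ≥ 1`. -/
theorem isBassObject_of_perp [EnoughInjectives D] {d : ℕ} (hd : HasInjectiveDimensionLT A d) {X : D}
    (hX : Perp W X) : IsBassObject adj W A X := by
  refine ⟨hX, h.perp_right_of_hasInjectiveDimensionLT hd hX, ?_⟩
  -- Comparison with an injective module containing `X` shows that the counit is always monic. On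
  -- the cosyzygy `Y` it is also epic, since `Y` is a quotient of `I`; the short five lemma then
  -- handles `X`.
  have key : ∀ X : D, Perp W X → Mono (adj.counit.app X) := by
    intro X hX
    obtain ⟨I, Y, f, g, w, _, hS⟩ := exists_shortExact_injective X
    have hY : Perp W Y := Perp.X₃ hS hX (Perp.of_injective W I)
    have hS' := h.map_counit_shortExact hS hX (h.perp_right_of_hasInjectiveDimensionLT hd hY)
    have := h.isIso_counit I
    have h1 : Mono ((G ⋙ F).map f) := hS'.mono_f
    have h2 : Mono (adj.counit.app X ≫ f) := by
      have h3 : adj.counit.app X ≫ f = (G ⋙ F).map f ≫ adj.counit.app I :=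
        (adj.counit.naturality f).symm
      rw [h3]
      infer_instance
    exact mono_of_mono _ f
  obtain ⟨I, Y, f, g, w, _, hS⟩ := exists_shortExact_injective X
  have hY : Perp W Y := Perp.X₃ hS hX (Perp.of_injective W I)
  have hS' := h.map_counit_shortExact hS hX (h.perp_right_of_hasInjectiveDimensionLT hd hY)
  have := h.isIso_counit I
  have hg : Epi g := hS.epi_g
  have hY' : IsIso (adj.counit.app Y) := by
    have := key Y hY
    have h2 : Epi ((G ⋙ F).map g ≫ adj.counit.app Y) := by
      rw [adj.counit.naturality g]
      exact epi_comp (adj.counit.app I) g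
    have : Epi (adj.counit.app Y) := epi_of_epi ((G ⋙ F).map g) _
    exact isIso_of_mono_of_epi _
  exact h.isIso_counit_of_shortExact₁ hS hS'

/-- Every object of the Bass class is a quotient of an injective object by an object of the
Bass class. -/
theorem exists_shortExact_isBassObject [EnoughProjectives C] {X : D} (hX : IsBassObject adj W A X) :
    ∃ (K I : D) (f : K ⟶ I) (g : I ⟶ X) (w : f ≫ g = 0), (ShortComplex.mk f g w).ShortExact ∧
      Injective I ∧ IsBassObject adj W A K := by
  let c : F.obj (G.obj X) ⟶ X := adj.counit.app X
  have hc : IsIso c := hX.isIso_counit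
  -- Applying `F` to a projective presentation of `G.obj X` stays exact because `Ext^1(G.obj X, A) =
  -- 0`; it presents `F (G X) ≅ X` by an injective object.
  let p : Projective.over (G.obj X) ⟶ G.obj X := Projective.π (G.obj X)
  have hp : Epi p := Projective.π_epi (G.obj X)
  let S := ShortComplex.mk (kernel.ι p) p (kernel.condition p)
  have hS : S.ShortExact := { exact := ShortComplex.exact_kernel p }
  have hFS := h.map_shortExact hS (hX.perp_right 0)
  let T := ShortComplex.mk (F.map (kernel.ι p)) (F.map p ≫ c)
    (by rw [← Category.assoc, ← F.map_comp, kernel.condition, F.map_zero, zero_comp])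
  let e : S.map F ≅ T := ShortComplex.isoMk (Iso.refl _) (Iso.refl _) (@asIso _ _ _ _ c hc)
    ((Category.id_comp _).trans (Category.comp_id _).symm) (Category.id_comp _)
  have hT : T.ShortExact := ShortComplex.shortExact_of_iso e hFS
  have hI : Injective T.X₂ := h.injective (Projective.over (G.obj X))
  have hη := h.isIso_unit (Projective.over (G.obj X))
  have hcomp : adj.unit.app (Projective.over (G.obj X)) ≫ G.map (F.map p ≫ c) = p := by
    rw [G.map_comp]
    refine (adj.unit_naturality_assoc p _).trans ?_
    exact (congrArg (p ≫ ·) (adj.right_triangle_components X)).trans (Category.comp_id p)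
  -- Through the unit, `p` factors over `G.map T.g`. This surjectivity is what gives `Ext^1(W, T.X₁)
  -- = 0`.
  have hepi : Epi (G.map T.g) := by
    have : Epi (adj.unit.app (Projective.over (G.obj X)) ≫ G.map T.g) := by
      change Epi (adj.unit.app (Projective.over (G.obj X)) ≫ G.map (F.map p ≫ c))
      rw [hcomp]
      infer_instance
    exact epi_of_epi (adj.unit.app (Projective.over (G.obj X))) _
  have hperp : Perp W T.X₁ := by
    intro i
    cases i with
    | zero =>
      exact hT.subsingleton_ext_one_of_exists_lift (subsingleton_ext_of_injective W 0)
        ((h.epi_iff T.g).1 hepi)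
    | succ i => exact hT.subsingleton_ext_X₁ (hX.perp i) (subsingleton_ext_of_injective W (i + 1))
  have hGT := h.map_right_shortExact hT (hperp 0)
  let φ : S ⟶ T.map G :=
    { τ₁ := adj.unit.app _, τ₂ := adj.unit.app _, τ₃ := 𝟙 _
      comm₁₂ := (adj.unit.naturality (kernel.ι p)).symm
      comm₂₃ := hcomp.trans (Category.comp_id p).symm }
  have : IsIso φ.τ₂ := hη
  have : IsIso φ.τ₃ := inferInstanceAs (IsIso (𝟙 _))
  -- Hence `G.obj T.X₁` is the syzygy of `G.obj X`, from which it inherits the vanishing of `Ext`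
  -- into `A`.
  have hK : IsIso (adj.unit.app (kernel p)) :=
    ShortComplex.isIso₁_of_shortExact_of_isIso₂₃ φ hS hGT
  refine ⟨T.X₁, T.X₂, T.f, T.g, T.zero, hT, hI, hperp, fun i => ?_, ?_⟩
  · refine Retract.subsingleton_ext_left (Y := kernel p)
      (asIso (adj.unit.app (kernel p))).symm.retract ?_
    exact hS.subsingleton_ext_left_X₁ (subsingleton_ext_of_projective A i) (hX.perp_right (i + 1))
  · exact IsIso.of_isIso_fac_left (h := 𝟙 _) (adj.left_triangle_components (kernel p))

/-- A map `I ⟶ Y` lifts along `J ⟶ Y` after applying `G`, as `G.obj I` is projective; applying `F`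
and the counits brings the lift back. So vanishing for `W` forces vanishing for every injective
object. -/
theorem subsingleton_ext_of_injective_of_perp [EnoughInjectives D] (I : D) [Injective I] {X : D}
    (hX : Perp W X) (i : ℕ) : Subsingleton (Ext I X (i + 1)) := by
  induction i generalizing X with
  | zero =>
    obtain ⟨J, Y, f, g, w, _, hS⟩ := exists_shortExact_injective X
    refine hS.subsingleton_ext_one_of_exists_lift (subsingleton_ext_of_injective I 0) fun k => ?_
    have := h.projective I
    have := h.isIso_counit I
    have : Epi (G.map g) := (h.map_right_shortExact hS (hX 0)).epi_g
    refine ⟨inv (adj.counit.app I) ≫ F.map (Projective.factorThru (G.map k) (G.map g)) ≫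
      adj.counit.app J, ?_⟩
    have h1 := adj.counit.naturality g
    have h2 := adj.counit.naturality k
    simp only [Functor.comp_map, Functor.id_map] at h1 h2
    rw [Category.assoc, Category.assoc, ← h1, ← F.map_comp_assoc, Projective.factorThru_comp, h2,
      IsIso.inv_hom_id_assoc]
  | succ i ih =>
    obtain ⟨J, Y, f, g, w, _, hS⟩ := exists_shortExact_injective X
    exact hS.subsingleton_ext_X₁ (ih (Perp.X₃ hS hX (Perp.of_injective W J)))
      (subsingleton_ext_of_injective I (i + 1))

theorem subsingleton_ext_of_hasInjectiveDimensionLT_of_perp [EnoughInjectives D] {d : ℕ} {V : D}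
    (hV : HasInjectiveDimensionLT V d) {X : D} (hX : Perp W X) (i : ℕ) :
    Subsingleton (Ext V X (i + 1)) := by
  induction d generalizing V i with
  | zero =>
    have := (isZero_of_hasInjectiveDimensionLT_zero V).hasProjectiveDimensionLT_zero
    exact HasProjectiveDimensionLT.subsingleton V 0 _ (Nat.zero_le _) X
  | succ d ih =>
    cases d with
    | zero =>
      have : Injective V := injective_iff_hasInjectiveDimensionLT_one.2 hV
      exact h.subsingleton_ext_of_injective_of_perp V hX i
    | succ d =>
      obtain ⟨J, Y, f, g, w, _, hS⟩ := exists_shortExact_injective V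
      exact hS.subsingleton_ext_left_X₁ (h.subsingleton_ext_of_injective_of_perp J hX i)
        (ih ((hS.hasInjectiveDimensionLT_X₃_iff d ‹_›).2 hV) (i + 1))

end IsDualizing

end CategoryTheory

/-! ### Approximations by modules of finite injective dimension -/

namespace CategoryTheory.ShortComplex.ShortExact

variable {B : Type u} [Ring B] {S : ShortComplex (ModuleCat.{u} B)} (hS : S.ShortExact)

include hS

theorem exists_apply_eq {y : S.X₂} (hy : S.g y = 0) : ∃ x, S.f x = y :=
  (ShortComplex.moduleCat_exact_iff S).1 hS.exact y hy

theorem exists_hom_apply_eq {K : ModuleCat.{u} B} (k : K ⟶ S.X₂) (hk : ∀ x, S.g (k x) = 0) :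
    ∃ l : K ⟶ S.X₁, ∀ x, S.f (l x) = k x := by
  have := hS.mono_f
  refine ⟨hS.exact.lift k (ModuleCat.hom_ext (LinearMap.ext hk)), fun x => ?_⟩
  rw [← ModuleCat.comp_apply, hS.exact.lift_f]

end CategoryTheory.ShortComplex.ShortExact

namespace CategoryTheory

open Abelian

theorem injective_prod {B : Type u} [Ring B] (I J : ModuleCat.{u} B) [Injective I] [Injective J] :
    Injective (ModuleCat.of B (I × J)) :=
  Injective.of_iso (ModuleCat.biprodIsoProd I J) inferInstance

variable {B : Type u} [Ring B] {C : Type*} [Category* C] [Abelian C]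
  {F : C ⥤ ModuleCat.{u} B} {G : ModuleCat.{u} B ⥤ C} [F.Additive] [G.Additive] [HasExt C]

/-- `M` is a quotient of a module of injective dimension at most `m` by a module in the
Bass class. -/
def HasBassCover (adj : F ⊣ G) (W : ModuleCat.{u} B) (A : C) (m : ℕ) (M : ModuleCat.{u} B) : Prop :=
  ∃ (X V : ModuleCat.{u} B) (f : X ⟶ V) (g : V ⟶ M) (w : f ≫ g = 0),
    (ShortComplex.mk f g w).ShortExact ∧ IsBassObject adj W A X ∧ HasInjectiveDimensionLT V (m + 1)

namespace IsDualizing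

variable {adj : F ⊣ G} {W : ModuleCat.{u} B} {A : C} (h : IsDualizing adj W A)

include h

theorem hasBassCover_zero [EnoughProjectives C] {X : ModuleCat.{u} B}
    (hX : IsBassObject adj W A X) : HasBassCover adj W A 0 X := by
  obtain ⟨K, I, f, g, w, hS, _, hK⟩ := h.exists_shortExact_isBassObject hX
  exact ⟨K, I, f, g, w, hS, hK, inferInstance⟩

/-- Take covers `V` of `S.X₂` and `V'` of `S.X₃`, and lift `V → S.X₃` to `t : V → V'`, which is
possible because `Ext^1(V, X') = 0`. The kernel of a surjection onto `V'` built from `t` covers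
`S.X₁`. -/
theorem hasBassCover_kernel [EnoughProjectives C] {S : ShortComplex (ModuleCat.{u} B)}
    (hS : S.ShortExact) (h₂ : IsBassObject adj W A S.X₂) {m : ℕ}
    (h₃ : HasBassCover adj W A m S.X₃) : HasBassCover adj W A (m + 1) S.X₁ := by
  obtain ⟨X, V, a, b, w, hV, _, hX⟩ := h.exists_shortExact_isBassObject h₂
  obtain ⟨X', V', a', b', w', hV', hX', hd⟩ := h₃
  obtain ⟨X'', E, k, p, w'', hE, _, hX''⟩ := h.exists_shortExact_isBassObject hX'
  obtain ⟨t, ht⟩ := hV'.exists_lift_of_subsingleton_ext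
    (h.subsingleton_ext_of_injective_of_perp V hX'.perp 0) (b ≫ S.g)
  have ht' : ∀ v, b' (t v) = S.g (b v) := fun v => congrArg (fun q => q.hom v) ht
  have hw : ∀ x, b (a x) = 0 := fun x => congrArg (fun q => q.hom x) w
  have hw' : ∀ x, b' (a' x) = 0 := fun x => congrArg (fun q => q.hom x) w'
  have hw'' : ∀ x, p (k x) = 0 := fun x => congrArg (fun q => q.hom x) w''
  have hSw : ∀ x, S.g (S.f x) = 0 := fun x => congrArg (fun q => q.hom x) S.zero
  have ha' : Function.Injective a' := hV'.injective_f
  have hp : Function.Surjective p := hE.surjective_g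
  -- The lift `t` is onto only modulo `X'`. The injective module `E`, mapping onto `X'` with Bass
  -- kernel `X''`, repairs this.
  let φ : (V × E) →ₗ[B] V' := LinearMap.coprod t.hom (a'.hom ∘ₗ p.hom)
  have hφ : ∀ x : V × E, φ x = t x.1 + a' (p x.2) := fun x => rfl
  have key : ∀ v, b' (t v) = 0 → ∃ e, t v + a' (p e) = 0 := by
    intro v hv
    obtain ⟨x, hx⟩ := hV'.exists_apply_eq hv
    obtain ⟨e, rfl⟩ := hp x
    refine ⟨-e, ?_⟩
    rw [map_neg, map_neg, ← hx]
    exact add_neg_cancel _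
  have hφs : Function.Surjective φ := by
    intro y
    obtain ⟨y', hy'⟩ := hS.surjective_g (b' y)
    obtain ⟨v, rfl⟩ := hV.surjective_g y'
    obtain ⟨x, hx⟩ := hV'.exists_apply_eq (y := y - t v)
      ((map_sub b'.hom _ _).trans (sub_eq_zero.2 (hy'.symm.trans (ht' v).symm)))
    obtain ⟨e, rfl⟩ := hp x
    refine ⟨(v, e), ?_⟩
    rw [hφ]
    exact (congrArg (t v + ·) hx).trans (add_sub_cancel _ _)
  let K := ModuleCat.of B (LinearMap.ker φ)
  have hK : ∀ x : K, t x.1.1 + a' (p x.1.2) = 0 := fun x => x.2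
  have hKb : ∀ x : K, b' (t x.1.1) = 0 := fun x => by
    rw [eq_neg_of_add_eq_zero_left (hK x), map_neg, hw', neg_zero]
  obtain ⟨ψ, hψ⟩ := hS.exists_hom_apply_eq (K := K)
    (ModuleCat.ofHom (b.hom ∘ₗ LinearMap.fst B V E ∘ₗ (LinearMap.ker φ).subtype))
    (fun x => (ht' _).symm.trans (hKb x))
  replace hψ : ∀ x : K, S.f (ψ x) = b x.1.1 := hψ
  have hψs : Function.Surjective ψ.hom := by
    intro z
    obtain ⟨v, hv⟩ := hV.surjective_g (S.f z)
    obtain ⟨e, he⟩ := key v ((ht' v).trans ((congrArg S.g hv).trans (hSw z)))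
    refine ⟨⟨(v, e), he⟩, hS.injective_f ?_⟩
    exact (hψ _).trans hv
  refine ⟨_, K, _, ψ, _, LinearMap.shortExact_shortComplexKer hψs, ?_, ?_⟩
  -- `L` consists of pairs `(v, e)` with `v` in `X` and `e` correcting `t v`, so it is an extension
  -- of `X` by `X''`.
  · let L := ModuleCat.of B (LinearMap.ker ψ.hom)
    have hL : ∀ x : L, b x.1.1.1 = 0 := fun x =>
      (hψ x.1).symm.trans ((congrArg S.f x.2).trans (map_zero _))
    obtain ⟨r, hr⟩ := hV.exists_hom_apply_eq (K := L)
      (ModuleCat.ofHom (LinearMap.fst B V E ∘ₗ (LinearMap.ker φ).subtype ∘ₗ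
        (LinearMap.ker ψ.hom).subtype)) hL
    replace hr : ∀ x : L, a (r x) = x.1.1.1 := hr
    let s : X'' ⟶ L := ModuleCat.ofHom
      (LinearMap.codRestrict _ (LinearMap.codRestrict _ (LinearMap.inr B V E ∘ₗ k.hom)
        (fun x => (hφ _).trans (by
          change t 0 + a' (p (k x)) = 0
          rw [hw'', map_zero, map_zero, add_zero])))
        (fun x => hS.injective_f ((hψ _).trans ((map_zero b.hom).trans (map_zero S.f.hom).symm))))
    have ha : Function.Injective a := hV.injective_f
    have hk : Function.Injective k := hE.injective_f
    refine h.isBassObject_X₂ (ModuleCat.shortExact_mk s r ?_ ?_ ?_ ?_) hX'' hX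
    · refine ModuleCat.hom_ext (LinearMap.ext fun x => ha ?_)
      exact (hr (s x)).trans (map_zero a.hom).symm
    · intro x y hxy
      exact hk (congrArg (fun z : L => z.1.1.2) hxy)
    · intro x
      obtain ⟨e, he⟩ := key (a x) ((ht' _).trans ((congrArg S.g (hw x)).trans (map_zero S.g.hom)))
      refine ⟨⟨⟨(a x, e), he⟩, hS.injective_f ?_⟩, ha (hr _)⟩
      exact (hψ _).trans ((hw x).trans (map_zero S.f.hom).symm)
    · intro y hy
      have hv : y.1.1.1 = 0 := (hr y).symm.trans ((congrArg a hy).trans (map_zero a.hom))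
      have he : a' (p y.1.1.2) = 0 := by
        have := hK y.1
        rw [hv, map_zero, zero_add] at this
        exact this
      obtain ⟨x, hx⟩ := hE.exists_apply_eq (ha' (he.trans (map_zero a'.hom).symm))
      refine ⟨x, Subtype.ext (Subtype.ext (Prod.ext hv.symm hx))⟩
  · exact (LinearMap.shortExact_shortComplexKer hφs).hasInjectiveDimensionLT_X₁ (m + 1) hd
      (have := injective_prod V E; inferInstanceAs
        (HasInjectiveDimensionLT (ModuleCat.of B (V × E)) (m + 2)))

/-- Let the injective module `V` cover `S.X₂` with Bass kernel `X`. The kernel of `V → S.X₂ → S.X₃`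
maps onto `S.X₁` with the same kernel `X`, and its injective dimension exceeds that of `S.X₃` by at
most one. -/
theorem hasBassCover_X₁_of_hasInjectiveDimensionLT [EnoughProjectives C]
    {S : ShortComplex (ModuleCat.{u} B)} (hS : S.ShortExact) (h₂ : IsBassObject adj W A S.X₂) {m : ℕ}
    (h₃ : HasInjectiveDimensionLT S.X₃ m) : HasBassCover adj W A m S.X₁ := by
  obtain ⟨X, V, a, b, w, hV, _, hX⟩ := h.exists_shortExact_isBassObject h₂
  have hw : ∀ x, b (a x) = 0 := fun x => congrArg (fun q => q.hom x) w
  have hSw : ∀ x, S.g (S.f x) = 0 := fun x => congrArg (fun q => q.hom x) S.zero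
  let φ : V →ₗ[B] S.X₃ := S.g.hom ∘ₗ b.hom
  have hφ : Function.Surjective φ := hS.surjective_g.comp hV.surjective_g
  let K := ModuleCat.of B (LinearMap.ker φ)
  obtain ⟨ψ, hψ⟩ := hS.exists_hom_apply_eq (K := K)
    (ModuleCat.ofHom (b.hom ∘ₗ (LinearMap.ker φ).subtype)) (fun x => x.2)
  replace hψ : ∀ x : K, S.f (ψ x) = b x.1 := hψ
  let s : X ⟶ K := ModuleCat.ofHom (LinearMap.codRestrict _ a.hom
    (fun x => (congrArg S.g (hw x)).trans (map_zero S.g.hom)))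
  have hs : ∀ x, (s x).1 = a x := fun _ => rfl
  have hsψ : s ≫ ψ = 0 := by
    refine ModuleCat.hom_ext (LinearMap.ext fun x => hS.injective_f ?_)
    exact (hψ (s x)).trans ((hw x).trans (map_zero S.f.hom).symm)
  refine ⟨X, K, s, ψ, hsψ, ModuleCat.shortExact_mk s ψ hsψ ?_ ?_ ?_, hX, ?_⟩
  · exact fun x y hxy => hV.injective_f (congrArg (fun z : K => z.1) hxy)
  · intro z
    obtain ⟨v, hv⟩ := hV.surjective_g (S.f z)
    exact ⟨⟨v, (congrArg S.g hv).trans (hSw z)⟩, hS.injective_f ((hψ _).trans hv)⟩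
  · intro y hy
    obtain ⟨x, hx⟩ := hV.exists_apply_eq (y := y.1)
      ((hψ y).symm.trans ((congrArg S.f hy).trans (map_zero S.f.hom)))
    exact ⟨x, Subtype.ext hx⟩
  · exact (LinearMap.shortExact_shortComplexKer hφ).hasInjectiveDimensionLT_X₁ m h₃
      (inferInstanceAs (HasInjectiveDimensionLT V (m + 1)))

/-- Each cosyzygy lowers by one the range of nonvanishing `Ext`, until an object of `Perp W`, hence
of the Bass class, is reached; `hasBassCover_kernel` climbs back. -/
theorem hasBassCover_of_subsingleton_ext [EnoughProjectives C] {d : ℕ}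
    (hd : HasInjectiveDimensionLT A d) {m : ℕ} {M : ModuleCat.{u} B}
    (hM : ∀ i, m ≤ i → Subsingleton (Ext W M (i + 1))) : HasBassCover adj W A m M := by
  induction m generalizing M with
  | zero => exact h.hasBassCover_zero (h.isBassObject_of_perp hd fun i => hM i (Nat.zero_le i))
  | succ m ih =>
    obtain ⟨I, Y, f, g, w, _, hS⟩ := exists_shortExact_injective M
    refine h.hasBassCover_kernel hS (h.isBassObject_of_injective I) (ih fun i hi => ?_)
    exact hS.subsingleton_ext_X₃ (subsingleton_ext_of_injective W i) (hM (i + 1) (by lia))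

/-- The pullback of `I → Y` and the cover `V' → Y` is an extension of `V'` by `M` and, read the
other way, an extension of `I` by the Bass module `X'`. -/
theorem exists_shortExact_of_hasBassCover {M I Y : ModuleCat.{u} B} [Injective I] {f : M ⟶ I}
    {g : I ⟶ Y} {w : f ≫ g = 0} (hS : (ShortComplex.mk f g w).ShortExact) {m : ℕ}
    (hY : HasBassCover adj W A m Y) :
    ∃ (X V : ModuleCat.{u} B) (f : M ⟶ X) (g : X ⟶ V) (w : f ≫ g = 0),
      (ShortComplex.mk f g w).ShortExact ∧ IsBassObject adj W A X ∧
        HasInjectiveDimensionLT V (m + 1) := by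
  obtain ⟨X', V', a', b', w', hV', hX', hd⟩ := hY
  have hw : ∀ x, g (f x) = 0 := fun x => congrArg (fun q => q.hom x) w
  have hw' : ∀ x, b' (a' x) = 0 := fun x => congrArg (fun q => q.hom x) w'
  let N := LinearMap.eqLocus (g.hom ∘ₗ LinearMap.fst B I V') (b'.hom ∘ₗ LinearMap.snd B I V')
  have hN : ∀ x : N, g x.1.1 = b' x.1.2 := fun x => x.2
  let X := ModuleCat.of B N
  let i : M ⟶ X := ModuleCat.ofHom (LinearMap.codRestrict N (LinearMap.inl B I V' ∘ₗ f.hom)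
    (fun x => (hw x).trans (map_zero b'.hom).symm))
  let q : X ⟶ V' := ModuleCat.ofHom (LinearMap.snd B I V' ∘ₗ N.subtype)
  let j : X' ⟶ X := ModuleCat.ofHom (LinearMap.codRestrict N (LinearMap.inr B I V' ∘ₗ a'.hom)
    (fun x => (map_zero g.hom).trans (hw' x).symm))
  let r : X ⟶ I := ModuleCat.ofHom (LinearMap.fst B I V' ∘ₗ N.subtype)
  refine ⟨X, V', i, q, rfl, ModuleCat.shortExact_mk i q rfl ?_ ?_ ?_,
    h.isBassObject_X₂ (ModuleCat.shortExact_mk j r rfl ?_ ?_ ?_) hX' (h.isBassObject_of_injective I),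
    hd⟩
  · exact fun x y hxy => hS.injective_f (congrArg (fun z : X => z.1.1) hxy)
  · intro v
    obtain ⟨x, hx⟩ := hS.surjective_g (b' v)
    exact ⟨⟨(x, v), hx⟩, rfl⟩
  · intro y (hy : y.1.2 = 0)
    obtain ⟨x, hx⟩ := hS.exists_apply_eq (y := y.1.1)
      ((hN y).trans ((congrArg b' hy).trans (map_zero b'.hom)))
    exact ⟨x, Subtype.ext (Prod.ext hx hy.symm)⟩
  · exact fun x y hxy => hV'.injective_f (congrArg (fun z : X => z.1.2) hxy)
  · intro y
    obtain ⟨v, hv⟩ := hV'.surjective_g (g y)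
    exact ⟨⟨(y, v), hv.symm⟩, rfl⟩
  · intro y (hy : y.1.1 = 0)
    obtain ⟨x, hx⟩ := hV'.exists_apply_eq (y := y.1.2)
      ((hN y).symm.trans ((congrArg g hy).trans (map_zero g.hom)))
    exact ⟨x, Subtype.ext (Prod.ext hy.symm hx)⟩

end IsDualizing

/-! ### Covers without a uniform bound, closed under extensions -/

/-- `M` is a quotient of a module of finite injective dimension by a module `X` with
`Ext^i(W, X) = 0` for `i ≥ 1`. -/
def HasPerpCover (W M : ModuleCat.{u} B) : Prop :=
  ∃ (X V : ModuleCat.{u} B) (f : X ⟶ V) (g : V ⟶ M) (w : f ≫ g = 0),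
    (ShortComplex.mk f g w).ShortExact ∧ Perp W X ∧ ∃ d, HasInjectiveDimensionLT V d

theorem HasBassCover.hasPerpCover {adj : F ⊣ G} {W : ModuleCat.{u} B} {A : C} {m : ℕ}
    {M : ModuleCat.{u} B} (hM : HasBassCover adj W A m M) : HasPerpCover W M := by
  obtain ⟨X, V, f, g, w, hS, hX, hV⟩ := hM
  exact ⟨X, V, f, g, w, hS, hX.perp, _, hV⟩

theorem HasBassCover.subsingleton_ext {adj : F ⊣ G} {W : ModuleCat.{u} B} {A : C} {m : ℕ}
    {M : ModuleCat.{u} B} (hM : HasBassCover adj W A m M) : Subsingleton (Ext W M (m + 1)) := by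
  obtain ⟨X, V, f, g, w, hS, hX, hV⟩ := hM
  exact hS.subsingleton_ext_X₃ (HasInjectiveDimensionLT.subsingleton V (m + 1) (m + 1) le_rfl W)
    (hX.perp (m + 1))

theorem HasPerpCover.of_isZero (W : ModuleCat.{u} B) {M : ModuleCat.{u} B} (hM : IsZero M) :
    HasPerpCover W M :=
  have := hM.hasInjectiveDimensionLT_zero
  have : Injective M := injective_iff_hasInjectiveDimensionLT_one.2
    (hasInjectiveDimensionLT_of_ge M 0 1 (Nat.zero_le 1))
  ⟨M, M, 0, 𝟙 M, zero_comp, ModuleCat.shortExact_mk _ _ _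
    (fun _ _ _ => (ModuleCat.subsingleton_of_isZero hM).elim _ _) (fun x => ⟨x, rfl⟩)
    (fun _ _ => ⟨0, (ModuleCat.subsingleton_of_isZero hM).elim _ _⟩),
    Perp.of_injective W M, 0, hM.hasInjectiveDimensionLT_zero⟩

namespace IsDualizing

variable {adj : F ⊣ G} {W : ModuleCat.{u} B} {A : C} (h : IsDualizing adj W A)

include h

/-- A horseshoe argument: the pullback `P` of `S.X₂` and `V''` over `S.X₃` is an extension of `V''`
by `S.X₁`, to be lifted to an extension by `V'`. The obstruction lies in `Ext^2(V'', X')`, which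
vanishes as `V''` has finite injective dimension. -/
theorem hasPerpCover_X₂ {S : ShortComplex (ModuleCat.{u} B)} (hS : S.ShortExact)
    (h₁ : HasPerpCover W S.X₁) (h₃ : HasPerpCover W S.X₃) : HasPerpCover W S.X₂ := by
  obtain ⟨X', V', a', b', w', hV', hX', d', hd'⟩ := h₁
  obtain ⟨X'', V'', a'', b'', w'', hV'', hX'', d'', hd''⟩ := h₃
  have hw' : ∀ x, b' (a' x) = 0 := fun x => congrArg (fun q => q.hom x) w'
  have hw'' : ∀ x, b'' (a'' x) = 0 := fun x => congrArg (fun q => q.hom x) w''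
  have hSw : ∀ x, S.g (S.f x) = 0 := fun x => congrArg (fun q => q.hom x) S.zero
  have ha' : Function.Injective a' := hV'.injective_f
  have ha'' : Function.Injective a'' := hV''.injective_f
  have hb' : Function.Surjective b' := hV'.surjective_g
  have hb'' : Function.Surjective b'' := hV''.surjective_g
  have hSf : Function.Injective S.f := hS.injective_f
  have hSg : Function.Surjective S.g := hS.surjective_g
  let j : V' ⟶ Injective.under V' := Injective.ι V'
  have hj : Function.Injective j := (ModuleCat.mono_iff_injective _).1 inferInstance
  let J := Injective.under V'
  let N : Submodule B J := LinearMap.range (j.hom ∘ₗ a'.hom)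
  -- With `Q = J/X'` and `J` injective, the obstruction becomes one in `Ext^1(V'', Q)`: it is killed
  -- by extending `S.X₁ = V'/X' → Q` to `H : P → Q`.
  let Q := ModuleCat.of B (J ⧸ N)
  let π : J ⟶ Q := ModuleCat.ofHom N.mkQ
  have hπ : Function.Surjective π := N.mkQ_surjective
  have hπ0 : ∀ y, π y = 0 → ∃ x, j (a' x) = y := fun y hy =>
    (Submodule.Quotient.mk_eq_zero N).1 hy
  have hπj : ∀ x, π (j (a' x)) = 0 := fun x => (Submodule.Quotient.mk_eq_zero N).2 ⟨x, rfl⟩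
  have hQ : Perp W Q := by
    refine Perp.X₃ (ModuleCat.shortExact_mk (a' ≫ j) π (ModuleCat.hom_ext (LinearMap.ext hπj))
      (hj.comp ha') hπ hπ0) hX' (Perp.of_injective W J)
  have := hV'.epi_g
  let k : S.X₁ ⟶ Q := hV'.exact.desc (j ≫ π) (ModuleCat.hom_ext (LinearMap.ext hπj))
  have hk : ∀ v, k (b' v) = π (j v) := fun v =>
    congrArg (fun q => q.hom v) (hV'.exact.g_desc (j ≫ π) (ModuleCat.hom_ext (LinearMap.ext hπj)))
  let P := LinearMap.eqLocus (S.g.hom ∘ₗ LinearMap.fst B S.X₂ V'')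
    (b''.hom ∘ₗ LinearMap.snd B S.X₂ V'')
  have hP : ∀ x : P, S.g x.1.1 = b'' x.1.2 := fun x => x.2
  let i : S.X₁ ⟶ ModuleCat.of B P := ModuleCat.ofHom
    (LinearMap.codRestrict P (LinearMap.inl B S.X₂ V'' ∘ₗ S.f.hom)
      (fun x => (hSw x).trans (map_zero b''.hom).symm))
  let q : ModuleCat.of B P ⟶ V'' := ModuleCat.ofHom (LinearMap.snd B S.X₂ V'' ∘ₗ P.subtype)
  have hiq : (ShortComplex.mk i q rfl).ShortExact := by
    refine ModuleCat.shortExact_mk i q rfl ?_ ?_ ?_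
    · exact fun x y hxy => hSf (congrArg (fun z : P => z.1.1) hxy)
    · intro v
      obtain ⟨x, hx⟩ := hSg (b'' v)
      exact ⟨⟨(x, v), hx⟩, rfl⟩
    · intro y (hy : y.1.2 = 0)
      obtain ⟨x, hx⟩ := hS.exists_apply_eq (y := y.1.1)
        ((hP y).trans ((congrArg b'' hy).trans (map_zero b''.hom)))
      exact ⟨x, Subtype.ext (Prod.ext hx hy.symm)⟩
  obtain ⟨H, hH⟩ := hiq.exists_desc_of_subsingleton_ext
    (h.subsingleton_ext_of_hasInjectiveDimensionLT_of_perp hd'' hQ 0) k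
  replace hH : ∀ x, H (i x) = k x := fun x => congrArg (fun q => q.hom x) hH
  -- The pullback of `P` and `J` over `Q` is the lifted extension of `V''` by `V'`. The kernel of
  -- its map onto `S.X₂` is an extension of `X''` by `X'`.
  let T := LinearMap.eqLocus (H.hom ∘ₗ LinearMap.fst B P J) (π.hom ∘ₗ LinearMap.snd B P J)
  have hT : ∀ x : T, H x.1.1 = π x.1.2 := fun x => x.2
  let V := ModuleCat.of B T
  let s : V' ⟶ V := ModuleCat.ofHom (LinearMap.codRestrict T
    (LinearMap.prod (i.hom ∘ₗ b'.hom) j.hom) (fun x => (hH _).trans (hk x)))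
  let r : V ⟶ V'' := ModuleCat.ofHom (q.hom ∘ₗ LinearMap.fst B P J ∘ₗ T.subtype)
  have key : ∀ y : V, y.1.1.1.2 = 0 → ∃ x, s x = y := by
    intro y hy
    obtain ⟨x, hx⟩ := hiq.exists_apply_eq (y := y.1.1) hy
    obtain ⟨v, rfl⟩ := hb' x
    have h1 : π (y.1.2 - j v) = 0 := by
      rw [map_sub, ← hT y, ← hk, ← hH]
      exact sub_eq_zero.2 (congrArg H hx.symm)
    obtain ⟨z, hz⟩ := hπ0 _ h1
    refine ⟨v + a' z, Subtype.ext (Prod.ext ?_ ?_)⟩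
    · change i (b' (v + a' z)) = y.1.1
      rw [map_add, hw', add_zero]
      exact hx
    · change j (v + a' z) = y.1.2
      rw [map_add, hz]
      exact add_sub_cancel _ _
  have hsr : s ≫ r = 0 := rfl
  have hrs : ∀ p : P, ∃ y : V, y.1.1 = p := fun p => by
    obtain ⟨t, ht⟩ := hπ (H p)
    exact ⟨⟨(p, t), ht.symm⟩, rfl⟩
  have hV : (ShortComplex.mk s r hsr).ShortExact := by
    refine ModuleCat.shortExact_mk s r hsr ?_ ?_ key
    · exact fun x y hxy => hj (congrArg (fun z : V => z.1.2) hxy)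
    · intro v
      obtain ⟨p, hp⟩ := hiq.surjective_g v
      obtain ⟨y, rfl⟩ := hrs p
      exact ⟨y, hp⟩
  let ψ : V ⟶ S.X₂ := ModuleCat.ofHom
    (LinearMap.fst B S.X₂ V'' ∘ₗ P.subtype ∘ₗ LinearMap.fst B P J ∘ₗ T.subtype)
  have hψ : Function.Surjective ψ.hom := by
    intro m
    obtain ⟨v, hv⟩ := hb'' (S.g m)
    obtain ⟨y, hy⟩ := hrs ⟨(m, v), hv.symm⟩
    exact ⟨y, congrArg (fun z : P => z.1.1) hy⟩
  refine ⟨_, V, _, ψ, _, LinearMap.shortExact_shortComplexKer hψ, ?_, max d' d'',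
    hV.hasInjectiveDimensionLT_X₂ _ (hasInjectiveDimensionLT_of_ge _ d' _ (le_max_left _ _))
      (hasInjectiveDimensionLT_of_ge _ d'' _ (le_max_right _ _))⟩
  let L := ModuleCat.of B (LinearMap.ker ψ.hom)
  have hL : ∀ x : L, x.1.1.1.1.1 = 0 := fun x => x.2
  obtain ⟨l, hl⟩ := hV''.exists_hom_apply_eq (K := L)
    (r.hom ∘ₗ (LinearMap.ker ψ.hom).subtype |> ModuleCat.ofHom)
    (fun x => (hP x.1.1.1).symm.trans ((congrArg S.g (hL x)).trans (map_zero S.g.hom)))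
  replace hl : ∀ x : L, a'' (l x) = x.1.1.1.1.2 := hl
  let c : X' ⟶ L := ModuleCat.ofHom (LinearMap.codRestrict _ (s.hom ∘ₗ a'.hom)
    (fun x => (congrArg S.f (hw' x)).trans (map_zero S.f.hom)))
  have hcl : c ≫ l = 0 := ModuleCat.hom_ext (LinearMap.ext fun x =>
    ha'' ((hl _).trans (map_zero a''.hom).symm))
  refine Perp.X₂ (ModuleCat.shortExact_mk c l hcl ?_ ?_ ?_) hX' hX''
  · exact fun x y hxy => ha' (hj (congrArg (fun z : L => z.1.1.2) hxy))
  · intro x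
    obtain ⟨y, hy⟩ := hrs ⟨(0, a'' x), (map_zero S.g.hom).trans (hw'' x).symm⟩
    refine ⟨⟨y, congrArg (fun z : P => z.1.1) hy⟩, ha'' ((hl _).trans ?_)⟩
    exact congrArg (fun z : P => z.1.2) hy
  · intro y hy
    obtain ⟨v, hv⟩ := key y.1 ((hl y).symm.trans ((congrArg a'' hy).trans (map_zero a''.hom)))
    have h1 : b' v = 0 := hSf ((congrArg (fun z : V => z.1.1.1.1) hv).trans
      ((hL y).trans (map_zero S.f.hom).symm))
    obtain ⟨x, rfl⟩ := hV'.exists_apply_eq h1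
    exact ⟨x, Subtype.ext hv⟩

theorem hasPerpCover_of_isFiniteLength
    (hT : ∀ T : ModuleCat.{u} B, IsSimpleModule B T → HasPerpCover W T)
    (M : Type u) [AddCommGroup M] [Module B M] (hM : IsFiniteLength B M) :
    HasPerpCover W (ModuleCat.of B M) := by
  induction hM with
  | @of_subsingleton M _ _ _ => exact HasPerpCover.of_isZero W (ModuleCat.isZero_of_subsingleton _)
  | @of_simple_quotient M _ _ N hq _ ih =>
    have := hq
    refine h.hasPerpCover_X₂ (ModuleCat.shortExact_mk (ModuleCat.ofHom N.subtype)
      (ModuleCat.ofHom N.mkQ) (by ext x; simp) N.subtype_injective N.mkQ_surjective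
      fun y hy => ?_) ih (hT _ hq)
    exact ⟨⟨y, (Submodule.Quotient.mk_eq_zero N).1 hy⟩, rfl⟩

end IsDualizing

/-- The surjection onto the projective module splits, so `P` is a summand of a module of finite
injective dimension. -/
theorem HasPerpCover.hasInjectiveDimensionLT {W P : ModuleCat.{u} B} [Projective P]
    (hP : HasPerpCover W P) : ∃ d, HasInjectiveDimensionLT P d := by
  obtain ⟨X, V, f, g, w, hS, hX, d, hd⟩ := hP
  have : Epi g := hS.epi_g
  exact ⟨d, (Retract.mk (Projective.factorThru (𝟙 P) g) g
    (Projective.factorThru_comp _ _)).hasInjectiveDimensionLT d⟩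

theorem HasBassCover.hasInjectiveDimensionLT {adj : F ⊣ G} {W P : ModuleCat.{u} B} {A : C} {m : ℕ}
    [Projective P] (hP : HasBassCover adj W A m P) : HasInjectiveDimensionLT P (m + 1) := by
  obtain ⟨X, V, f, g, w, hS, hX, hd⟩ := hP
  have : Epi g := hS.epi_g
  exact (Retract.mk (Projective.factorThru (𝟙 P) g) g
    (Projective.factorThru_comp _ _)).hasInjectiveDimensionLT (m + 1)

end CategoryTheory

/-! ### The dualizing adjunction of an artin algebra -/

section ArtinAlgebra

open Abelian

variable (R Λ : Type u) [CommRing R] [IsArtinianRing R] [Ring Λ] [Algebra R Λ]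

/-- The map `ω ⊗ Λ → ω`. -/
noncomputable def tensorRegularMap :
    BalancedTensor Λ Λ (MatlisDual R Λ) Λ →ₗ[Λ] MatlisDual R Λ :=
  BalancedTensor.lift
    { toFun := fun x => AddMonoidHom.toIntLinearMap
        { toFun := fun s : Λ => MulOpposite.op s • x
          map_zero' := zero_smul _ x
          map_add' := fun s t => add_smul (MulOpposite.op s) (MulOpposite.op t) x }
      map_add' := fun x y => LinearMap.ext fun s => smul_add (MulOpposite.op s) x y
      map_smul' := fun r x => LinearMap.ext fun s => (smul_comm r (MulOpposite.op s) x).symm }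
    (fun x s t => (mul_smul (MulOpposite.op t) (MulOpposite.op s) x).symm)

instance : Projective (ModuleCat.of.{u} Λ Λ) := (IsProjective.iff_projective _).1 inferInstance

variable {Λ} in
theorem exists_hom_tensor_regular_apply_ne_zero {M : ModuleCat.{u} Λ} {z : M} (hz : z ≠ 0) :
    ∃ f : M ⟶ (tensorFunctor Λ Λ (MatlisDual R Λ)).obj (ModuleCat.of Λ Λ), f z ≠ 0 := by
  obtain ⟨φ, hφ⟩ := MatlisDual.exists_hom_apply_ne_zero (R := R) (Λ := Λ) hz
  refine ⟨ModuleCat.ofHom (tmulRight Λ Λ (MatlisDual R Λ) (1 : Λ) ∘ₗ φ), fun h => hφ ?_⟩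
  have h1 := (congrArg (tensorRegularMap R Λ) h).trans (map_zero (tensorRegularMap R Λ))
  exact (one_smul (Λᵐᵒᵖ) (φ z)).symm.trans h1

variable [Module.Finite R Λ]

theorem isDualizing_matlisDual :
    IsDualizing (tensorHomAdjunction Λ Λ (MatlisDual R Λ)) (ModuleCat.of Λ (MatlisDual R Λ))
      (ModuleCat.of Λ Λ) where
  isIso_unit P _ := isIso_unit_app_of_projective R P
  isIso_counit I _ := isIso_evalTrans_app_of_injective R I
  injective P _ := injective_tensorFunctor_obj R P
  projective I _ := projective_homFunctor_obj R I
  projective_regular := inferInstance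
  isZero X hX := by
    rw [ModuleCat.isZero_iff_subsingleton]
    refine subsingleton_of_forall_eq 0 fun z => ?_
    by_contra hz
    obtain ⟨f, hf⟩ := exists_hom_tensor_regular_apply_ne_zero R hz
    exact hf (by rw [hX f]; rfl)
  epi_iff {X Y} g := by
    rw [ModuleCat.epi_iff_surjective]
    constructor
    · intro hg f
      obtain ⟨f', hf'⟩ := hg f.hom
      exact ⟨ModuleCat.ofHom (show MatlisDual R Λ →ₗ[Λ] X from f'), ModuleCat.hom_ext hf'⟩
    · intro hg f
      obtain ⟨f', hf'⟩ := hg (ModuleCat.ofHom (show MatlisDual R Λ →ₗ[Λ] Y from f))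
      exact ⟨f'.hom, congrArg ModuleCat.Hom.hom hf'⟩

variable {Λ}

theorem isBass_iff (X : ModuleCat.{u} Λ) :
    IsBass Λ Λ (MatlisDual R Λ) X ↔
      IsBassObject (tensorHomAdjunction Λ Λ (MatlisDual R Λ)) (ModuleCat.of Λ (MatlisDual R Λ))
        (ModuleCat.of Λ Λ) X := by
  have h := isDualizing_matlisDual R Λ
  constructor
  · intro hX
    refine ⟨fun i => subsingleton_of_forall_eq 0 (hX.ext_eq_zero (i + 1) (by lia)), fun i => ?_, ?_⟩
    · exact (h.isZero_leftDerived_iff _ i).1 (hX.tor_isZero (i + 1) (by lia))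
    · exact (ConcreteCategory.isIso_iff_bijective _).2 hX.static
  · intro hX
    refine ⟨fun i hi e => ?_, fun i hi => ?_,
      (ConcreteCategory.isIso_iff_bijective _).1 hX.isIso_counit⟩
    · obtain ⟨i, rfl⟩ := Nat.exists_eq_add_of_le' hi
      exact (hX.perp i).elim _ _
    · obtain ⟨i, rfl⟩ := Nat.exists_eq_add_of_le' hi
      exact (h.isZero_leftDerived_iff _ i).2 (hX.perp_right i)

variable (Λ) in
/-- For every simple module `T` there is a quotient presentation of `T` as in
`HasPerpCover`, and `ω` has projective dimension at most `n`. -/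
def SimplesHavePerpCover (n : ℕ) : Prop :=
  HasProjectiveDimensionLT (ModuleCat.of Λ (MatlisDual R Λ)) (n + 1) ∧
    ∀ T : ModuleCat.{u} Λ, IsSimpleModule Λ T →
      HasPerpCover (ModuleCat.of Λ (MatlisDual R Λ)) T

theorem hasProjectiveDimensionLT_matlisDual {n : ℕ}
    (h : ∀ T : ModuleCat.{u} Λ, IsSimpleModule Λ T →
      Subsingleton (Ext (ModuleCat.of Λ (MatlisDual R Λ)) T (n + 1))) :
    HasProjectiveDimensionLT (ModuleCat.of Λ (MatlisDual R Λ)) (n + 1) :=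
  have := IsArtinianRing.of_artinAlgebra R Λ
  have : Module.Finite Λ (ModuleCat.of Λ (MatlisDual R Λ)) :=
    inferInstanceAs (Module.Finite Λ (MatlisDual R Λ))
  ModuleCat.hasProjectiveDimensionLT_of_simple n _ h

/-- If `ω` has finite projective dimension and `Λ` has finite injective dimension, then these
dimensions agree. -/
theorem hasProjectiveDimensionLT_matlisDual_iff {n d : ℕ}
    (hn : HasProjectiveDimensionLT (ModuleCat.of Λ (MatlisDual R Λ)) n)
    (hd : HasInjectiveDimensionLT (ModuleCat.of.{u} Λ Λ) d) (m : ℕ) :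
    HasProjectiveDimensionLT (ModuleCat.of Λ (MatlisDual R Λ)) (m + 1) ↔
      HasInjectiveDimensionLT (ModuleCat.of.{u} Λ Λ) (m + 1) := by
  have h := isDualizing_matlisDual R Λ
  constructor
  · intro hm
    -- The Bass cover of `Λ` splits, so `Λ` inherits the bound `m` from the module covering it.
    refine (h.hasBassCover_of_subsingleton_ext hd fun i hi => ?_).hasInjectiveDimensionLT
    exact HasProjectiveDimensionLT.subsingleton _ (m + 1) (i + 1) (by lia) _
  · intro hm
    -- Finiteness of `pd ω` starts a descent. Writing a simple `T` as `Λ/K`, its top `Ext` from `ω`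
    -- lies between that of `Λ`, zero by the bound on `id Λ`, and one of `K` beyond `pd ω`.
    suffices key : ∀ k, HasProjectiveDimensionLT (ModuleCat.of Λ (MatlisDual R Λ)) (m + k + 1) →
        HasProjectiveDimensionLT (ModuleCat.of Λ (MatlisDual R Λ)) (m + 1) from
      key n (hasProjectiveDimensionLT_of_ge _ n _ (by lia))
    intro k
    induction k with
    | zero => exact id
    | succ k ih =>
      intro hk
      refine ih (hasProjectiveDimensionLT_matlisDual R fun T hT => ?_)
      have := IsSimpleModule.nontrivial Λ T
      obtain ⟨x, hx⟩ := exists_ne (0 : T)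
      have hs : Function.Surjective (LinearMap.toSpanSingleton Λ T x) :=
        IsSimpleModule.toSpanSingleton_surjective Λ hx
      exact (LinearMap.shortExact_shortComplexKer hs).subsingleton_ext_X₃
        (HasInjectiveDimensionLT.subsingleton _ (m + 1) _ (by lia) _)
        (HasProjectiveDimensionLT.subsingleton _ (m + (k + 1) + 1) _ (by lia) _)

theorem WithBot.eq_of_forall_le_iff_of_eq_bot_iff {x y : WithBot ℕ∞} (hb : x = ⊥ ↔ y = ⊥)
    (h : ∀ m : ℕ, x ≤ m ↔ y ≤ m) : x = y := by
  induction x with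
  | bot => exact (hb.1 rfl).symm
  | coe x =>
    induction y with
    | bot => exact hb.2 rfl
    | coe y =>
      have h' : ∀ m : ℕ, x ≤ m ↔ y ≤ m := fun m => by
        simpa only [← WithBot.coe_natCast, WithBot.coe_le_coe] using h m
      have key : ∀ a b : ℕ∞, (∀ m : ℕ, b ≤ m → a ≤ m) → a ≤ b := by
        intro a b hab
        induction b using ENat.recTopCoe with
        | top => exact le_top
        | coe m => exact hab m le_rfl
      rw [le_antisymm (key x y fun m => (h' m).2) (key y x fun m => (h' m).1)]

/-- `Λ` has finite length, so covers of simple modules yield one of `Λ`, whose injective dimension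
is thus finite. Both its left and right injective dimensions are then equal to `pd ω`. -/
theorem isGorensteinAlgebra_of_simplesHavePerpCover {n : ℕ} (h : SimplesHavePerpCover R Λ n) :
    IsGorensteinAlgebra Λ ∧ injectiveDimension (ModuleCat.of.{u} Λ Λ) ≤ n := by
  have := IsArtinianRing.of_artinAlgebra R Λ
  obtain ⟨d, hd⟩ := ((isDualizing_matlisDual R Λ).hasPerpCover_of_isFiniteLength h.2 Λ
    (isFiniteLength_iff_isNoetherian_isArtinian.2 ⟨inferInstance, inferInstance⟩)
    ).hasInjectiveDimensionLT
  have key := hasProjectiveDimensionLT_matlisDual_iff R h.1 hd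
  refine ⟨⟨?_, ?_⟩, ?_⟩
  · refine WithBot.eq_of_forall_le_iff_of_eq_bot_iff ?_ fun m => ?_
    · rw [injectiveDimension_eq_bot_iff, injectiveDimension_eq_bot_iff,
        ModuleCat.isZero_iff_subsingleton, ModuleCat.isZero_iff_subsingleton]
    · rw [injectiveDimension_le_iff, injectiveDimension_le_iff]
      exact (key m).symm.trans (MatlisDual.hasProjectiveDimensionLT_iff R Λ m)
  · exact lt_top_iff_ne_top.2 ((injectiveDimension_ne_top_iff _).2
      ⟨d, hasInjectiveDimensionLT_of_ge _ d _ (Nat.le_succ d)⟩)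
  · exact (injectiveDimension_le_iff _ n).2 ((key n).1 h.1)

theorem hasInjectiveDimensionLT_of_isGorensteinAlgebra {n : ℕ} (h : IsGorensteinAlgebra Λ)
    (hn : injectiveDimension (ModuleCat.of.{u} Λ Λ) ≤ n) :
    HasInjectiveDimensionLT (ModuleCat.of.{u} Λ Λ) (n + 1) ∧
      HasProjectiveDimensionLT (ModuleCat.of Λ (MatlisDual R Λ)) (n + 1) :=
  ⟨(injectiveDimension_le_iff _ n).1 hn, (MatlisDual.hasProjectiveDimensionLT_iff R Λ n).2
    ((injectiveDimension_le_iff _ n).1 (h.1 ▸ hn))⟩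

theorem hasBassCover_iff (n : ℕ) (M : ModuleCat.{u} Λ) :
    HasBassCover (tensorHomAdjunction Λ Λ (MatlisDual R Λ)) (ModuleCat.of Λ (MatlisDual R Λ))
        (ModuleCat.of Λ Λ) n M ↔
      ∃ (X W : ModuleCat.{u} Λ) (f : X ⟶ W) (g : W ⟶ M) (w : f ≫ g = 0),
        (ShortComplex.mk f g w).ShortExact ∧ IsBass Λ Λ (MatlisDual R Λ) X ∧
          injectiveDimension W ≤ n := by
  simp only [isBass_iff, injectiveDimension_le_iff]
  rfl

theorem simplesHavePerpCover_of_hasBassCover {n : ℕ}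
    (h : ∀ T : ModuleCat.{u} Λ, IsSimpleModule Λ T →
      HasBassCover (tensorHomAdjunction Λ Λ (MatlisDual R Λ)) (ModuleCat.of Λ (MatlisDual R Λ))
        (ModuleCat.of Λ Λ) n T) : SimplesHavePerpCover R Λ n :=
  ⟨hasProjectiveDimensionLT_matlisDual R fun T hT => (h T hT).subsingleton_ext,
    fun T hT => (h T hT).hasPerpCover⟩

theorem hasBassCover_of_shortExact {n : ℕ} {T : ModuleCat.{u} Λ}
    (h : ∃ (X W : ModuleCat.{u} Λ) (f : T ⟶ X) (g : X ⟶ W) (w : f ≫ g = 0),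
      (ShortComplex.mk f g w).ShortExact ∧ IsBass Λ Λ (MatlisDual R Λ) X ∧
        injectiveDimension W < n) :
    HasBassCover (tensorHomAdjunction Λ Λ (MatlisDual R Λ)) (ModuleCat.of Λ (MatlisDual R Λ))
      (ModuleCat.of Λ Λ) n T := by
  obtain ⟨X, W, f, g, w, hS, hX, hW⟩ := h
  exact (isDualizing_matlisDual R Λ).hasBassCover_X₁_of_hasInjectiveDimensionLT hS
    ((isBass_iff R X).1 hX) (injectiveDimension_lt_iff.1 hW)

theorem exists_shortExact_of_hasInjectiveDimensionLT {n d : ℕ}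
    (hn : HasProjectiveDimensionLT (ModuleCat.of Λ (MatlisDual R Λ)) (n + 1))
    (hd : HasInjectiveDimensionLT (ModuleCat.of.{u} Λ Λ) d) (T : ModuleCat.{u} Λ) :
    ∃ (X W : ModuleCat.{u} Λ) (f : T ⟶ X) (g : X ⟶ W) (w : f ≫ g = 0),
      (ShortComplex.mk f g w).ShortExact ∧ IsBass Λ Λ (MatlisDual R Λ) X ∧
        injectiveDimension W < n := by
  have h := isDualizing_matlisDual R Λ
  simp only [isBass_iff, injectiveDimension_lt_iff]
  cases n with
  -- Dimension less than `0` forces the cokernel to be zero; `ω` is projective here, so `T` itself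
  -- is Bass.
  | zero =>
    have hZ : IsZero (ModuleCat.of Λ PUnit.{u + 1}) := ModuleCat.isZero_of_subsingleton _
    refine ⟨T, ModuleCat.of Λ PUnit, 𝟙 T, 0, comp_zero, ModuleCat.shortExact_mk _ _ _
      (fun _ _ hxy => hxy) (fun y => ⟨0, Subsingleton.elim (α := PUnit) _ _⟩) (fun y _ => ⟨y, rfl⟩),
      h.isBassObject_of_perp hd fun i => ?_, hZ.hasInjectiveDimensionLT_zero⟩
    exact HasProjectiveDimensionLT.subsingleton _ (0 + 1) (i + 1) (by lia) _
  | succ n =>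
    obtain ⟨I, Y, f, g, w, _, hS⟩ := exists_shortExact_injective T
    refine h.exists_shortExact_of_hasBassCover hS
      (h.hasBassCover_of_subsingleton_ext hd fun i hi => ?_)
    exact hS.subsingleton_ext_X₃ (subsingleton_ext_of_injective _ i)
      (HasProjectiveDimensionLT.subsingleton _ (n + 1 + 1) _ (by lia) _)

end ArtinAlgebra

/-! ### Cycles and boundaries of complexes -/

namespace CochainComplex

section

variable {C : Type*} [Category* C] [Abelian C] (K : CochainComplex C ℤ)

theorem iCycles_toCycles (i j : ℤ) : K.iCycles i ≫ K.toCycles i j = 0 := by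
  rw [← cancel_mono (K.iCycles j), Category.assoc, K.toCycles_i, K.iCycles_d, zero_comp]

theorem exact_iCycles_d {i j : ℤ} (hij : i + 1 = j) :
    (ShortComplex.mk (K.iCycles i) (K.d i j) (K.iCycles_d i j)).Exact :=
  ShortComplex.exact_of_f_is_kernel _ (K.cyclesIsKernel i j (by simpa using hij))

theorem exact_toCycles_homologyπ {i j : ℤ} (hij : i + 1 = j) :
    (ShortComplex.mk (K.toCycles i j) (K.homologyπ j) (K.toCycles_comp_homologyπ i j)).Exact :=
  ShortComplex.exact_of_g_is_cokernel _ (K.homologyIsCokernel i j (by simp; lia))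

theorem shortExact_iCycles_toCycles {i j : ℤ} (hij : i + 1 = j) (hK : K.ExactAt j) :
    (ShortComplex.mk (K.iCycles i) (K.toCycles i j) (K.iCycles_toCycles i j)).ShortExact := by
  refine { exact := ?_, mono_f := inferInstanceAs (Mono (K.iCycles i)), epi_g := ?_ }
  · let φ : ShortComplex.mk (K.iCycles i) (K.toCycles i j) (K.iCycles_toCycles i j) ⟶
        ShortComplex.mk (K.iCycles i) (K.d i j) (K.iCycles_d i j) :=
      { τ₁ := 𝟙 _, τ₂ := 𝟙 _, τ₃ := K.iCycles j }
    have : Epi φ.τ₁ := inferInstanceAs (Epi (𝟙 _))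
    have : IsIso φ.τ₂ := inferInstanceAs (IsIso (𝟙 _))
    have : Mono φ.τ₃ := inferInstanceAs (Mono (K.iCycles j))
    exact (ShortComplex.exact_iff_of_epi_of_isIso_of_mono φ).2 (K.exact_iCycles_d hij)
  · exact (K.exact_toCycles_homologyπ hij).epi_f (hK.isZero_homology.eq_of_tgt _ _)

theorem exists_shortExact_boundaries {i j : ℤ} (hij : i + 1 = j) :
    ∃ (Z : C) (p : K.X i ⟶ Z) (q : Z ⟶ K.cycles j) (wp : K.iCycles i ≫ p = 0)
      (wq : q ≫ K.homologyπ j = 0), (ShortComplex.mk _ _ wp).ShortExact ∧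
        (ShortComplex.mk _ _ wq).ShortExact := by
  have hfac := image.fac (K.toCycles i j)
  have wp : K.iCycles i ≫ factorThruImage (K.toCycles i j) = 0 := by
    rw [← cancel_mono (image.ι (K.toCycles i j)), Category.assoc, hfac, iCycles_toCycles, zero_comp]
  have wq : image.ι (K.toCycles i j) ≫ K.homologyπ j = 0 := by
    rw [← cancel_epi (factorThruImage (K.toCycles i j)), image.fac_assoc,
      K.toCycles_comp_homologyπ, comp_zero]
  refine ⟨image (K.toCycles i j), factorThruImage _, image.ι _, wp, wq,
    { exact := ?_, mono_f := inferInstanceAs (Mono (K.iCycles i)),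
      epi_g := inferInstanceAs (Epi (factorThruImage _)) },
    { exact := ?_, mono_f := inferInstanceAs (Mono (image.ι _)),
      epi_g := inferInstanceAs (Epi (K.homologyπ j)) }⟩
  · let φ : ShortComplex.mk (K.iCycles i) (factorThruImage (K.toCycles i j)) wp ⟶
        ShortComplex.mk (K.iCycles i) (K.d i j) (K.iCycles_d i j) :=
      { τ₁ := 𝟙 _, τ₂ := 𝟙 _, τ₃ := image.ι (K.toCycles i j) ≫ K.iCycles j
        comm₂₃ := by simp }
    have : Epi φ.τ₁ := inferInstanceAs (Epi (𝟙 _))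
    have : IsIso φ.τ₂ := inferInstanceAs (IsIso (𝟙 _))
    have : Mono φ.τ₃ := inferInstanceAs (Mono (image.ι (K.toCycles i j) ≫ K.iCycles j))
    exact (ShortComplex.exact_iff_of_epi_of_isIso_of_mono φ).2 (K.exact_iCycles_d hij)
  · let φ : ShortComplex.mk (K.toCycles i j) (K.homologyπ j) (K.toCycles_comp_homologyπ i j) ⟶
        ShortComplex.mk (image.ι (K.toCycles i j)) (K.homologyπ j) wq :=
      { τ₁ := factorThruImage _, τ₂ := 𝟙 _, τ₃ := 𝟙 _ }
    have : Epi φ.τ₁ := inferInstanceAs (Epi (factorThruImage _))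
    have : IsIso φ.τ₂ := inferInstanceAs (IsIso (𝟙 _))
    have : Mono φ.τ₃ := inferInstanceAs (Mono (𝟙 _))
    exact (ShortComplex.exact_iff_of_epi_of_isIso_of_mono φ).1 (K.exact_toCycles_homologyπ hij)

theorem isZero_cycles {i : ℤ} (h : IsZero (K.X i)) : IsZero (K.cycles i) :=
  h.of_mono (K.iCycles i)

theorem exactAt_of_quasiIso_single {T : C} {K : CochainComplex C ℤ}
    (φ : (HomologicalComplex.single C (ComplexShape.up ℤ) 0).obj T ⟶ K) [QuasiIso φ] {i : ℤ}
    (hi : i ≠ 0) : K.ExactAt i :=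
  (exactAt_iff_of_quasiIsoAt φ i).1 (HomologicalComplex.exactAt_single_obj _ _ T i hi)

/-- The cohomology in degree `0` of a complex quasi-isomorphic to `T`. -/
noncomputable def homologyIsoOfQuasiIsoSingle {T : C} {K : CochainComplex C ℤ}
    (φ : (HomologicalComplex.single C (ComplexShape.up ℤ) 0).obj T ⟶ K) [QuasiIso φ] :
    K.homology 0 ≅ T :=
  (isoOfQuasiIsoAt φ 0).symm ≪≫ HomologicalComplex.singleObjHomologySelfIso _ 0 T

end

end CochainComplex

/-! ### Covers extracted from complexes -/

namespace CategoryTheory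

open Abelian

variable {B : Type u} [Ring B]

theorem HasPerpCover.X₃ {W : ModuleCat.{u} B} {S : ShortComplex (ModuleCat.{u} B)}
    (hS : S.ShortExact) (h₁ : Perp W S.X₁) (h₂ : HasPerpCover W S.X₂) : HasPerpCover W S.X₃ := by
  obtain ⟨X, V, a, b, w, hV, hX, hd⟩ := h₂
  have hw : ∀ x, b (a x) = 0 := fun x => congrArg (fun q => q.hom x) w
  have hSw : ∀ x, S.g (S.f x) = 0 := fun x => congrArg (fun q => q.hom x) S.zero
  let φ : V →ₗ[B] S.X₃ := S.g.hom ∘ₗ b.hom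
  have hφ : Function.Surjective φ := hS.surjective_g.comp hV.surjective_g
  refine ⟨_, V, _, ModuleCat.ofHom φ, _, LinearMap.shortExact_shortComplexKer hφ, ?_, hd⟩
  let L := ModuleCat.of B (LinearMap.ker φ)
  obtain ⟨ψ, hψ⟩ := hS.exists_hom_apply_eq (K := L)
    (ModuleCat.ofHom (b.hom ∘ₗ (LinearMap.ker φ).subtype)) (fun x => x.2)
  replace hψ : ∀ x : L, S.f (ψ x) = b x.1 := hψ
  let s : X ⟶ L := ModuleCat.ofHom (LinearMap.codRestrict _ a.hom
    (fun x => (congrArg S.g (hw x)).trans (map_zero S.g.hom)))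
  have hsψ : s ≫ ψ = 0 := by
    refine ModuleCat.hom_ext (LinearMap.ext fun x => hS.injective_f ?_)
    exact (hψ (s x)).trans ((hw x).trans (map_zero S.f.hom).symm)
  refine Perp.X₂ (ModuleCat.shortExact_mk s ψ hsψ ?_ ?_ ?_) hX h₁
  · exact fun x y hxy => hV.injective_f (congrArg (fun z : L => z.1) hxy)
  · intro z
    obtain ⟨v, hv⟩ := hV.surjective_g (S.f z)
    exact ⟨⟨v, (congrArg S.g hv).trans (hSw z)⟩, hS.injective_f ((hψ _).trans hv)⟩
  · intro y hy
    obtain ⟨x, hx⟩ := hV.exists_apply_eq (y := y.1)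
      ((hψ y).symm.trans ((congrArg S.f hy).trans (map_zero S.f.hom)))
    exact ⟨x, Subtype.ext hx⟩

theorem HasPerpCover.of_iso {W M N : ModuleCat.{u} B} (hM : HasPerpCover W M) (e : M ≅ N) :
    HasPerpCover W N := by
  obtain ⟨X, V, f, g, w, hS, h⟩ := hM
  refine ⟨X, V, f, g ≫ e.hom, by rw [reassoc_of% w, zero_comp],
    ShortComplex.shortExact_of_iso ?_ hS, h⟩
  exact ShortComplex.isoMk (Iso.refl _) (Iso.refl _) e
    ((Category.id_comp _).trans (Category.comp_id _).symm) (Category.id_comp _)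

variable {C : Type*} [Category* C] [Abelian C]
  {F : C ⥤ ModuleCat.{u} B} {G : ModuleCat.{u} B ⥤ C} [F.Additive] [G.Additive] [HasExt C]

theorem HasBassCover.of_iso {adj : F ⊣ G} {W M N : ModuleCat.{u} B} {A : C} {m : ℕ}
    (hM : HasBassCover adj W A m M) (e : M ≅ N) : HasBassCover adj W A m N := by
  obtain ⟨X, V, f, g, w, hS, h⟩ := hM
  refine ⟨X, V, f, g ≫ e.hom, by rw [reassoc_of% w, zero_comp],
    ShortComplex.shortExact_of_iso ?_ hS, h⟩
  exact ShortComplex.isoMk (Iso.refl _) (Iso.refl _) e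
    ((Category.id_comp _).trans (Category.comp_id _).symm) (Category.id_comp _)

theorem HasBassCover.of_le {adj : F ⊣ G} {W M : ModuleCat.{u} B} {A : C} {m n : ℕ}
    (hM : HasBassCover adj W A m M) (h : m ≤ n) : HasBassCover adj W A n M := by
  obtain ⟨X, V, f, g, w, hS, hX, hV⟩ := hM
  exact ⟨X, V, f, g, w, hS, hX, hasInjectiveDimensionLT_of_ge V (m + 1) (n + 1) (by lia)⟩

theorem Perp.of_isZero (W : ModuleCat.{u} B) {M : ModuleCat.{u} B} (hM : IsZero M) : Perp W M :=
  fun i => have := hM.hasInjectiveDimensionLT_zero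
    HasInjectiveDimensionLT.subsingleton M 0 (i + 1) (Nat.zero_le _) W

/-- The approximations obtained from a bounded complex in the Bass class quasi-isomorphic
to `T`. -/
theorem IsDualizing.hasPerpCover_of_complex [EnoughProjectives C] {adj : F ⊣ G}
    {W : ModuleCat.{u} B} {A : C} (h : IsDualizing adj W A) {T : ModuleCat.{u} B} (hT : ¬ IsZero T)
    {Y : CochainComplex (ModuleCat.{u} B) ℤ}
    (φ : (HomologicalComplex.single (ModuleCat.{u} B) (ComplexShape.up ℤ) 0).obj T ⟶ Y)
    [QuasiIso φ] {a : ℤ} {n : ℕ} (hY₁ : Y.IsStrictlyGE a) (hY₂ : Y.IsStrictlyLE (a + n))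
    (hY : ∀ i, IsBassObject adj W A (Y.X i)) :
    HasPerpCover W T ∧ Subsingleton (Ext W T (n + 1)) := by
  have hex : ∀ i : ℤ, i ≠ 0 → Y.ExactAt i := fun i hi =>
    CochainComplex.exactAt_of_quasiIso_single φ hi
  have e := CochainComplex.homologyIsoOfQuasiIsoSingle φ
  have hY0 : ¬ IsZero (Y.X 0) := fun h0 => hT
    (((Y.isZero_cycles h0).of_epi (Y.homologyπ 0)).of_iso e.symm)
  -- Since `T` is nonzero, degree `0` lies in the range `[a, a + n]`, so at most `n` steps separate
  -- it from the top.
  have ha : a ≤ 0 := by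
    by_contra! ha
    exact hY0 (Y.isZero_of_isStrictlyGE a 0 ha)
  have hb : 0 ≤ a + n := by
    by_contra! hb
    exact hY0 (Y.isZero_of_isStrictlyLE (a + n) 0 hb)
  -- Descend from the top degree, where the cycles are a Bass module, with one application of
  -- `hasBassCover_kernel` per degree.
  have key : ∀ (k : ℕ) (i : ℤ), 0 ≤ i → i + k = a + n → HasBassCover adj W A k (Y.cycles i) := by
    intro k
    induction k with
    | zero =>
      intro i hi hik
      have h0 : Y.d i (i + 1) = 0 :=
        (Y.isZero_of_isStrictlyLE (a + n) (i + 1) (by lia)).eq_of_tgt _ _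
      have := Y.isIso_iCycles i (i + 1) (by simp) h0
      exact (h.hasBassCover_zero (hY i)).of_iso (asIso (Y.iCycles i)).symm
    | succ k ih =>
      intro i hi hik
      exact h.hasBassCover_kernel (Y.shortExact_iCycles_toCycles rfl (hex (i + 1) (by lia))) (hY i)
        (ih (i + 1) (by lia) (by push_cast at hik; lia))
  have hZ : HasBassCover adj W A n (Y.cycles 0) := by
    obtain ⟨k, hk⟩ := Int.eq_ofNat_of_zero_le hb
    exact (key k 0 le_rfl (by lia)).of_le (by lia)
  -- Ascend from below the complex. Thus `T` is the quotient of the degree `0` cycles by boundaries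
  -- that lie in `Perp W`.
  have key' : ∀ (k : ℕ) (i : ℤ), i < 0 → i < a + k → Perp W (Y.cycles i) := by
    intro k
    induction k with
    | zero =>
      exact fun i _ hi => Perp.of_isZero W
        (Y.isZero_cycles (Y.isZero_of_isStrictlyGE a i (by simpa using hi)))
    | succ k ih =>
      intro i hi hik
      exact Perp.X₃ (Y.shortExact_iCycles_toCycles (i := i - 1) (by lia) (hex i (by lia)))
        (ih (i - 1) (by lia) (by push_cast at hik; lia)) (hY (i - 1)).perp
  obtain ⟨Z, p, q, wp, wq, hp, hq⟩ := Y.exists_shortExact_boundaries (i := -1) (j := 0) (by lia)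
  have hZp : Perp W Z := by
    refine Perp.X₃ hp ?_ (hY (-1)).perp
    exact key' (-a).toNat (-1) (by lia) (by lia)
  refine ⟨(HasPerpCover.X₃ hq hZp hZ.hasPerpCover).of_iso e, ?_⟩
  exact Retract.subsingleton_ext_right (Y := Y.homology 0) e.symm.retract
    (hq.subsingleton_ext_X₃ hZ.subsingleton_ext (hZp (n + 1)))

/-- The bound above gives the degree `0` cycles finite injective dimension. The complex may be
unbounded below, but in negative degrees each step down raises the `Ext` degree until it exceeds the
projective dimension of `W`. -/
theorem hasPerpCover_of_injective_complex {W T : ModuleCat.{u} B} {n : ℕ}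
    (hW : HasProjectiveDimensionLT W n) {V : CochainComplex (ModuleCat.{u} B) ℤ} {b : ℤ}
    (hV₁ : V.IsStrictlyLE b) (hV : ∀ i, Injective (V.X i)) (hex : ∀ i : ℤ, i ≠ 0 → V.ExactAt i)
    (e : V.homology 0 ≅ T) : HasPerpCover W T := by
  have key : ∀ (k : ℕ) (i : ℤ), 0 ≤ i → b < i + k → HasInjectiveDimensionLT (V.cycles i) k := by
    intro k
    induction k with
    | zero =>
      exact fun i _ hi => (V.isZero_cycles (V.isZero_of_isStrictlyLE b i
        (by simpa using hi))).hasInjectiveDimensionLT_zero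
    | succ k ih =>
      intro i hi hik
      have := hV i
      exact (V.shortExact_iCycles_toCycles rfl (hex (i + 1) (by lia))).hasInjectiveDimensionLT_X₁ k
        (ih (i + 1) (by lia) (by push_cast at hik; lia))
        (inferInstanceAs (HasInjectiveDimensionLT (V.X i) (k + 1)))
  have key' : ∀ (k : ℕ) (i : ℤ), i < 0 → ∀ j, n ≤ j + 1 + k →
      Subsingleton (Ext W (V.cycles i) (j + 1)) := by
    intro k
    induction k with
    | zero => exact fun i _ j hj => HasProjectiveDimensionLT.subsingleton W n (j + 1) hj _
    | succ k ih =>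
      intro i hi j hj
      have := hV (i - 1)
      exact (V.shortExact_iCycles_toCycles (i := i - 1) (by lia)
        (hex i (by lia))).subsingleton_ext_X₃ (subsingleton_ext_of_injective W (I := V.X (i - 1)) j)
          (ih (i - 1) (by lia) (j + 1) (by lia))
  obtain ⟨Z, p, q, wp, wq, hp, hq⟩ := V.exists_shortExact_boundaries (i := -1) (j := 0) (by lia)
  have := hV (-1)
  have hZp : Perp W Z :=
    Perp.X₃ hp (fun j => key' n (-1) (by lia) j (by lia)) (Perp.of_injective W (V.X (-1)))
  exact HasPerpCover.of_iso ⟨Z, V.cycles 0, q, V.homologyπ 0, wq, hq, hZp, (b + 1).toNat,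
    key _ 0 le_rfl (by lia)⟩ e

end CategoryTheory

/-! ### Resolutions of complexes -/

namespace CochainComplex

variable {C : Type*} [Category* C] [Abelian C]

theorem quasiIso_unop_opEquivalence_inverse_map {K L : CochainComplex Cᵒᵖ ℤ} (φ : K ⟶ L)
    [QuasiIso φ] : QuasiIso ((opEquivalence C).inverse.map φ).unop := by
  rw [quasiIso_iff]
  intro m
  have h : QuasiIsoAt φ (-m) := inferInstance
  rw [quasiIsoAt_iff' φ (-(m + 1)) (-m) (-(m - 1)) (by simp; lia) (by simp; lia)] at h
  rw [quasiIsoAt_iff' _ (m - 1) m (m + 1) (by simp) (by simp), ← ShortComplex.quasiIso_opMap_iff]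
  exact h

/-- Complexes that are bounded above have projective resolutions. -/
theorem exists_quasiIso_projective [EnoughProjectives C] (K : CochainComplex C ℤ) (n : ℤ)
    [K.IsStrictlyLE n] : ∃ (P : CochainComplex C ℤ) (π : P ⟶ K),
      QuasiIso π ∧ (∀ i, Projective (P.X i)) ∧ P.IsStrictlyLE n := by
  have : ((opEquivalence C).functor.obj (.op K)).IsStrictlyGE (-n) := by
    rw [isStrictlyGE_iff]
    exact fun i hi => (K.isZero_of_isStrictlyLE n (-i) (by lia)).op
  obtain ⟨L, i, hi, hL, hL'⟩ := Plus.modelCategoryQuillen.exists_quasiIso_injective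
    ((opEquivalence C).functor.obj (.op K)) (-n)
  have := quasiIso_unop_opEquivalence_inverse_map i
  refine ⟨((opEquivalence C).inverse.obj L).unop, ((opEquivalence C).inverse.map i).unop ≫
    ((opEquivalence C).unitIso.hom.app (.op K)).unop, inferInstance, fun m => ?_, ?_⟩
  · have := hL (-m)
    exact inferInstanceAs (Projective (L.X (-m)).unop)
  · rw [isStrictlyLE_iff]
    exact fun m hm => (L.isZero_of_isStrictlyGE (-n) (-m) (by lia)).unop

theorem quasiIso_iff_acyclic_mappingCone {K L : CochainComplex C ℤ} (φ : K ⟶ L) :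
    QuasiIso φ ↔ (mappingCone φ).Acyclic := by
  rw [← HomotopyCategory.quotient_obj_mem_subcategoryAcyclic_iff_acyclic]
  refine Iff.trans ?_ ((HomotopyCategory.subcategoryAcyclic C).trW_iff_of_distinguished _
    (HomotopyCategory.mappingCone_triangleh_distinguished φ))
  rw [← HomotopyCategory.quasiIso_eq_trW_subcategoryAcyclic]
  exact (HomotopyCategory.quotient_map_mem_quasiIso_iff φ).symm

theorem projective_mappingCone_X {K L : CochainComplex C ℤ} (φ : K ⟶ L)
    (hK : ∀ i, Projective (K.X i)) (hL : ∀ i, Projective (L.X i)) (i : ℤ) :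
    Projective ((mappingCone φ).X i) := by
  have := hK (i + 1)
  have := hL i
  exact Projective.of_iso (HomologicalComplex.homotopyCofiber.XIsoBiprod φ i (i + 1) (by simp)).symm
    inferInstance

end CochainComplex

/-! ### Dualizing adjunctions on complexes of projectives -/

namespace CategoryTheory

open Abelian

section

variable {C D : Type*} [Category* C] [Category* D] [Abelian C] [Abelian D]
  {F : C ⥤ D} {G : D ⥤ C} [F.Additive] [G.Additive] [HasExt C] {adj : F ⊣ G} {W : D} {A : C}

/-- Every object of cycles is an arbitrarily high syzygy, so its higher `Ext` into `A` vanishes. By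
`exact_iff` it remains to extend maps into `A` from cycles to terms; no bound on the complex is
needed. -/
theorem IsDualizing.acyclic_map (h : IsDualizing adj W A) {d : ℕ}
    (hd : HasInjectiveDimensionLT A d) {K : CochainComplex C ℤ} (hK : K.Acyclic)
    (hP : ∀ i, Projective (K.X i)) : ((F.mapHomologicalComplex _).obj K).Acyclic := by
  have key : ∀ (k : ℕ) (i : ℤ) (j : ℕ), d ≤ j + k → Subsingleton (Ext (K.cycles i) A (j + 1)) := by
    intro k
    induction k with
    | zero => exact fun i j hj => HasInjectiveDimensionLT.subsingleton A d (j + 1) (by lia) _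
    | succ k ih =>
      intro i j hj
      have := hP i
      exact (K.shortExact_iCycles_toCycles rfl (hK (i + 1))).subsingleton_ext_left_X₁
        (subsingleton_ext_of_projective (P := K.X i) A j) (ih (i + 1) (j + 1) (by lia))
  intro i
  rw [HomologicalComplex.exactAt_iff' _ (i - 1) i (i + 1) (by simp) (by simp)]
  refine (h.exact_iff (K.sc' (i - 1) i (i + 1))).2 fun (f : K.X i ⟶ A)
    (hf : K.d (i - 1) i ≫ f = 0) => ?_
  have hE := K.shortExact_iCycles_toCycles rfl (hK (i + 1))
  have : Epi (K.toCycles (i - 1) i) :=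
    (K.shortExact_iCycles_toCycles (i := i - 1) (by lia) (hK i)).epi_g
  have := hE.epi_g
  have hf' : K.iCycles i ≫ f = 0 := by
    rw [← cancel_epi (K.toCycles (i - 1) i), K.toCycles_i_assoc, hf, comp_zero]
  obtain ⟨g, hg⟩ := (K.shortExact_iCycles_toCycles rfl
    (hK (i + 1 + 1))).exists_desc_of_subsingleton_ext (key d (i + 1 + 1) 0 (by lia))
    (hE.exact.desc f hf')
  refine ⟨g, ?_⟩
  have h1 := hE.exact.g_desc f hf'
  rw [← hg] at h1
  exact (K.toCycles_i_assoc i (i + 1) g).symm.trans h1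

/-- The mapping cone is an acyclic complex of projectives and `F` commutes with cones. This allows
comparing `Hom(ω, I)`, possibly unbounded above, with a bounded above resolution of it. -/
theorem IsDualizing.quasiIso_map (h : IsDualizing adj W A) {d : ℕ}
    (hd : HasInjectiveDimensionLT A d) {K L : CochainComplex C ℤ} (φ : K ⟶ L) [QuasiIso φ]
    (hK : ∀ i, Projective (K.X i)) (hL : ∀ i, Projective (L.X i)) :
    QuasiIso ((F.mapHomologicalComplex _).map φ) := by
  rw [CochainComplex.quasiIso_iff_acyclic_mappingCone]
  exact fun i => (h.acyclic_map hd
    ((CochainComplex.quasiIso_iff_acyclic_mappingCone φ).1 inferInstance)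
    (CochainComplex.projective_mappingCone_X φ hK hL) i).of_iso
      (CochainComplex.mappingCone.mapHomologicalComplexIso φ F)

end

end CategoryTheory

/-! ### Injective resolutions and extension groups -/

namespace CochainComplex

open Abelian

variable {C : Type*} [Category* C] [Abelian C] [HasExt C] {K : CochainComplex C ℤ} {a : ℤ}

-- From the bottom upwards, the cycles are quotients of injective objects by injective objects.
omit [HasExt C] in
theorem hasInjectiveDimensionLT_cycles (hI : ∀ i, Injective (K.X i)) (ha : K.IsStrictlyGE a)
    {b : ℤ} (hex : ∀ i < b, K.ExactAt i) {i : ℤ} (hi : i < b) :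
    HasInjectiveDimensionLT (K.cycles i) 1 := by
  suffices key : ∀ (k : ℕ) (i : ℤ), i < b → i < a + k → HasInjectiveDimensionLT (K.cycles i) 1 from
    key (i + 1 - a).toNat i hi (by lia)
  intro k
  induction k with
  | zero =>
    intro i _ hi
    have := (K.isZero_cycles (K.isZero_of_isStrictlyGE a i
      (by simpa using hi))).hasInjectiveDimensionLT_zero
    exact hasInjectiveDimensionLT_of_ge _ 0 1 (by lia)
  | succ k ih =>
    intro i hi hik
    have := hI (i - 1)
    have := ih (i - 1) (by lia) (by push_cast at hik; lia)
    exact (K.shortExact_iCycles_toCycles (i := i - 1) (by lia)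
      (hex i hi)).hasInjectiveDimensionLT_X₃ 1
        (inferInstanceAs (HasInjectiveDimensionLT (K.X (i - 1)) 1))
        (hasInjectiveDimensionLT_of_ge _ 1 2 (by lia))

variable (hI : ∀ i, Injective (K.X i)) (ha : K.IsStrictlyGE a) (hex : ∀ i ≠ 0, K.ExactAt i)

include hI ha hex

theorem subsingleton_ext_cycles_zero_iff (W : C) (j : ℕ) :
    Subsingleton (Ext W (K.cycles 0) (j + 1)) ↔ Subsingleton (Ext W (K.homology 0) (j + 1)) := by
  obtain ⟨Z, p, q, wp, wq, hp, hq⟩ := K.exists_shortExact_boundaries (i := -1) (j := 0) (by lia)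
  have := hI (-1)
  have := hasInjectiveDimensionLT_cycles hI ha (b := 0) (fun i hi => hex i hi.ne) (i := -1) (by lia)
  have hZ : HasInjectiveDimensionLT Z 1 := hp.hasInjectiveDimensionLT_X₃ 1
    (inferInstanceAs (HasInjectiveDimensionLT (K.X (-1)) 1))
    (hasInjectiveDimensionLT_of_ge _ 1 2 (by lia))
  have hZ' : ∀ k, Subsingleton (Ext W Z (k + 1)) := fun k =>
    HasInjectiveDimensionLT.subsingleton Z 1 (k + 1) (by lia) W
  exact ⟨fun h => hq.subsingleton_ext_X₃ h (hZ' _), fun h => hq.subsingleton_ext_X₂ (hZ' j) h⟩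

theorem subsingleton_ext_cycles_iff (W : C) (i j : ℕ) :
    Subsingleton (Ext W (K.cycles i) (j + 1)) ↔
      Subsingleton (Ext W (K.homology 0) (i + j + 1)) := by
  induction i generalizing j with
  | zero => simpa using subsingleton_ext_cycles_zero_iff hI ha hex W j
  | succ i ih =>
    rw [show i + 1 + j + 1 = i + (j + 1) + 1 by lia, ← ih]
    have hS := K.shortExact_iCycles_toCycles (i := i) (j := (i + 1 : ℕ)) (by push_cast; rfl)
      (hex _ (by lia))
    have := hI i
    have hX := fun k => subsingleton_ext_of_injective W (I := K.X i) k
    exact ⟨fun h => hS.subsingleton_ext_X₁ h (hX _), fun h => hS.subsingleton_ext_X₃ (hX _) h⟩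

/-- A map killed by the differential is a map into the cycles of degree `i + 1`, and lifting all of
these is the vanishing of `Ext^1` into the cycles of degree `i`. -/
theorem exists_lift_iff (W : C) (i : ℕ) :
    (∀ f : W ⟶ K.X (i + 1), f ≫ K.d (i + 1) (i + 1 + 1) = 0 → ∃ g, g ≫ K.d i (i + 1) = f) ↔
      Subsingleton (Ext W (K.homology 0) (i + 1)) := by
  rw [← subsingleton_ext_cycles_iff hI ha hex W i 0]
  have hS := K.shortExact_iCycles_toCycles (i := i) rfl (hex _ (by lia))
  have := hI i
  constructor
  · refine fun h => hS.subsingleton_ext_one_of_exists_lift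
      (subsingleton_ext_of_injective W (I := K.X i) 0) fun f => ?_
    obtain ⟨g, hg⟩ := h (f ≫ K.iCycles (i + 1)) (by simp)
    refine ⟨g, (cancel_mono (K.iCycles ((i : ℤ) + 1))).1 ?_⟩
    simpa using hg
  · intro h f hf
    obtain ⟨g, hg⟩ := hS.exists_lift_of_subsingleton_ext h
      (K.liftCycles f (i + 1 + 1) (by simp) hf)
    refine ⟨g, ?_⟩
    have h1 := congrArg (· ≫ K.iCycles ((i : ℤ) + 1)) hg
    simpa using h1

end CochainComplex

section HomComplex

open Abelian CochainComplex

variable {Λ : Type u} [Ring Λ] {ω : Type u} [AddCommGroup ω] [Module Λ ω] [Module Λᵐᵒᵖ ω]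
  [SMulCommClass Λ Λᵐᵒᵖ ω]

theorem exactAt_homComplex_iff (K : CochainComplex (ModuleCat.{u} Λ) ℤ) (i : ℤ) :
    (homComplex Λ Λ ω K).ExactAt (i + 1) ↔
      ∀ f : ModuleCat.of Λ ω ⟶ K.X (i + 1), f ≫ K.d (i + 1) (i + 1 + 1) = 0 →
        ∃ g, g ≫ K.d i (i + 1) = f := by
  rw [HomologicalComplex.exactAt_iff' _ i (i + 1) (i + 1 + 1) (by simp) (by simp),
    ShortComplex.moduleCat_exact_iff]
  constructor
  · intro h f hf
    obtain ⟨g, hg⟩ := h (show BimodHom Λ ω (K.X (i + 1)) from f.hom)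
      (congrArg ModuleCat.Hom.hom hf)
    exact ⟨ModuleCat.ofHom (show ω →ₗ[Λ] K.X i from g), ModuleCat.hom_ext hg⟩
  · intro h f hf
    obtain ⟨g, hg⟩ := h (ModuleCat.ofHom (show ω →ₗ[Λ] K.X (i + 1) from f)) (ModuleCat.hom_ext hf)
    exact ⟨(show BimodHom Λ ω (K.X i) from g.hom), congrArg ModuleCat.Hom.hom hg⟩

/-- The cohomology of `Hom(ω, I)` for an injective resolution `I` of `T` vanishes in degree
`i ≥ 1` if and only if `Ext^i(ω, T)` does. -/
theorem IsInjRes.exactAt_homComplex_iff {T : ModuleCat.{u} Λ}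
    {I : CochainComplex (ModuleCat.{u} Λ) ℤ}
    {ι : (HomologicalComplex.single (ModuleCat.{u} Λ) (ComplexShape.up ℤ) 0).obj T ⟶ I}
    (h : IsInjRes ι) (i : ℕ) : (homComplex Λ Λ ω I).ExactAt (i + 1) ↔
      Subsingleton (Ext (ModuleCat.of Λ ω) T (i + 1)) := by
  obtain ⟨_, hI, a, ha⟩ := h
  rw [_root_.exactAt_homComplex_iff, exists_lift_iff hI ha
    (fun i hi => exactAt_of_quasiIso_single ι hi)]
  have e := homologyIsoOfQuasiIsoSingle ι
  exact ⟨e.symm.retract.subsingleton_ext_right, e.retract.subsingleton_ext_right⟩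

theorem isInjRes_injectiveResolution {T : ModuleCat.{u} Λ} (I : InjectiveResolution T) :
    IsInjRes (M := (HomologicalComplex.single (ModuleCat.{u} Λ) (ComplexShape.up ℤ) 0).obj T)
      I.ι' :=
  ⟨inferInstanceAs (QuasiIso I.ι'), fun _ => inferInstance, 0, inferInstance⟩

theorem supRHom_single_le_iff (T : ModuleCat.{u} Λ) (n : ℕ) :
    supRHom Λ Λ ω ((HomologicalComplex.single (ModuleCat.{u} Λ) (ComplexShape.up ℤ) 0).obj T) ≤ n ↔
      ∀ i : ℕ, n ≤ i → Subsingleton (Ext (ModuleCat.of Λ ω) T (i + 1)) := by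
  rw [supRHom, sSup_le_iff]
  constructor
  · intro h i hi
    have hres := isInjRes_injectiveResolution (InjectiveResolution.of T)
    rw [← hres.exactAt_homComplex_iff, HomologicalComplex.exactAt_iff_isZero_homology]
    by_contra hne
    have h1 := h _ ⟨_, _, _, hres, hne, rfl⟩
    have h2 : (((i : ℤ) + 1 : ℤ) : ℝ) ≤ (n : ℝ) := EReal.coe_le_coe_iff.1 h1
    have h3 : (i : ℤ) + 1 ≤ n := by exact_mod_cast h2
    lia
  · rintro h _ ⟨I, ι, i, hres, hne, rfl⟩
    by_contra! hi
    have h2 : (n : ℝ) < (i : ℝ) := EReal.coe_lt_coe_iff.1 hi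
    have h3 : (n : ℤ) < i := by exact_mod_cast h2
    -- As `n ≥ 0`, a degree above `n` is positive, so only `Ext` groups of positive degree occur.
    obtain ⟨k, rfl⟩ : ∃ k : ℕ, i = k + 1 := ⟨(i - 1).toNat, by lia⟩
    exact hne ((hres.exactAt_homComplex_iff k).2 (h k (by lia))).isZero_homology

end HomComplex

/-! ### The conditions on complexes for an artin algebra -/

section ArtinAlgebra

open Abelian CochainComplex

variable (R : Type u) {Λ : Type u} [CommRing R] [IsArtinianRing R] [Ring Λ] [Algebra R Λ]
  [Module.Finite R Λ]

/-- The finite bound forces `T` into the Bass class of complexes. Then `ω ⊗ P` is a bounded above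
complex of injectives with cohomology `T`, to which `hasPerpCover_of_injective_complex` applies. -/
theorem simplesHavePerpCover_of_bassInjectiveDimension_le {n : ℕ}
    (h : ∀ T : ModuleCat.{u} Λ, IsSimpleModule Λ T →
      bassInjectiveDimension Λ Λ (MatlisDual R Λ)
        ((HomologicalComplex.single (ModuleCat.{u} Λ) (ComplexShape.up ℤ) 0).obj T) ≤ n) :
    SimplesHavePerpCover R Λ n := by
  have h' : ∀ T : ModuleCat.{u} Λ, IsSimpleModule Λ T →
      IsBassComplex Λ Λ (MatlisDual R Λ)
        ((HomologicalComplex.single (ModuleCat.{u} Λ) (ComplexShape.up ℤ) 0).obj T) ∧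
      supRHom Λ Λ (MatlisDual R Λ)
        ((HomologicalComplex.single (ModuleCat.{u} Λ) (ComplexShape.up ℤ) 0).obj T) ≤ n := by
    intro T hT
    have hT := h T hT
    rw [bassInjectiveDimension] at hT
    split_ifs at hT with hB
    · exact ⟨hB, hT⟩
    · exact absurd (top_le_iff.1 hT) (EReal.coe_ne_top n)
  have hpd := hasProjectiveDimensionLT_matlisDual R (n := n) fun T hT =>
    (supRHom_single_le_iff T n).1 (h' T hT).2 n le_rfl
  refine ⟨hpd, fun T hT => ?_⟩
  obtain ⟨⟨-, I, ι, hι, -, P, π, hπ, hq⟩, -⟩ := h' T hT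
  have := hι.quasiIso
  obtain ⟨b, hb⟩ := hπ.bounded
  refine hasPerpCover_of_injective_complex (V := tensorComplex Λ Λ (MatlisDual R Λ) P) (b := b)
    hpd ?_ (fun i => ?_) (fun i hi => ?_)
    (isoOfQuasiIsoAt (((tensorFunctor Λ Λ (MatlisDual R Λ)).mapHomologicalComplex _).map π ≫
      evalComplex Λ Λ (MatlisDual R Λ) I) 0 ≪≫ homologyIsoOfQuasiIsoSingle ι)
  · rw [isStrictlyLE_iff]
    exact fun i hi => (tensorFunctor Λ Λ (MatlisDual R Λ)).map_isZero
      (P.isZero_of_isStrictlyLE b i hi)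
  · have := hπ.projective i
    exact injective_tensorFunctor_obj R (P.X i)
  · exact (exactAt_iff_of_quasiIsoAt (((tensorFunctor Λ Λ (MatlisDual R Λ)).mapHomologicalComplex
      _).map π ≫ evalComplex Λ Λ (MatlisDual R Λ) I) i).2 (exactAt_of_quasiIso_single ι hi)

theorem isIso_evalComplex {I : CochainComplex (ModuleCat.{u} Λ) ℤ} (hI : ∀ i, Injective (I.X i)) :
    IsIso (evalComplex Λ Λ (MatlisDual R Λ) I) := by
  have : ∀ i, IsIso ((evalComplex Λ Λ (MatlisDual R Λ) I).f i) := fun i =>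
    have := hI i
    isIso_evalTrans_app_of_injective R (I.X i)
  exact HomologicalComplex.Hom.isIso_of_components _

/-- `pd ω ≤ n` bounds the cohomology of `Hom(ω, I)`, so a truncation of it has a projective
resolution `P`. Tensoring preserves the quasi-isomorphism `P → Hom(ω, I)` of complexes of
projectives, and evaluation is invertible on injectives. -/
theorem isBassComplex_single {n d : ℕ}
    (hn : HasProjectiveDimensionLT (ModuleCat.of Λ (MatlisDual R Λ)) (n + 1))
    (hd : HasInjectiveDimensionLT (ModuleCat.of.{u} Λ Λ) d) (T : ModuleCat.{u} Λ) :
    IsBassComplex Λ Λ (MatlisDual R Λ)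
      ((HomologicalComplex.single (ModuleCat.{u} Λ) (ComplexShape.up ℤ) 0).obj T) := by
  have hres := isInjRes_injectiveResolution (InjectiveResolution.of T)
  let I := (InjectiveResolution.of T).cochainComplex
  have hI : ∀ i, Injective (I.X i) := hres.injective
  have hGE : (homComplex Λ Λ (MatlisDual R Λ) I).IsStrictlyGE 0 := by
    rw [isStrictlyGE_iff]
    exact fun i hi => (homFunctor Λ Λ (MatlisDual R Λ)).map_isZero
      (I.isZero_of_isStrictlyGE 0 i hi)
  have hLE : (homComplex Λ Λ (MatlisDual R Λ) I).IsLE n := by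
    rw [isLE_iff]
    intro i hi
    obtain ⟨k, rfl⟩ : ∃ k : ℕ, i = k + 1 := ⟨(i - 1).toNat, by lia⟩
    exact (hres.exactAt_homComplex_iff k).2
      (HasProjectiveDimensionLT.subsingleton _ (n + 1) (k + 1) (by lia) T)
  obtain ⟨P, π, hπ, hP, hP'⟩ :=
    exists_quasiIso_projective ((homComplex Λ Λ (MatlisDual R Λ) I).truncLE n) n
  have hG : ∀ i, Projective ((homComplex Λ Λ (MatlisDual R Λ) I).X i) := fun i =>
    have := hI i
    projective_homFunctor_obj R (I.X i)
  refine ⟨⟨0, 0, inferInstance, inferInstance⟩, I, _, hres, ⟨0, n, inferInstance, hLE⟩, P,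
    π ≫ ιTruncLE _ n, ⟨inferInstance, hP, n, hP'⟩, ?_⟩
  have := (isDualizing_matlisDual R Λ).quasiIso_map hd (π ≫ ιTruncLE _ n) hP hG
  have := isIso_evalComplex R hI
  infer_instance

theorem bassInjectiveDimension_single_le {n d : ℕ}
    (hn : HasProjectiveDimensionLT (ModuleCat.of Λ (MatlisDual R Λ)) (n + 1))
    (hd : HasInjectiveDimensionLT (ModuleCat.of.{u} Λ Λ) d) (T : ModuleCat.{u} Λ) :
    bassInjectiveDimension Λ Λ (MatlisDual R Λ)
      ((HomologicalComplex.single (ModuleCat.{u} Λ) (ComplexShape.up ℤ) 0).obj T) ≤ n := by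
  rw [bassInjectiveDimension, if_pos (isBassComplex_single R hn hd T), supRHom_single_le_iff]
  exact fun i hi => HasProjectiveDimensionLT.subsingleton _ (n + 1) (i + 1) (by lia) T

/-- Truncate an injective resolution at degree `n`. The only noninjective term is the module of
`n`-cycles, whose higher `Ext` groups from `ω` are those of `T` in degrees above `n`, which vanish.
-/
theorem exists_quasiIso_isBass {n d : ℕ}
    (hn : HasProjectiveDimensionLT (ModuleCat.of Λ (MatlisDual R Λ)) (n + 1))
    (hd : HasInjectiveDimensionLT (ModuleCat.of.{u} Λ Λ) d) (T : ModuleCat.{u} Λ) :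
    ∃ (Y : CochainComplex (ModuleCat.{u} Λ) ℤ)
      (φ : (HomologicalComplex.single (ModuleCat.{u} Λ) (ComplexShape.up ℤ) 0).obj T ⟶ Y),
      QuasiIso φ ∧ (∃ a : ℤ, Y.IsStrictlyGE a ∧ Y.IsStrictlyLE (a + n)) ∧
      ∀ i : ℤ, IsBass Λ Λ (MatlisDual R Λ) (Y.X i) := by
  have h := isDualizing_matlisDual R Λ
  have hres := isInjRes_injectiveResolution (InjectiveResolution.of T)
  let I := (InjectiveResolution.of T).cochainComplex
  let S : CochainComplex (ModuleCat.{u} Λ) ℤ :=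
    (HomologicalComplex.single (ModuleCat.{u} Λ) (ComplexShape.up ℤ) 0).obj T
  let ι : S ⟶ I := (InjectiveResolution.of T).ι'
  have hι : QuasiIso ι := hres.quasiIso
  have hI : ∀ i, Injective (I.X i) := hres.injective
  have hS : S.IsStrictlyLE n := isStrictlyLE_of_le S 0 n (by lia)
  have hq : QuasiIso (truncLEMap ι n) := by
    rw [quasiIso_truncLEMap_iff]
    exact fun i _ => inferInstance
  have hX : ∀ i : ℤ, i < n → Injective ((I.truncLE n).X i) := fun i hi =>
    Injective.of_iso (I.truncLEXIso n i hi).symm (hI i)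
  -- `T` sits in degree `0 ≤ n`, so truncation does not change it and its inclusion can be inverted.
  refine ⟨I.truncLE n, inv (ιTruncLE S n) ≫ truncLEMap ι n, inferInstance, ⟨0, ?_, ?_⟩,
    fun i => (isBass_iff R _).2 (h.isBassObject_of_perp hd ?_)⟩
  · rw [isStrictlyGE_iff]
    intro i hi
    exact (I.isZero_of_isStrictlyGE 0 i hi).of_iso (I.truncLEXIso n i (by lia))
  · rw [zero_add]
    infer_instance
  · obtain hi | rfl | hi := lt_trichotomy i n
    · have := hX i hi
      exact Perp.of_injective _ _
    · refine Perp.of_iso (fun j => ?_) (I.truncLEXIsoCycles n).symm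
      rw [subsingleton_ext_cycles_iff (a := 0) hI inferInstance
        (fun i hi => exactAt_of_quasiIso_single ι hi)]
      exact HasProjectiveDimensionLT.subsingleton _ (n + 1) (n + j + 1) (by lia) _
    · exact Perp.of_isZero _ ((I.truncLE n).isZero_of_isStrictlyLE n i hi)

end ArtinAlgebra

/-! ### The equivalence of the five conditions -/

theorem corollary5p6 (R Λ : Type u) [CommRing R] [IsArtinianRing R] [Ring Λ] [Algebra R Λ]
    [Module.Finite R Λ] (n : ℕ) :
    List.TFAE [
      IsGorensteinAlgebra Λ ∧ injectiveDimension (ModuleCat.of.{u} Λ Λ) ≤ n,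
      ∀ T : ModuleCat.{u} Λ, IsSimpleModule Λ T →
        bassInjectiveDimension Λ Λ (MatlisDual R Λ)
          ((HomologicalComplex.single (ModuleCat.{u} Λ) (ComplexShape.up ℤ) 0).obj T) ≤ n,
      ∀ T : ModuleCat.{u} Λ, IsSimpleModule Λ T →
        ∃ (Y : CochainComplex (ModuleCat.{u} Λ) ℤ)
          (φ : (HomologicalComplex.single (ModuleCat.{u} Λ) (ComplexShape.up ℤ) 0).obj T ⟶ Y),
          QuasiIso φ ∧ (∃ a : ℤ, Y.IsStrictlyGE a ∧ Y.IsStrictlyLE (a + n)) ∧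
          ∀ i : ℤ, IsBass Λ Λ (MatlisDual R Λ) (Y.X i),
      ∀ T : ModuleCat.{u} Λ, IsSimpleModule Λ T →
        ∃ (X W : ModuleCat.{u} Λ) (f : T ⟶ X) (g : X ⟶ W) (w : f ≫ g = 0),
          (ShortComplex.mk f g w).ShortExact ∧ IsBass Λ Λ (MatlisDual R Λ) X ∧
          injectiveDimension W < n,
      ∀ T : ModuleCat.{u} Λ, IsSimpleModule Λ T →
        ∃ (X W : ModuleCat.{u} Λ) (f : X ⟶ W) (g : W ⟶ T) (w : f ≫ g = 0),
          (ShortComplex.mk f g w).ShortExact ∧ IsBass Λ Λ (MatlisDual R Λ) X ∧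
          injectiveDimension W ≤ n] := by
  have h := isDualizing_matlisDual R Λ
  have hdim : IsGorensteinAlgebra Λ ∧ injectiveDimension (ModuleCat.of.{u} Λ Λ) ≤ n → _ :=
    fun hΛ => hasInjectiveDimensionLT_of_isGorensteinAlgebra R hΛ.1 hΛ.2
  tfae_have 1 → 2 := fun hΛ T _ => bassInjectiveDimension_single_le R (hdim hΛ).2 (hdim hΛ).1 T
  tfae_have 1 → 3 := fun hΛ T _ => exists_quasiIso_isBass R (hdim hΛ).2 (hdim hΛ).1 T
  tfae_have 1 → 4 := fun hΛ T _ =>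
    exists_shortExact_of_hasInjectiveDimensionLT R (hdim hΛ).2 (hdim hΛ).1 T
  tfae_have 2 → 1 := fun hT => isGorensteinAlgebra_of_simplesHavePerpCover R
    (simplesHavePerpCover_of_bassInjectiveDimension_le R hT)
  tfae_have 3 → 1 := by
    intro hT
    have key : ∀ T : ModuleCat.{u} Λ, IsSimpleModule Λ T →
        HasPerpCover (ModuleCat.of Λ (MatlisDual R Λ)) T ∧
          Subsingleton (Abelian.Ext (ModuleCat.of Λ (MatlisDual R Λ)) T (n + 1)) := by
      intro T hT'
      obtain ⟨Y, φ, hφ, ⟨a, ha, ha'⟩, hY⟩ := hT T hT'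
      refine h.hasPerpCover_of_complex (fun h0 => ?_) φ ha ha' fun i => (isBass_iff R _).1 (hY i)
      have := IsSimpleModule.nontrivial Λ T
      exact not_subsingleton T ((ModuleCat.isZero_iff_subsingleton).1 h0)
    exact isGorensteinAlgebra_of_simplesHavePerpCover R
      ⟨hasProjectiveDimensionLT_matlisDual R fun T hT' => (key T hT').2, fun T hT' => (key T hT').1⟩
  tfae_have 4 → 5 := fun hT T hT' =>
    (hasBassCover_iff R n T).1 (hasBassCover_of_shortExact R (hT T hT'))
  tfae_have 5 → 1 := fun hT => isGorensteinAlgebra_of_simplesHavePerpCover R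
    (simplesHavePerpCover_of_hasBassCover R fun T hT' => (hasBassCover_iff R n T).2 (hT T hT'))
  tfae_finish
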